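/- Let $d\ge 2$ and $p>2d$ (so $p>4$ when $d=2$). For $\sigma,s\in\{\pm1\}^{\mathbb Z^d}$ and a finite set $X\subset\mathbb Z^d$ let $$H_X(\sigma_X|s)=-J\sum_{\substack{\{x,y\}\subset X\\|x-y|=1}}(\sigma_x\sigma_y-1)+\sum_{\substack{\{x,y\}\subset X\\x\ne y}}\frac{\sigma_x\sigma_y-1}{|x-y|^p}-J\sum_{\substack{x\in X,\,y\notin X\\|x-y|=1}}(\sigma_xs_y-1)+\sum_{x\in X,\,y\notin X}\frac{\sigma_xs_y-1}{|x-y|^p},$$ where $|\cdot|$ is the Euclidean norm and the first two sums run over unordered pairs. A configuration $s$ is an infinite volume ground state if $H_X(\sigma_X|s)\ge H_X(s_X|s)$ for all finite $X$ and all $\sigma_X\in\{\pm1\}^X$; its sector is the set of infinite volume ground states that differ from $s$ only on a finite set, and the sector is trivial if it is $\{s\}$. Let $$J_c=\sum_{y\in\mathbb Z^d,\ y_1>0}\frac{y_1}{|y|^p}.$$ For an integer $h\ge1$ let $\sigma^{(h)}_x=\operatorname{sign}\big(\sin(\pi(x_1+\tfrac12)/h)\big)$, and let $e_{\rm s}(h)$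 be its energy per site, that is, the average over $0\le x_1<2h$ (the other coordinates of $x$ being $0$) of $$\tfrac12\sum_{y\ne x}\Big(-J\,\mathbf 1_{|x-y|=1}+|x-y|^{-p}\Big)\big(\sigma^{(h)}_x\sigma^{(h)}_y-1\big).$$ An optimal periodic striped configuration is one obtained by translations and rotations of the lattice from $\sigma^{(h^*)}$, where $h^*$ is a minimizer of $e_{\rm s}$ over the positive integers. There exists $\varepsilon>0$ (depending on $d$ and $p$) such that, if $J_c-\varepsilon<J<J_c$, then $e_{\rm s}$ has a minimizer, and all the optimal periodic striped configurations are infinite volume ground states with trivial sectors. -/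

import Mathlib

/-- Sites of the lattice `ℤ^d`. -/
abbrev Site (d : ℕ) : Type := Fin d → ℤ

/-- Spin configurations on `ℤ^d`; the group `ℤˣ` is exactly `{1, -1}`. -/
abbrev SpinConfig (d : ℕ) : Type := Site d → ℤˣ

/-- The Euclidean distance `|x - y|` between two lattice sites. -/
noncomputable def siteDist {d : ℕ} (x y : Site d) : ℝ :=
  Real.sqrt (∑ i, ((x i : ℝ) - (y i : ℝ)) ^ 2)

open Classical in
/-- The energy of the pair of distinct sites `{x, y}` carrying the spins `a`, `b`:
`-J (a b - 1)` if `x`, `y` are nearest neighbours, plus `(a b - 1) / |x - y| ^ p`. -/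
noncomputable def pairEnergy {d : ℕ} (J p : ℝ) (x y : Site d) (a b : ℤˣ) : ℝ :=
  (if siteDist x y = 1 then -J * (((a : ℤ) : ℝ) * ((b : ℤ) : ℝ) - 1) else 0)
    + (((a : ℤ) : ℝ) * ((b : ℤ) : ℝ) - 1) / siteDist x y ^ p

open Classical in
/-- The energy `H_X(σ_X | s)` of the configuration `σ` in the finite set `X` with boundary
condition `s` outside `X`. Only the restriction of `σ` to `X` and the restriction of `s` to the
complement of `X` enter. The factor `1 / 2` makes every unordered pair inside `X` count once. -/
noncomputable def hamiltonian {d : ℕ} (J p : ℝ) (X : Finset (Site d)) (σ s : SpinConfig d) : ℝ :=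
  (1 / 2) * ∑ x ∈ X, ∑ y ∈ X.erase x, pairEnergy J p x y (σ x) (σ y)
    + ∑ x ∈ X, ∑' y : {y : Site d // y ∉ X}, pairEnergy J p x y (σ x) (s y)

/-- Infinite volume ground states: no change of the spins in a finite set lowers the energy. -/
def IsGroundState {d : ℕ} (J p : ℝ) (s : SpinConfig d) : Prop :=
  ∀ (X : Finset (Site d)) (σ : SpinConfig d),
    0 ≤ hamiltonian J p X σ s - hamiltonian J p X s s

/-- The sector of `s`: all the infinite volume ground states that differ from `s` only on a
finite set. -/
def sector {d : ℕ} (J p : ℝ) (s : SpinConfig d) : Set (SpinConfig d) :=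
  {t | IsGroundState J p t ∧ {x | t x ≠ s x}.Finite}

/-- The critical coupling `J_c`, the sum of `y₁ / |y| ^ p` over the sites `y` with `y₁ > 0`. -/
noncomputable def criticalCoupling (d : ℕ) [NeZero d] (p : ℝ) : ℝ :=
  ∑' y : {y : Site d // 0 < y 0}, (y.1 0 : ℝ) / siteDist y.1 0 ^ p

open Classical in
/-- The striped configuration `sign (sin (π (x₁ + 1/2) / h))` with stripes of width `h`, for
`h ≥ 1` (the sine does not vanish then). -/
noncomputable def stripes (d : ℕ) [NeZero d] (h : ℕ) : SpinConfig d :=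
  fun x => if 0 < Real.sin (Real.pi * ((x 0 : ℝ) + 1 / 2) / h) then 1 else -1

/-- The energy attributed to the site `x` in the configuration `s`: every pair of sites shares its
energy equally between its two members. -/
noncomputable def siteEnergy {d : ℕ} (J p : ℝ) (s : SpinConfig d) (x : Site d) : ℝ :=
  (1 / 2) * ∑' y : {y : Site d // y ≠ x}, pairEnergy J p x y (s x) (s y)

/-- The energy per site `e_s(h)` of the striped configuration of width `h`, i.e. the mean of
the site energies over the period `0 ≤ x₁ < 2h` (the configuration does not depend on the other
coordinates). -/
noncomputable def stripeEnergy (d : ℕ) [NeZero d] (J p : ℝ) (h : ℕ) : ℝ :=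
  (∑ k ∈ Finset.range (2 * h), siteEnergy J p (stripes d h) (Pi.single 0 (k : ℤ))) / (2 * (h : ℝ))

/-- `h` is an optimal stripe width: a minimizer of `e_s` over the positive integers. -/
def IsOptimalWidth (d : ℕ) [NeZero d] (J p : ℝ) (h : ℕ) : Prop :=
  1 ≤ h ∧ ∀ k : ℕ, 1 ≤ k → stripeEnergy d J p h ≤ stripeEnergy d J p k

/-- The optimal periodic striped configurations: the configurations obtained from the striped
configuration of an optimal width by translations and rotations of the lattice. -/
def IsOptimalStriped {d : ℕ} [NeZero d] (J p : ℝ) (s : SpinConfig d) : Prop :=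
  ∃ h : ℕ, IsOptimalWidth d J p h ∧
    ∃ (R : Matrix (Fin d) (Fin d) ℤ) (v : Site d), R * R.transpose = 1 ∧ R.det = 1 ∧
      ∀ x, s x = stripes d h (R.mulVec x + v)

/-! A perturbation `t` of a striped configuration `s` on a finite set changes the energy by
`-∑ y, pairWeight y * defect t s y`, where `defect t s y` is the change of the number of pairs of
disagreeing spins at displacement `y` (`hamiltonian_sub_eq`). The proof bounds this below by a positive
multiple of the number of corners of `t`, the sites where walls of two different directions meet.

*Reduction to lines.* Disagreement is subadditive along a path, and the defect at `y` is at most the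
sum of the defects at the components of `y` along the axes; each corner makes the inequality
strict for a displacement `±e_i ± e_j`. As the long range interaction is antiferromagnetic, the energy
difference is at least a sum of energies of lines, in which the interaction at distance `n` is the sum
`lineWeight` of `|y| ^ (-p)` over the transverse directions, plus a constant times the number of corners
(`neg_tsum_pairWeight_mul_defect`, `card_cornerSites_le`).

*Lines.* Poisson summation shows that `lineWeight` is a superposition of decaying exponentials
(`exists_laplace_measure`). For the weights `r ^ n`, the field `D` exerted on a site by the sites on its
left evolves multiplicatively within a stripe and is reflected at a wall. The sum of `D` over a stripe
of width `h` is therefore an explicit function of `D` at its left end, and it is at most its value for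
periodic stripes of width `h`, up to the increment of a quadratic potential in `D`
(`stripe_inequality`); the increments telescope. Hence the energy of a line is at least the sum over its
walls of `widthEnergy h`, with `h` the distance to the next wall, which is an equality for periodic
stripes (`tsum_wallWeight_widthEnergy_le`). This plays the role of reflection positivity, without
boundary terms. With `e` the minimum of `widthEnergy h / h` (the optimal energy per site) and `l`
so large that walls at distance at least `l` have energy at least `e * l`, the energy of a line
relative to `s` is at least `e` times the increase of the number of sites within a distance `l` to the
right of a wall
(`mul_tsum_nearWall_le`).

*Corners.* In `s` every site is near a wall of exactly one direction. In `t` a site may be near walls of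
several directions, but then a corner lies within a box of side `l`, so that the total gain is at most
`d * |e| * (l + 1) ^ d` per corner (`tsum_sum_nearIndicator_sub_le`). A finite perturbation without
corners is trivial (`eq_of_cornerSites_eq_empty`). It remains to see that `|e| * (l + 1) ^ d` is small for
`J` close to `J_c`. With `τ = J_c - J` one has
`-2τ ≤ widthEnergy h ≤ -2τ + O(h ^ (1 - p / 2))`, which gives `|e| * (l + 1) ^ d = O(τ * H ^ (d - 1))`
with `H` of order `τ ^ (-1 / (p / 2 - 1))`, and this tends to `0` exactly because `p > 2d`. -/

/-! ### Laplace representation of the transverse sums of a power law -/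

section Laplace
open MeasureTheory Set
open scoped ENNReal

theorem tsum_pi_fin_prod {n : ℕ} (f : Fin n → ℤ → ℝ≥0∞) :
    ∑' z : Fin n → ℤ, ∏ i, f i (z i) = ∏ i, ∑' k, f i k := by
  induction n with
  | zero => simp [tsum_fintype]
  | succ n ih =>
    rw [Fin.prod_univ_succ, ← ih (fun i => f i.succ),
      ← (Fin.consEquiv (fun _ : Fin (n + 1) => ℤ)).tsum_eq, ENNReal.tsum_prod',
      ← ENNReal.tsum_mul_right]
    refine tsum_congr fun a => ?_
    rw [← ENNReal.tsum_mul_left]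
    refine tsum_congr fun b => ?_
    simp [Fin.prod_univ_succ, Fin.consEquiv]

/-- The Cauchy-Schlömilch integral: the substitutions `s ↦ b / (a s)` and `u = a s - b / s` reduce it to
a Gaussian integral. -/
theorem lintegral_exp_neg_sq_sub_div {a b : ℝ} (ha : 0 < a) (hb : 0 < b) :
    ∫⁻ s in Ioi (0 : ℝ), ENNReal.ofReal (Real.exp (-(a * s - b / s) ^ 2)) =
      ENNReal.ofReal (Real.sqrt Real.pi / (2 * a)) := by
  set f : ℝ → ℝ≥0∞ := fun s => ENNReal.ofReal (Real.exp (-(a * s - b / s) ^ 2)) with hf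
  have hfm : Measurable f := by simp only [hf]; fun_prop
  have himg : (fun s : ℝ => b / (a * s)) '' Ioi 0 = Ioi 0 := by
    ext x
    simp only [mem_image, mem_Ioi]
    refine ⟨?_, fun hx => ⟨b / (a * x), by positivity, by field_simp⟩⟩
    rintro ⟨y, hy, rfl⟩
    positivity
  have h1 : ∫⁻ s in Ioi (0 : ℝ), f s = ∫⁻ s in Ioi (0 : ℝ), ENNReal.ofReal (b / (a * s ^ 2)) * f s := by
    conv_lhs => rw [← himg]
    rw [lintegral_image_eq_lintegral_abs_deriv_mul (f' := fun s => -(b / (a * s ^ 2))) measurableSet_Ioi]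
    · refine setLIntegral_congr_fun measurableSet_Ioi fun s hs => ?_
      have hs' : (0 : ℝ) < s := hs
      simp only [hf, abs_neg]
      rw [abs_of_pos (by positivity)]
      congr 4
      have : a * (b / (a * s)) - b / (b / (a * s)) = -(a * s - b / s) := by field_simp; ring
      rw [this, neg_sq]
    · intro x hx
      have hx' : x ≠ 0 := (ne_of_gt hx)
      have := ((hasDerivAt_inv hx').const_mul (b / a)).hasDerivWithinAt (s := Ioi 0)
      have e : (fun s : ℝ => b / (a * s)) = fun s => b / a * s⁻¹ := by
        ext y; rw [← div_div, div_eq_mul_inv]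
      rw [e]
      exact this.congr_deriv (by rw [← div_div, mul_neg, ← div_eq_mul_inv])
    · intro x hx y hy hxy
      have hx' : x ≠ 0 := (ne_of_gt hx)
      have hy' : y ≠ 0 := (ne_of_gt hy)
      simp only at hxy
      field_simp at hxy
      exact hxy.symm
  have himg2 : (fun s : ℝ => a * s - b / s) '' Ioi 0 = univ := by
    refine eq_univ_of_forall fun y => ?_
    set q := Real.sqrt (y ^ 2 + 4 * a * b) with hq
    have hq2 : q ^ 2 = y ^ 2 + 4 * a * b := Real.sq_sqrt (by positivity)
    have hqy : |y| < q := by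
      rw [hq]; refine Real.lt_sqrt_of_sq_lt ?_; rw [sq_abs]; nlinarith [mul_pos ha hb]
    have hpos : 0 < y + q := by linarith [neg_abs_le y]
    refine ⟨(y + q) / (2 * a), by simp only [mem_Ioi]; positivity, ?_⟩
    simp only
    field_simp
    nlinarith
  have h2 : ∫⁻ s in Ioi (0 : ℝ), ENNReal.ofReal (a + b / s ^ 2) * f s = ENNReal.ofReal (Real.sqrt Real.pi) := by
    have hg : ∫⁻ u : ℝ, ENNReal.ofReal (Real.exp (-u ^ 2)) = ENNReal.ofReal (Real.sqrt Real.pi) := by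
      have := integral_gaussian 1
      simp only [div_one, neg_mul, one_mul] at this
      rw [← this, ofReal_integral_eq_lintegral_ofReal]
      · simpa using integrable_exp_neg_mul_sq (b := 1) one_pos
      · exact Filter.Eventually.of_forall fun x => (Real.exp_pos _).le
    rw [← hg, ← setLIntegral_univ fun u : ℝ => ENNReal.ofReal (Real.exp (-u ^ 2)), ← himg2,
      lintegral_image_eq_lintegral_abs_deriv_mul (f' := fun s => a + b / s ^ 2) measurableSet_Ioi]
    · refine setLIntegral_congr_fun measurableSet_Ioi fun s hs => ?_
      have hs' : (0 : ℝ) < s := hs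
      simp only [hf]
      rw [abs_of_pos (by positivity)]
    · intro x hx
      have hx' : x ≠ 0 := (ne_of_gt hx)
      have := (((hasDerivAt_id x).const_mul a).sub ((hasDerivAt_inv hx').const_mul b)).hasDerivWithinAt (s := Ioi 0)
      simp only [id, ← div_eq_mul_inv] at this
      exact this.congr_deriv (by rw [mul_one, mul_neg, sub_neg_eq_add, div_eq_mul_inv])
    · intro x hx y hy hxy
      have hx' : 0 < x := hx
      have hy' : 0 < y := hy
      simp only at hxy
      field_simp at hxy
      have : (x - y) * (a * x * y + b) = 0 := by linear_combination hxy
      rcases mul_eq_zero.1 this with h | h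
      · linarith
      · exfalso; have : 0 < a * x * y + b := by positivity
        linarith
  -- the two expressions for `a * ∫ f` add up to an integral with the Jacobian `a + b / s ^ 2` of `s ↦ a s - b / s`
  have h3 : ENNReal.ofReal (2 * a) * ∫⁻ s in Ioi (0 : ℝ), f s = ENNReal.ofReal (Real.sqrt Real.pi) := by
    rw [← h2, two_mul, ENNReal.ofReal_add ha.le ha.le, add_mul]
    nth_rewrite 2 [h1]
    rw [← lintegral_const_mul _ hfm, ← lintegral_const_mul _ (by fun_prop), ← lintegral_add_left (by fun_prop)]
    refine setLIntegral_congr_fun measurableSet_Ioi fun s hs => ?_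
    have hs' : (0 : ℝ) < s := hs
    rw [ENNReal.ofReal_add ha.le (by positivity), add_mul, ← mul_assoc]
    congr 2
    rw [← ENNReal.ofReal_mul ha.le]
    congr 1
    field_simp
  rw [ENNReal.ofReal_div_of_pos (by positivity), ← h3, mul_comm, ENNReal.mul_div_cancel_right]
  · exact (ENNReal.ofReal_pos.2 (by positivity)).ne'
  · exact ENNReal.ofReal_ne_top

/-- The same integral with the square expanded: up to the factor `1 / a`, it is exponential in `a`. -/
theorem lintegral_exp_neg_sq_mul_sub_div {a b : ℝ} (ha : 0 < a) (hb : 0 < b) :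
    ∫⁻ s in Ioi (0 : ℝ), ENNReal.ofReal (Real.exp (-(s ^ 2 * a ^ 2) - b / s ^ 2)) =
      ENNReal.ofReal (Real.sqrt Real.pi / (2 * a) * Real.exp (-2 * a * Real.sqrt b)) := by
  rw [ENNReal.ofReal_mul (by positivity), ← lintegral_exp_neg_sq_sub_div ha (Real.sqrt_pos.2 hb),
    ← lintegral_mul_const _ (by fun_prop)]
  refine setLIntegral_congr_fun measurableSet_Ioi fun s hs => ?_
  have hs' : s ≠ 0 := (ne_of_gt hs)
  rw [← ENNReal.ofReal_mul (Real.exp_pos _).le, ← Real.exp_add]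
  congr 2
  have := Real.sq_sqrt hb.le
  field_simp
  linear_combination this

theorem summable_exp_neg_mul_int_sq {c : ℝ} (hc : 0 < c) :
    Summable fun k : ℤ => Real.exp (-c * (k : ℝ) ^ 2) := by
  have h : Summable fun n : ℕ => Real.exp (-c * (n : ℝ) ^ 2) := by
    refine Summable.of_nonneg_of_le (fun _ => (Real.exp_pos _).le) (fun n => ?_)
      (Real.summable_exp_nat_mul_iff.2 (neg_lt_zero.2 hc))
    have hn : (n : ℝ) ≤ (n : ℝ) ^ 2 := by exact_mod_cast Nat.le_self_pow two_ne_zero n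
    exact Real.exp_le_exp.2 (by nlinarith)
  exact Summable.of_nat_of_neg (by simpa using h) (by simpa using h)

/-- The inversion formula of the Jacobi theta function. -/
theorem tsum_ofReal_exp_neg_sq {s : ℝ} (hs : 0 < s) :
    ∑' k : ℤ, ENNReal.ofReal (Real.exp (-(s ^ 2 * (k : ℝ) ^ 2))) =
      ENNReal.ofReal (Real.sqrt Real.pi / s) *
        ∑' k : ℤ, ENNReal.ofReal (Real.exp (-(Real.pi ^ 2 * (k : ℝ) ^ 2 / s ^ 2))) := by
  have hpi := Real.pi_pos
  have key := Real.tsum_exp_neg_mul_int_sq (a := s ^ 2 / Real.pi) (by positivity)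
  have e1 : ∀ k : ℤ, -Real.pi * (s ^ 2 / Real.pi) * (k : ℝ) ^ 2 = -(s ^ 2) * (k : ℝ) ^ 2 := by
    intro k; field_simp
  have e2 : ∀ k : ℤ, -Real.pi / (s ^ 2 / Real.pi) * (k : ℝ) ^ 2 =
      -(Real.pi ^ 2 / s ^ 2) * (k : ℝ) ^ 2 := by
    intro k; field_simp
  simp only [e1, e2] at key
  have e3 : 1 / (s ^ 2 / Real.pi) ^ (1 / 2 : ℝ) = Real.sqrt Real.pi / s := by
    rw [← Real.sqrt_eq_rpow, Real.sqrt_div (by positivity), Real.sqrt_sq hs.le, one_div_div]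
  rw [e3] at key
  have e4 : ∀ k : ℤ, -(Real.pi ^ 2 * (k : ℝ) ^ 2 / s ^ 2) = -(Real.pi ^ 2 / s ^ 2) * (k : ℝ) ^ 2 := by
    intro k; ring
  simp only [e4, ← neg_mul]
  rw [← ENNReal.ofReal_tsum_of_nonneg (fun _ => (Real.exp_pos _).le)
      (summable_exp_neg_mul_int_sq (by positivity)),
    ← ENNReal.ofReal_tsum_of_nonneg (fun _ => (Real.exp_pos _).le)
      (summable_exp_neg_mul_int_sq (by positivity)), key, ENNReal.ofReal_mul (by positivity)]

theorem lintegral_rpow_mul_exp_neg_sq {p A : ℝ} (hp : 0 < p) (hA : 0 < A) :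
    ∫⁻ s in Ioi (0 : ℝ), ENNReal.ofReal (s ^ (p - 1) * Real.exp (-(s ^ 2 * A ^ 2))) =
      ENNReal.ofReal (1 / 2 * Real.Gamma (p / 2)) * ENNReal.ofReal (A ^ (-p)) := by
  have h1 := integral_rpow_mul_exp_neg_mul_rpow (p := 2) (q := p - 1) (b := A ^ 2) two_pos
    (by linarith) (by positivity)
  have h2 := integrableOn_rpow_mul_exp_neg_mul_rpow (p := 2) (s := p - 1) (b := A ^ 2)
    (by linarith) two_pos (by positivity)
  have e : ∀ s : ℝ, -(A ^ 2) * s ^ (2 : ℝ) = -(s ^ 2 * A ^ 2) := by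
    intro s; rw [Real.rpow_two]; ring
  simp only [e, sub_add_cancel] at h1 h2
  rw [← ofReal_integral_eq_lintegral_ofReal h2, h1, ← ENNReal.ofReal_mul (by positivity)]
  · congr 1
    rw [← Real.rpow_natCast, ← Real.rpow_mul hA.le]
    have : ((2 : ℕ) : ℝ) * (-p / 2) = -p := by push_cast; ring
    rw [this]; ring
  · refine (ae_restrict_iff' measurableSet_Ioi).2 (Filter.Eventually.of_forall fun s hs => ?_)
    have : (0 : ℝ) < s := hs
    simp only [Pi.zero_apply]
    positivity

/-- A power of `1 / r` times `exp (-r K)` is a superposition of the functions `exp (-r x)`, `x > K`. -/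
theorem lintegral_Ioi_rpow_mul_exp_neg {β r K : ℝ} (hβ : 0 < β) (hr : 0 < r) :
    ∫⁻ x in Ioi K, ENNReal.ofReal ((x - K) ^ (β - 1) * Real.exp (-(r * x))) =
      ENNReal.ofReal (Real.Gamma β) * ENNReal.ofReal (r ^ (-β) * Real.exp (-(r * K))) := by
  have h1 := Real.integral_rpow_mul_exp_neg_mul_Ioi hβ hr
  have h2 := integrableOn_rpow_mul_exp_neg_mul_rpow (p := 1) (s := β - 1) (b := r)
    (by linarith) one_pos hr
  simp only [Real.rpow_one, neg_mul] at h2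
  have h3 : ∫⁻ t in Ioi (0 : ℝ), ENNReal.ofReal (t ^ (β - 1) * Real.exp (-(r * t))) =
      ENNReal.ofReal (Real.Gamma β * r ^ (-β)) := by
    rw [← ofReal_integral_eq_lintegral_ofReal h2, h1, one_div, Real.inv_rpow hr.le,
      Real.rpow_neg hr.le, mul_comm]
    refine (ae_restrict_iff' measurableSet_Ioi).2 (Filter.Eventually.of_forall fun s hs => ?_)
    have : (0 : ℝ) < s := hs
    simp only [Pi.zero_apply]
    positivity
  have hG := Real.Gamma_pos_of_pos hβ
  rw [← ENNReal.ofReal_mul hG.le, ← mul_assoc, ENNReal.ofReal_mul (by positivity), ← h3,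
    ← lintegral_mul_const _ (by fun_prop), ← lintegral_indicator measurableSet_Ioi,
    ← lintegral_indicator measurableSet_Ioi,
    ← lintegral_sub_right_eq_self ((Ioi (0 : ℝ)).indicator _) K]
  refine lintegral_congr fun x => ?_
  simp only [indicator, mem_Ioi, sub_pos]
  split_ifs
  · rw [← ENNReal.ofReal_mul' (Real.exp_pos _).le, mul_assoc, ← Real.exp_add]
    congr 3
    ring
  · rfl

theorem lintegral_Ioi_exp_neg_mul {r K : ℝ} (hr : 0 < r) :
    ∫⁻ x in Ioi K, ENNReal.ofReal (Real.exp (-(r * x))) =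
      ENNReal.ofReal (1 / r * Real.exp (-(r * K))) := by
  have := lintegral_Ioi_rpow_mul_exp_neg (β := 1) (K := K) one_pos hr
  simpa [Real.rpow_neg_one] using this

open Classical in
/-- The power law summed over the transverse directions is completely monotone in the longitudinal
distance `n`. Write the power as an integral of Gaussians `exp (-s² (n² + |z|²))`; invert the theta functions
in the transverse variables, which turns them into a positive combination of functions `exp (-κ / s²)`;
the integral over `s` of `exp (-s² n² - κ / s²)` is then proportional to `exp (-2 n √κ) / n`, and
`1 / n` is itself a Laplace transform. -/
theorem exists_laplace_measure {D : ℕ} {p : ℝ} (hp : (D : ℝ) + 1 < p) :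
    ∃ μ : Measure ℝ, μ (Iic 0) = 0 ∧ ∀ n : ℕ, 1 ≤ n →
      ∑' z : Fin D → ℤ, ENNReal.ofReal (Real.sqrt ((n : ℝ) ^ 2 + ∑ i, (z i : ℝ) ^ 2) ^ (-p)) =
        ∫⁻ l, ENNReal.ofReal (Real.exp (-(n * l))) ∂μ := by
  have hp0 : 0 < p := by have : (0 : ℝ) ≤ D := Nat.cast_nonneg D
                         linarith
  set β : ℝ := (p - 1 - D) / 2 with hβdef
  have hβ : 0 < β := by rw [hβdef]; linarith
  have hpi := Real.pi_pos
  set Q : (Fin D → ℤ) → ℝ := fun z => Real.pi ^ 2 * ∑ i, (z i : ℝ) ^ 2 with hQ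
  have hQ0 : ∀ z, 0 ≤ Q z := fun z => by positivity
  set U : ℝ → ℝ≥0∞ := fun κ => ∑' z, (Ioi (Q z)).indicator
    (fun κ => ENNReal.ofReal ((κ - Q z) ^ (β - 1))) κ with hU
  have hUm : Measurable U := by
    refine Measurable.tsum fun z => Measurable.indicator ?_ measurableSet_Ioi
    fun_prop
  set G : ℝ≥0∞ := ENNReal.ofReal (1 / 2 * Real.Gamma (p / 2)) with hG
  set B : ℝ≥0∞ := ENNReal.ofReal (Real.Gamma β) with hB
  set P : ℝ≥0∞ := ENNReal.ofReal (Real.sqrt Real.pi) with hP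
  have hGpos : 0 < 1 / 2 * Real.Gamma (p / 2) := by
    have := Real.Gamma_pos_of_pos (half_pos hp0); positivity
  have hBpos := Real.Gamma_pos_of_pos hβ
  have hG0 : G ≠ 0 := (ENNReal.ofReal_pos.2 hGpos).ne'
  have hB0 : B ≠ 0 := (ENNReal.ofReal_pos.2 hBpos).ne'
  have hGt : G ≠ ∞ := ENNReal.ofReal_ne_top
  have hBt : B ≠ ∞ := ENNReal.ofReal_ne_top
  -- the theta function turned into a superposition of `exp (-κ / s ^ 2)`
  have hθ : ∀ s : ℝ, 0 < s → B * (ENNReal.ofReal (s ^ (p - 1)) *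
      ∑' z : Fin D → ℤ, ∏ i, ENNReal.ofReal (Real.exp (-(s ^ 2 * (z i : ℝ) ^ 2)))) =
      P ^ D * ∫⁻ κ in Ioi 0, U κ * ENNReal.ofReal (Real.exp (-(κ / s ^ 2))) := by
    intro s hs
    have h1 : ∫⁻ κ in Ioi 0, U κ * ENNReal.ofReal (Real.exp (-(κ / s ^ 2))) =
        ∑' z, B * ENNReal.ofReal (s ^ (2 * β) * Real.exp (-(Q z / s ^ 2))) := by
      simp only [hU, ← ENNReal.tsum_mul_right]
      rw [lintegral_tsum]
      · refine tsum_congr fun z => ?_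
        have := lintegral_Ioi_rpow_mul_exp_neg (K := Q z) hβ
          (show 0 < 1 / s ^ 2 by positivity)
        have e : (1 / s ^ 2) ^ (-β) = s ^ (2 * β) := by
          rw [one_div, Real.inv_rpow (by positivity), Real.rpow_neg (by positivity), inv_inv,
            ← Real.rpow_natCast, ← Real.rpow_mul hs.le]
          norm_num
        rw [e] at this
        simp only [one_div_mul_eq_div] at this
        rw [← this, ← lintegral_indicator measurableSet_Ioi, ← lintegral_indicator measurableSet_Ioi]
        refine lintegral_congr fun κ => ?_
        simp only [indicator, mem_Ioi]
        by_cases hκ : Q z < κ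
        · rw [if_pos hκ, if_pos hκ, if_pos ((hQ0 z).trans_lt hκ), ENNReal.ofReal_mul' (Real.exp_pos _).le]
        · simp [hκ]
      · intro z
        refine (Measurable.mul (Measurable.indicator ?_ measurableSet_Ioi) ?_).aemeasurable
        · fun_prop
        · fun_prop
    rw [h1, tsum_pi_fin_prod (fun _ k => ENNReal.ofReal (Real.exp (-(s ^ 2 * (k : ℝ) ^ 2)))),
      ENNReal.tsum_mul_left, Finset.prod_congr rfl fun i _ => tsum_ofReal_exp_neg_sq hs,
      Finset.prod_mul_distrib, ← tsum_pi_fin_prod, Finset.prod_const, Finset.card_univ, Fintype.card_fin]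
    have h2 : ∀ z : Fin D → ℤ, ∏ i, ENNReal.ofReal (Real.exp (-(Real.pi ^ 2 * (z i : ℝ) ^ 2 / s ^ 2))) =
        ENNReal.ofReal (Real.exp (-(Q z / s ^ 2))) := by
      intro z
      rw [← ENNReal.ofReal_prod_of_nonneg fun _ _ => (Real.exp_pos _).le, ← Real.exp_sum]
      simp only [hQ, Finset.mul_sum, Finset.sum_div, Finset.sum_neg_distrib]
    simp only [h2, ENNReal.ofReal_mul (Real.rpow_pos_of_pos hs (2 * β)).le, ENNReal.tsum_mul_left]
    have h3 : ENNReal.ofReal (s ^ (p - 1)) * ENNReal.ofReal (Real.sqrt Real.pi / s) ^ D =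
        P ^ D * ENNReal.ofReal (s ^ (2 * β)) := by
      rw [hP, ← ENNReal.ofReal_pow (by positivity), ← ENNReal.ofReal_pow (by positivity),
        ← ENNReal.ofReal_mul (by positivity), ← ENNReal.ofReal_mul (by positivity)]
      congr 1
      have : 2 * β = (p - 1) - (D : ℝ) := by rw [hβdef]; ring
      rw [this, Real.rpow_sub hs (p - 1), Real.rpow_natCast, div_pow]
      ring
    rw [← mul_assoc (ENNReal.ofReal (s ^ (p - 1))), h3]
    ring
  -- the density of the Laplace transform of `U κ * exp (-2 n √κ) / n`
  set W : ℝ → ℝ≥0∞ := fun l => ∫⁻ κ in Ioi 0, (if 2 * Real.sqrt κ < l then U κ else 0) with hW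
  have hset : MeasurableSet {x : ℝ × ℝ | 2 * Real.sqrt x.2 < x.1} :=
    measurableSet_lt (by fun_prop) (by fun_prop)
  have hWm : Measurable W := by
    have : Measurable fun x : ℝ × ℝ => if 2 * Real.sqrt x.2 < x.1 then U x.2 else 0 :=
      Measurable.ite hset (hUm.comp measurable_snd) measurable_const
    exact this.lintegral_prod_right
  refine ⟨((G * B)⁻¹ * P ^ D * (P / 2)) • volume.withDensity W, ?_, fun n hn => ?_⟩
  · rw [Measure.smul_apply, withDensity_apply _ measurableSet_Iic, smul_eq_mul]
    have : ∫⁻ l in Iic 0, W l = 0 := by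
      refine setLIntegral_eq_zero measurableSet_Iic fun l hl => ?_
      have hl' : l ≤ 0 := hl
      simp only [hW, Pi.zero_apply]
      refine (lintegral_congr fun κ => ?_).trans lintegral_zero
      rw [if_neg]
      have := Real.sqrt_nonneg κ
      linarith
    rw [this, mul_zero]
  · have hn0 : (0 : ℝ) < n := by exact_mod_cast hn
    have hA : ∀ z : Fin D → ℤ, 0 < Real.sqrt ((n : ℝ) ^ 2 + ∑ i, (z i : ℝ) ^ 2) := fun z => by
      have : 0 ≤ ∑ i, (z i : ℝ) ^ 2 := Finset.sum_nonneg fun i _ => sq_nonneg _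
      positivity
    have hA2 : ∀ z : Fin D → ℤ, Real.sqrt ((n : ℝ) ^ 2 + ∑ i, (z i : ℝ) ^ 2) ^ 2 =
        (n : ℝ) ^ 2 + ∑ i, (z i : ℝ) ^ 2 := fun z => by
      have : 0 ≤ ∑ i, (z i : ℝ) ^ 2 := Finset.sum_nonneg fun i _ => sq_nonneg _
      exact Real.sq_sqrt (by positivity)
    -- the power law as an integral of Gaussians
    have hgauss : G * ∑' z : Fin D → ℤ, ENNReal.ofReal (Real.sqrt ((n : ℝ) ^ 2 + ∑ i, (z i : ℝ) ^ 2) ^ (-p)) =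
        ∫⁻ s in Ioi (0 : ℝ), ENNReal.ofReal (Real.exp (-(s ^ 2 * (n : ℝ) ^ 2))) *
          (ENNReal.ofReal (s ^ (p - 1)) *
            ∑' z : Fin D → ℤ, ∏ i, ENNReal.ofReal (Real.exp (-(s ^ 2 * (z i : ℝ) ^ 2)))) := by
      rw [← ENNReal.tsum_mul_left]
      simp only [hG, ← lintegral_rpow_mul_exp_neg_sq hp0 (hA _), hA2]
      rw [← lintegral_tsum fun z => by fun_prop]
      refine setLIntegral_congr_fun measurableSet_Ioi fun s hs => ?_
      have hs' : (0 : ℝ) < s := hs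
      rw [← ENNReal.tsum_mul_left, ← ENNReal.tsum_mul_left]
      refine tsum_congr fun z => ?_
      rw [← ENNReal.ofReal_prod_of_nonneg fun _ _ => (Real.exp_pos _).le, ← Real.exp_sum,
        ← ENNReal.ofReal_mul (by positivity), ← ENNReal.ofReal_mul (by positivity),
        mul_add, neg_add, Real.exp_add, Finset.mul_sum, Finset.sum_neg_distrib]
      congr 1
      ring
    -- inversion of the theta functions, followed by the integration over `s`
    have hinv : G * B * ∑' z : Fin D → ℤ, ENNReal.ofReal (Real.sqrt ((n : ℝ) ^ 2 + ∑ i, (z i : ℝ) ^ 2) ^ (-p)) =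
        P ^ D * ∫⁻ κ in Ioi 0, U κ * ENNReal.ofReal (Real.sqrt Real.pi / (2 * n) * Real.exp (-2 * n * Real.sqrt κ)) := by
      rw [mul_right_comm, hgauss, mul_comm, ← lintegral_const_mul' _ _ hBt]
      have : ∀ s ∈ Ioi (0 : ℝ), B * (ENNReal.ofReal (Real.exp (-(s ^ 2 * (n : ℝ) ^ 2))) *
          (ENNReal.ofReal (s ^ (p - 1)) *
            ∑' z : Fin D → ℤ, ∏ i, ENNReal.ofReal (Real.exp (-(s ^ 2 * (z i : ℝ) ^ 2))))) =
          P ^ D * ∫⁻ κ in Ioi 0, U κ * ENNReal.ofReal (Real.exp (-(s ^ 2 * (n : ℝ) ^ 2) - κ / s ^ 2)) := by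
        intro s hs
        rw [mul_left_comm, hθ s hs, mul_left_comm, ← lintegral_const_mul' _ _ ENNReal.ofReal_ne_top]
        congr 1
        refine lintegral_congr fun κ => ?_
        rw [mul_left_comm, ← ENNReal.ofReal_mul (Real.exp_pos _).le, ← Real.exp_add, sub_eq_add_neg]
      rw [setLIntegral_congr_fun measurableSet_Ioi this, lintegral_const_mul' _ _ (by finiteness),
        lintegral_lintegral_swap]
      · congr 1
        refine setLIntegral_congr_fun measurableSet_Ioi fun κ hκ => ?_
        rw [lintegral_const_mul _ (by fun_prop), lintegral_exp_neg_sq_mul_sub_div hn0 hκ]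
      · exact ((hUm.comp measurable_snd).mul (by fun_prop)).aemeasurable
    have hdens : ∫⁻ l, ENNReal.ofReal (Real.exp (-(n * l))) * W l =
        ∫⁻ κ in Ioi 0, U κ * ENNReal.ofReal (1 / n * Real.exp (-2 * n * Real.sqrt κ)) := by
      simp only [hW]
      simp only [← lintegral_const_mul' _ _ ENNReal.ofReal_ne_top]
      rw [lintegral_lintegral_swap]
      · refine lintegral_congr fun κ => ?_
        have e : -2 * (n : ℝ) * Real.sqrt κ = -(n * (2 * Real.sqrt κ)) := by ring
        rw [e, ← lintegral_Ioi_exp_neg_mul hn0, ← lintegral_indicator measurableSet_Ioi,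
          ← lintegral_const_mul _ (Measurable.indicator (by fun_prop) measurableSet_Ioi)]
        refine lintegral_congr fun l => ?_
        simp only [indicator, mem_Ioi]
        split_ifs
        · rw [mul_comm]
        · simp
      · refine (Measurable.mul (by fun_prop) ?_).aemeasurable
        exact Measurable.ite hset (hUm.comp measurable_snd) measurable_const
    rw [lintegral_smul_measure, lintegral_withDensity_eq_lintegral_mul _ hWm (by fun_prop), smul_eq_mul]
    have e1 : ∫⁻ l, (W * fun l => ENNReal.ofReal (Real.exp (-(n * l)))) l =
        ∫⁻ κ in Ioi 0, U κ * ENNReal.ofReal (1 / n * Real.exp (-2 * n * Real.sqrt κ)) := by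
      rw [← hdens]
      refine lintegral_congr fun l => ?_
      rw [Pi.mul_apply, mul_comm]
    have e2 : ∫⁻ κ in Ioi 0, U κ * ENNReal.ofReal (Real.sqrt Real.pi / (2 * n) * Real.exp (-2 * n * Real.sqrt κ)) =
        P / 2 * ∫⁻ κ in Ioi 0, U κ * ENNReal.ofReal (1 / n * Real.exp (-2 * n * Real.sqrt κ)) := by
      have hP2 : P / 2 = ENNReal.ofReal (Real.sqrt Real.pi / 2) := by
        rw [ENNReal.ofReal_div_of_pos two_pos]; simp [hP]
      rw [hP2, ← lintegral_const_mul' _ _ ENNReal.ofReal_ne_top]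
      refine lintegral_congr fun κ => ?_
      rw [mul_left_comm, ← ENNReal.ofReal_mul (by positivity)]
      congr 2
      ring
    rw [e1, mul_assoc, ← e2, mul_assoc, ← hinv, ← mul_assoc, ENNReal.inv_mul_cancel, one_mul]
    · exact mul_ne_zero hG0 hB0
    · exact ENNReal.mul_ne_top hGt hBt

/-- A linear functional of a superposition of exponentials is nonnegative if it is so on each exponential. -/
theorem tsum_nonneg_of_laplace {v : ℕ → ℝ} {μ : Measure ℝ} (hμ : μ (Iic 0) = 0)
    (hv0 : ∀ n, 0 ≤ v n)
    (hv : ∀ n : ℕ, ENNReal.ofReal (v n) = ∫⁻ l, ENNReal.ofReal (Real.exp (-((n + 1 : ℕ) * l))) ∂μ)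
    {c : ℕ → ℝ} (hsum : Summable fun n => v n * |c n|)
    (hc : ∀ r : ℝ, 0 < r → r < 1 → 0 ≤ ∑' n, r ^ (n + 1) * c n) :
    0 ≤ ∑' n, v n * c n := by
  have hint : ∀ n : ℕ, Integrable (fun l : ℝ => Real.exp (-((n + 1 : ℕ) * l))) μ := by
    intro n
    refine ⟨by fun_prop, ?_⟩
    rw [hasFiniteIntegral_iff_ofReal (Filter.Eventually.of_forall fun _ => (Real.exp_pos _).le),
      ← hv n]
    exact ENNReal.ofReal_lt_top
  have hval : ∀ n : ℕ, ∫ l, Real.exp (-((n + 1 : ℕ) * l)) ∂μ = v n := by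
    intro n
    rw [integral_eq_lintegral_of_nonneg_ae
      (Filter.Eventually.of_forall fun _ => (Real.exp_pos _).le) (by fun_prop), ← hv n,
      ENNReal.toReal_ofReal (hv0 n)]
  have key := hasSum_integral_of_summable_integral_norm
    (F := fun (n : ℕ) (l : ℝ) => Real.exp (-((n + 1 : ℕ) * l)) * c n) (μ := μ)
    (fun n => (hint n).mul_const _) (by
      refine hsum.congr fun n => ?_
      simp only [norm_mul, Real.norm_eq_abs, Real.abs_exp]
      rw [integral_mul_const, hval])
  simp only [integral_mul_const, hval] at key
  rw [key.tsum_eq]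
  refine integral_nonneg_of_ae ?_
  have hpos : ∀ᵐ l ∂μ, 0 < l := by
    rw [ae_iff]
    simp only [not_lt]
    exact hμ
  filter_upwards [hpos] with l hl
  have := hc (Real.exp (-l)) (Real.exp_pos _) (by simpa using hl)
  have e : ∀ n : ℕ, Real.exp (-((n + 1 : ℕ) * l)) = Real.exp (-l) ^ (n + 1) := by
    intro n
    rw [← Real.exp_nat_mul, mul_neg]
  simpa only [e, Pi.zero_apply] using this

end Laplace

/-! ### Disagreements of spin configurations -/

/-- The indicator of disagreement of two spins. -/
noncomputable def dis (a b : ℤˣ) : ℝ := if a = b then 0 else 1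

theorem dis_self (a : ℤˣ) : dis a a = 0 := if_pos rfl
theorem dis_of_ne {a b : ℤˣ} (h : a ≠ b) : dis a b = 1 := if_neg h
theorem dis_comm (a b : ℤˣ) : dis a b = dis b a := by unfold dis; simp only [eq_comm]
theorem dis_nonneg (a b : ℤˣ) : 0 ≤ dis a b := by unfold dis; split_ifs <;> norm_num
theorem dis_le_one (a b : ℤˣ) : dis a b ≤ 1 := by unfold dis; split_ifs <;> norm_num

theorem dis_eq_half (a b : ℤˣ) : dis a b = (1 - ((a : ℤ) : ℝ) * ((b : ℤ) : ℝ)) / 2 := by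
  rcases Int.units_eq_one_or a with rfl | rfl <;> rcases Int.units_eq_one_or b with rfl | rfl <;>
    norm_num [dis]

/-- A path from `a` to `c` through `b` has an excess of two disagreements exactly when both its
steps are disagreements. -/
theorem dis_triangle (a b c : ℤˣ) : dis a c = dis a b + dis b c - 2 * (dis a b * dis b c) := by
  rcases Int.units_eq_one_or a with rfl | rfl <;> rcases Int.units_eq_one_or b with rfl | rfl <;>
    rcases Int.units_eq_one_or c with rfl | rfl <;> norm_num [dis]

theorem abs_dis_sub_dis_le (a b c d : ℤˣ) : |dis a b - dis c d| ≤ dis a c + dis b d := by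
  have h1 := dis_nonneg a c
  have h2 := dis_nonneg b d
  by_cases hac : a = c
  · by_cases hbd : b = d
    · simp [hac, hbd, dis]
    · rw [dis_of_ne hbd, abs_le]
      constructor <;> linarith [dis_nonneg a b, dis_le_one a b, dis_nonneg c d, dis_le_one c d]
  · rw [dis_of_ne hac, abs_le]
    constructor <;> linarith [dis_nonneg a b, dis_le_one a b, dis_nonneg c d, dis_le_one c d]

theorem summable_dis {G : Type*} {t s : G → ℤˣ} (hX : {x | t x ≠ s x}.Finite) :
    Summable fun x => dis (t x) (s x) := by
  refine summable_of_hasFiniteSupport (hX.subset fun x hx => ?_)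
  contrapose! hx
  simp only [Set.mem_ofPred_eq, not_not] at hx
  simp [hx, dis]

section Defect
variable {G : Type*} [AddCommGroup G]

/-- The number of disagreements at displacement `y` in `t`, minus the same number in `s`. The sum
has only finitely many nonzero terms when `t` and `s` differ on a finite set. -/
noncomputable def defect (t s : G → ℤˣ) (y : G) : ℝ :=
  ∑' x, (dis (t x) (t (x + y)) - dis (s x) (s (x + y)))

theorem summable_dis_shift {t s : G → ℤˣ} (hX : {x | t x ≠ s x}.Finite) (y : G) :
    Summable fun x => dis (t (x + y)) (s (x + y)) :=
  ((Equiv.addRight y).summable_iff (f := fun x => dis (t x) (s x))).2 (summable_dis hX)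

theorem tsum_dis_shift (t s : G → ℤˣ) (y : G) :
    ∑' x, dis (t (x + y)) (s (x + y)) = ∑' x, dis (t x) (s x) :=
  (Equiv.addRight y).tsum_eq fun x => dis (t x) (s x)

theorem summable_defect {t s : G → ℤˣ} (hX : {x | t x ≠ s x}.Finite) (y : G) :
    Summable fun x => dis (t x) (t (x + y)) - dis (s x) (s (x + y)) := by
  refine Summable.of_norm_bounded ((summable_dis hX).add (summable_dis_shift hX y)) fun x => ?_
  exact abs_dis_sub_dis_le _ _ _ _

theorem abs_defect_le {t s : G → ℤˣ} (hX : {x | t x ≠ s x}.Finite) (y : G) :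
    |defect t s y| ≤ 2 * ∑' x, dis (t x) (s x) := by
  have h := tsum_of_norm_bounded (f := fun x => dis (t x) (t (x + y)) - dis (s x) (s (x + y)))
    ((summable_dis hX).add (summable_dis_shift hX y)).hasSum
    (fun x => abs_dis_sub_dis_le (t x) (t (x + y)) (s x) (s (x + y)))
  rw [(summable_dis hX).tsum_add (summable_dis_shift hX y), tsum_dis_shift] at h
  rw [two_mul]
  exact h

theorem defect_neg (t s : G → ℤˣ) (y : G) : defect t s (-y) = defect t s y := by
  unfold defect
  rw [← (Equiv.addRight y).tsum_eq]
  refine tsum_congr fun x => ?_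
  simp [dis_comm]

theorem defect_zero (t s : G → ℤˣ) : defect t s 0 = 0 := by simp [defect, dis_self]

theorem defect_shift (t s : G → ℤˣ) (y z : G) :
    ∑' x, (dis (t (x + z)) (t (x + z + y)) - dis (s (x + z)) (s (x + z + y))) = defect t s y :=
  (Equiv.addRight z).tsum_eq fun x => dis (t x) (t (x + y)) - dis (s x) (s (x + y))

theorem summable_defect_shift {t s : G → ℤˣ} (hX : {x | t x ≠ s x}.Finite) (y z : G) :
    Summable fun x => dis (t (x + z)) (t (x + z + y)) - dis (s (x + z)) (s (x + z + y)) :=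
  ((Equiv.addRight z).summable_iff
    (f := fun x => dis (t x) (t (x + y)) - dis (s x) (s (x + y)))).2 (summable_defect hX y)

end Defect

/-! ### Walls and left fields on a line -/

section Line

/-- There is a domain wall of the one-dimensional configuration `τ` between `m - 1` and `m`. -/
def IsWall (τ : ℤ → ℤˣ) (m : ℤ) : Prop := τ m ≠ τ (m - 1)

/-- The distance from `m` to the next wall on its right; by convention it is `0` if there is no
wall on the right of `m`, so that `0` stands for an infinite distance. -/
noncomputable def gap (τ : ℤ → ℤˣ) (m : ℤ) : ℕ := sInf {k : ℕ | 1 ≤ k ∧ IsWall τ (m + k)}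

theorem not_isWall_of_gap_eq_zero {τ : ℤ → ℤˣ} {m : ℤ} (h : gap τ m = 0) {k : ℕ} (hk : 1 ≤ k) :
    ¬ IsWall τ (m + k) := by
  intro hw
  rcases Nat.sInf_eq_zero.1 h with h0 | h0
  · exact absurd h0.1 (by norm_num)
  · exact (Set.eq_empty_iff_forall_notMem.1 h0 k) ⟨hk, hw⟩

theorem not_isWall_of_lt_gap {τ : ℤ → ℤˣ} {m : ℤ} {k : ℕ} (hk : 1 ≤ k) (hkg : k < gap τ m) :
    ¬ IsWall τ (m + k) := fun hw => Nat.notMem_of_lt_sInf hkg ⟨hk, hw⟩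

theorem isWall_add_gap {τ : ℤ → ℤˣ} {m : ℤ} (h : gap τ m ≠ 0) : IsWall τ (m + gap τ m) := by
  have : {k : ℕ | 1 ≤ k ∧ IsWall τ (m + k)}.Nonempty :=
    Nat.nonempty_of_pos_sInf (Nat.pos_of_ne_zero h)
  exact (Nat.sInf_mem this).2

theorem gap_eq_of_isWall {τ : ℤ → ℤˣ} {m : ℤ} {h : ℕ} (h1 : 1 ≤ h) (hw : IsWall τ (m + h))
    (hn : ∀ k : ℕ, 1 ≤ k → k < h → ¬ IsWall τ (m + k)) : gap τ m = h := by
  refine le_antisymm (Nat.sInf_le ⟨h1, hw⟩) (le_csInf ⟨h, h1, hw⟩ fun k hk => ?_)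
  by_contra! hlt
  exact hn k hk.1 hlt hk.2

theorem gap_le_of_isWall {τ : ℤ → ℤˣ} {m : ℤ} {h : ℕ} (h1 : 1 ≤ h) (hw : IsWall τ (m + h)) :
    gap τ m ≤ h := Nat.sInf_le ⟨h1, hw⟩

theorem gap_ne_zero_of_isWall {τ : ℤ → ℤˣ} {m : ℤ} {h : ℕ} (h1 : 1 ≤ h) (hw : IsWall τ (m + h)) :
    gap τ m ≠ 0 := fun h0 => not_isWall_of_gap_eq_zero h0 h1 hw

/-- The generating function of the disagreements of the site `m` with the sites on its left. -/
noncomputable def leftField (r : ℝ) (τ : ℤ → ℤˣ) (m : ℤ) : ℝ :=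
  ∑' n : ℕ, r ^ (n + 1) * dis (τ m) (τ (m - (n + 1)))

variable {r : ℝ}

theorem summable_pow_mul_dis (hr0 : 0 < r) (hr1 : r < 1) (f g : ℕ → ℤˣ) :
    Summable fun n : ℕ => r ^ (n + 1) * dis (f n) (g n) := by
  refine Summable.of_nonneg_of_le (fun n => mul_nonneg (by positivity) (dis_nonneg _ _)) (fun n => ?_)
    ((summable_geometric_of_lt_one hr0.le hr1).mul_left r)
  rw [← pow_succ']
  exact mul_le_of_le_one_right (by positivity) (dis_le_one _ _)

theorem tsum_pow_succ (hr0 : 0 < r) (hr1 : r < 1) : ∑' n : ℕ, r ^ (n + 1) = r / (1 - r) := by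
  simp only [pow_succ']
  rw [tsum_mul_left, tsum_geometric_of_lt_one hr0.le hr1, div_eq_mul_inv]

theorem leftField_succ (hr0 : 0 < r) (hr1 : r < 1) (τ : ℤ → ℤˣ) (m : ℤ) :
    leftField r τ (m + 1) = r * dis (τ (m + 1)) (τ m) +
      r * ∑' n : ℕ, r ^ (n + 1) * dis (τ (m + 1)) (τ (m - (n + 1))) := by
  unfold leftField
  rw [(summable_pow_mul_dis hr0 hr1 _ _).tsum_eq_zero_add, ← tsum_mul_left]
  congr 1
  · simp
  · refine tsum_congr fun n => ?_
    rw [pow_succ', mul_assoc]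
    congr 4
    push_cast; ring

theorem leftField_succ_of_not_isWall (hr0 : 0 < r) (hr1 : r < 1) {τ : ℤ → ℤˣ} {m : ℤ}
    (h : ¬ IsWall τ (m + 1)) : leftField r τ (m + 1) = r * leftField r τ m := by
  have e : τ (m + 1) = τ m := by simpa [IsWall] using h
  rw [leftField_succ hr0 hr1, e, dis_self, mul_zero, zero_add]
  rfl

theorem leftField_succ_of_isWall (hr0 : 0 < r) (hr1 : r < 1) {τ : ℤ → ℤˣ} {m : ℤ}
    (h : IsWall τ (m + 1)) : leftField r τ (m + 1) = r / (1 - r) - r * leftField r τ m := by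
  have e : τ (m + 1) ≠ τ m := by simpa [IsWall] using h
  have e2 : ∀ n : ℕ, r ^ (n + 1) * dis (τ (m + 1)) (τ (m - (n + 1))) =
      r ^ (n + 1) - r ^ (n + 1) * dis (τ m) (τ (m - (n + 1))) := by
    intro n
    rw [dis_triangle _ (τ m), dis_of_ne e]; ring
  rw [leftField_succ hr0 hr1, dis_of_ne e]
  simp only [e2]
  rw [Summable.tsum_sub ((summable_nat_add_iff 1).2 (summable_geometric_of_lt_one hr0.le hr1))
    (summable_pow_mul_dis hr0 hr1 _ _), tsum_pow_succ hr0 hr1]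
  have : 1 - r ≠ 0 := by linarith
  change r * 1 + r * (r / (1 - r) - leftField r τ m) = _
  field_simp
  ring

theorem leftField_add (hr0 : 0 < r) (hr1 : r < 1) {τ : ℤ → ℤˣ} {m : ℤ} (j : ℕ)
    (h : ∀ k : ℕ, 1 ≤ k → k ≤ j → ¬ IsWall τ (m + k)) :
    leftField r τ (m + j) = r ^ j * leftField r τ m := by
  induction j with
  | zero => simp
  | succ j ih =>
    have := h (j + 1) (by omega) le_rfl
    push_cast at this ⊢
    rw [← add_assoc] at this ⊢
    rw [leftField_succ_of_not_isWall hr0 hr1 this, ih fun k h1 h2 => h k h1 (by omega), pow_succ']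
    ring

/-- The recursion for the left field at consecutive walls. -/
theorem leftField_add_gap (hr0 : 0 < r) (hr1 : r < 1) {τ : ℤ → ℤˣ} {m : ℤ} (h : gap τ m ≠ 0) :
    leftField r τ (m + gap τ m) = r / (1 - r) - r ^ gap τ m * leftField r τ m := by
  obtain ⟨j, hj⟩ := Nat.exists_eq_succ_of_ne_zero h
  have hw := isWall_add_gap h
  have h2 := leftField_add hr0 hr1 j (τ := τ) (m := m) fun k h1 h2 => not_isWall_of_lt_gap h1 (by omega)
  rw [hj] at hw ⊢
  push_cast [Nat.succ_eq_add_one] at hw ⊢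
  rw [← add_assoc] at hw ⊢
  rw [leftField_succ_of_isWall hr0 hr1 hw, h2, pow_succ']
  ring

/-- The weight `r ^ h`, with `h = 0` standing for an infinite width. -/
noncomputable def widthPow (r : ℝ) (h : ℕ) : ℝ := if h = 0 then 0 else r ^ h

/-- The sum of the left fields over one stripe of the periodic configuration of width `h`. -/
noncomputable def stripeField (r : ℝ) (h : ℕ) : ℝ :=
  r / (1 - r) * (1 - widthPow r h) / ((1 - r) * (1 + widthPow r h))

/-- The quadratic potential in the value of the left field at a wall whose increments control the
excess energy of a stripe. -/
noncomputable def wallPotential (r x : ℝ) : ℝ := (2 * x - r / (1 - r)) ^ 2 / (4 * r)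

/-- The sum of the left field over a stripe, as a function of its value `x` at the left end, is
at most its value for periodic stripes of the same width up to an increment of the potential: the
difference is a square. Here `q` stands for `r ^ h`, and `q = 0` for an infinite stripe. -/
theorem stripe_inequality (hr0 : 0 < r) (hr1 : r < 1) {q : ℝ} (hq0 : 0 ≤ q) (hq1 : q < 1) (x : ℝ) :
    x * ((1 - q) / (1 - r)) ≤ r / (1 - r) * (1 - q) / ((1 - r) * (1 + q)) +
      wallPotential r x - wallPotential r (r / (1 - r) - q * x) := by
  have h1 : 0 < 1 - r := by linarith
  have h2 : 0 < 1 + q := by linarith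
  have key : r / (1 - r) * (1 - q) / ((1 - r) * (1 + q)) +
      wallPotential r x - wallPotential r (r / (1 - r) - q * x) - x * ((1 - q) / (1 - r)) =
      (1 - q ^ 2) * (x - r / (1 - r) / (1 + q)) ^ 2 / r := by
    unfold wallPotential
    field_simp
    ring
  have : 0 ≤ (1 - q ^ 2) * (x - r / (1 - r) / (1 + q)) ^ 2 / r := by
    have : 0 ≤ 1 - q ^ 2 := by nlinarith
    positivity
  linarith

/-- The function equal to `F (gap τ m)` at the walls `m` of `τ` and to `0` elsewhere. -/
noncomputable def wallWeight (τ : ℤ → ℤˣ) (F : ℕ → ℝ) (m : ℤ) : ℝ :=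
  open Classical in if IsWall τ m then F (gap τ m) else 0

theorem wallWeight_of_isWall {τ : ℤ → ℤˣ} {m : ℤ} (h : IsWall τ m) (F : ℕ → ℝ) :
    wallWeight τ F m = F (gap τ m) := if_pos h

theorem wallWeight_of_not_isWall {τ : ℤ → ℤˣ} {m : ℤ} (h : ¬ IsWall τ m) (F : ℕ → ℝ) :
    wallWeight τ F m = 0 := if_neg h

theorem sum_range_gap_leftField (hr0 : 0 < r) (hr1 : r < 1) {τ : ℤ → ℤˣ} {m : ℤ} :
    ∑ j ∈ Finset.range (gap τ m), leftField r τ (m + j) =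
      leftField r τ m * ((1 - r ^ gap τ m) / (1 - r)) := by
  have : ∀ j ∈ Finset.range (gap τ m), leftField r τ (m + j) = r ^ j * leftField r τ m := by
    intro j hj
    exact leftField_add hr0 hr1 j fun k h1 h2 =>
      not_isWall_of_lt_gap h1 (by have := Finset.mem_range.1 hj; omega)
  rw [Finset.sum_congr rfl this, ← Finset.sum_mul, geom_sum_eq (by linarith), mul_comm]
  congr 1
  rw [← neg_div_neg_eq]; congr 1 <;> ring

/-- The stripe inequality summed over the stripes between two walls. -/
theorem sum_leftField_le (hr0 : 0 < r) (hr1 : r < 1) {τ : ℤ → ℤˣ} (n : ℕ) :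
    ∀ m : ℤ, IsWall τ m → IsWall τ (m + n) →
    ∑ j ∈ Finset.range n, leftField r τ (m + j) ≤
      ∑ j ∈ Finset.range n, wallWeight τ (stripeField r) (m + j) +
        wallPotential r (leftField r τ m) - wallPotential r (leftField r τ (m + n)) := by
  induction n using Nat.strong_induction_on with
  | _ n ih =>
    intro m hm hmn
    rcases Nat.eq_zero_or_pos n with rfl | hn
    · simp
    have hg0 := gap_ne_zero_of_isWall hn hmn
    have hgn := gap_le_of_isWall hn hmn
    set g := gap τ m with hg
    obtain ⟨k, hk⟩ := Nat.exists_eq_add_of_le hgn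
    have e : m + (n : ℤ) = m + g + k := by rw [hk]; push_cast; ring
    have ih' := ih k (by omega) (m + g) (isWall_add_gap hg0) (by rw [← e]; exact hmn)
    rw [hk, Finset.sum_range_add, Finset.sum_range_add, ← hk, e]
    have e2 : ∀ j : ℕ, m + ((g + j : ℕ) : ℤ) = m + g + j := by intro j; push_cast; ring
    simp only [e2]
    have h1 : ∑ j ∈ Finset.range g, wallWeight τ (stripeField r) (m + j) = stripeField r g := by
      rw [Finset.sum_eq_single_of_mem 0 (Finset.mem_range.2 (Nat.pos_of_ne_zero hg0))]
      · simpa using wallWeight_of_isWall hm _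
      · intro j hj hj0
        exact wallWeight_of_not_isWall (not_isWall_of_lt_gap (Nat.pos_of_ne_zero hj0)
          (Finset.mem_range.1 hj)) _
    have h2 := sum_range_gap_leftField hr0 hr1 (τ := τ) (m := m)
    have h3 := stripe_inequality hr0 hr1 (q := r ^ g) (by positivity)
      (pow_lt_one₀ hr0.le hr1 hg0) (leftField r τ m)
    have h4 := leftField_add_gap hr0 hr1 hg0
    rw [← hg] at h2 h4
    rw [h1, h2]
    rw [h4] at ih'
    have h5 : stripeField r g = r / (1 - r) * (1 - r ^ g) / ((1 - r) * (1 + r ^ g)) := by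
      simp [stripeField, widthPow, hg0]
    rw [h5]
    linarith
end Line

/-! ### The energy of a line is bounded by the energy of its walls -/

section Line

/-- The disagreements only depend on the positions of the walls. -/
theorem dis_sub_eq_of_isWall_iff {τ ς : ℤ → ℤˣ} (h : ∀ m, IsWall τ m ↔ IsWall ς m) (m : ℤ) (n : ℕ) :
    dis (τ m) (τ (m - n)) = dis (ς m) (ς (m - n)) := by
  induction n with
  | zero => simp [dis_self]
  | succ n ih =>
    have e : m - ((n + 1 : ℕ) : ℤ) = m - n - 1 := by push_cast; ring
    have hw : dis (τ (m - n)) (τ (m - n - 1)) = dis (ς (m - n)) (ς (m - n - 1)) := by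
      by_cases hτ : IsWall τ (m - n)
      · rw [dis_of_ne hτ, dis_of_ne ((h _).1 hτ)]
      · have hς := (h _).not.1 hτ
        unfold IsWall at hτ hς
        push Not at hτ hς
        rw [hτ, hς, dis_self, dis_self]
    rw [e, dis_triangle _ (τ (m - n)), dis_triangle (ς m) (ς (m - n)), ih, hw]

/-- A configuration is constant on a half-line without walls. -/
theorem eq_of_not_isWall {τ : ℤ → ℤˣ} {m : ℤ} (h : ∀ k, k ≤ m → ¬ IsWall τ k) (n : ℕ) :
    τ (m - n) = τ m := by
  induction n with
  | zero => simp
  | succ n ih =>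
    have := h (m - n) (by omega)
    unfold IsWall at this
    push Not at this
    rw [← ih, this]
    congr 1
    push_cast; ring

/-- The periodic configuration of stripes of width `h`, with walls at the multiples of `h`. -/
def altStripes (h : ℕ) (m : ℤ) : ℤˣ := Int.negOnePow (m / h)

theorem mul_add_ediv_of_lt {h : ℕ} (q s : ℤ) (h0 : 0 ≤ s) (h1 : s < h) : ((h : ℤ) * q + s) / h = q := by
  rw [Int.mul_add_ediv_left _ _ (by omega), Int.ediv_eq_zero_of_lt h0 h1, add_zero]

theorem isWall_altStripes {h : ℕ} (h1 : 1 ≤ h) (m : ℤ) : IsWall (altStripes h) m ↔ (h : ℤ) ∣ m := by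
  have hm := Int.mul_ediv_add_emod m h
  set q := m / (h : ℤ) with hq
  set s := m % (h : ℤ) with hs
  have hs0 : 0 ≤ s := Int.emod_nonneg _ (by omega)
  have hs1 : s < h := Int.emod_lt_of_pos _ (by omega)
  rw [Int.dvd_iff_emod_eq_zero, ← hs]
  unfold IsWall altStripes
  rw [← hq]
  by_cases h0 : s = 0
  · simp only [h0, iff_true]
    have : m - 1 = h * (q - 1) + ((h : ℤ) - 1) := by rw [← hm, h0]; ring
    rw [this, mul_add_ediv_of_lt _ _ (by omega) (by omega), Int.negOnePow_sub, Int.negOnePow_one]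
    intro h2
    rcases Int.units_eq_one_or q.negOnePow with h3 | h3 <;> rw [h3] at h2 <;> exact absurd h2 (by decide)
  · simp only [h0, iff_false, not_not, ne_eq]
    have : m - 1 = h * q + (s - 1) := by rw [← hm]; ring
    rw [this, mul_add_ediv_of_lt _ _ (by omega) (by omega)]

theorem altStripes_add {h : ℕ} (h1 : 1 ≤ h) (m : ℤ) : altStripes h (m + h) = -altStripes h m := by
  unfold altStripes
  rw [Int.add_ediv_of_dvd_right (dvd_refl _), Int.ediv_self (by omega), Int.negOnePow_succ]

theorem dis_neg_neg (a b : ℤˣ) : dis (-a) (-b) = dis a b := by simp [dis]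

theorem gap_eq_of_forall_isWall_iff {ς : ℤ → ℤˣ} {a : ℤ} {h : ℕ} (h1 : 1 ≤ h)
    (hς : ∀ m, IsWall ς m ↔ (h : ℤ) ∣ m - a) {m : ℤ} (hm : IsWall ς m) : gap ς m = h := by
  have hm' := (hς m).1 hm
  refine gap_eq_of_isWall h1 ((hς _).2 ?_) fun k hk hkh hw => ?_
  · rw [show m + (h : ℤ) - a = m - a + h by ring]
    exact dvd_add hm' (dvd_refl _)
  · have := (hς _).1 hw
    rw [show m + (k : ℤ) - a = m - a + k by ring, Int.dvd_add_right hm'] at this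
    have := Nat.le_of_dvd hk (by exact_mod_cast this)
    omega

variable {r : ℝ}

/-- The fixed point of the recursion for the left field at consecutive walls. -/
theorem leftField_altStripes (hr0 : 0 < r) (hr1 : r < 1) {h : ℕ} (h1 : 1 ≤ h) :
    leftField r (altStripes h) 0 = r / (1 - r) / (1 + r ^ h) := by
  have hw : ∀ m, IsWall (altStripes h) m ↔ (h : ℤ) ∣ m - 0 := by
    intro m; rw [sub_zero, isWall_altStripes h1]
  have hg : gap (altStripes h) 0 = h := gap_eq_of_forall_isWall_iff h1 hw ((hw 0).2 (by simp))
  have h2 := leftField_add_gap hr0 hr1 (τ := altStripes h) (m := 0) (by omega)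
  have h3 : leftField r (altStripes h) (0 + h) = leftField r (altStripes h) 0 := by
    unfold leftField
    refine tsum_congr fun n => ?_
    rw [altStripes_add h1, show (0 : ℤ) + h - (n + 1) = (0 - (n + 1)) + h by ring,
      altStripes_add h1, dis_neg_neg]
  rw [hg, h3] at h2
  have : 0 < 1 + r ^ h := by positivity
  rw [eq_div_iff this.ne']
  linarith

/-- The number of disagreements at distance `n` per stripe in the periodic configuration of
stripes of width `h`; for `h = 0`, the value for a single wall. -/
noncomputable def stripeDis (h n : ℕ) : ℝ :=
  if h = 0 then n else ∑ k ∈ Finset.range h, dis (altStripes h k) (altStripes h (k - n))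

theorem tsum_pow_mul_stripeDis (hr0 : 0 < r) (hr1 : r < 1) (h : ℕ) :
    ∑' n : ℕ, r ^ (n + 1) * stripeDis h (n + 1) = stripeField r h := by
  rcases Nat.eq_zero_or_pos h with rfl | hh
  · have h1 : ‖r‖ < 1 := by rwa [Real.norm_of_nonneg hr0.le]
    have h2 := tsum_coe_mul_geometric_of_norm_lt_one h1
    have h3 : Summable fun n : ℕ => (n : ℝ) * r ^ n := by
      simpa using summable_pow_mul_geometric_of_norm_lt_one 1 h1
    rw [h3.tsum_eq_zero_add] at h2
    simp only [stripeDis, stripeField, widthPow, if_true]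
    rw [Nat.cast_zero, zero_mul, zero_add] at h2
    simp only [mul_comm (r ^ (_ + 1))]
    rw [h2]
    have : 1 - r ≠ 0 := by linarith
    field_simp
    ring
  · have hw : ∀ m, IsWall (altStripes h) m ↔ (h : ℤ) ∣ m - 0 := by
      intro m; rw [sub_zero, isWall_altStripes hh]
    have hg : gap (altStripes h) 0 = h := gap_eq_of_forall_isWall_iff hh hw ((hw 0).2 (by simp))
    have h2 := sum_range_gap_leftField hr0 hr1 (τ := altStripes h) (m := 0)
    rw [hg, leftField_altStripes hr0 hr1 hh] at h2
    have h0 : h ≠ 0 := by omega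
    have e : ∀ n : ℕ, r ^ (n + 1) * stripeDis h (n + 1) = ∑ k ∈ Finset.range h,
        r ^ (n + 1) * dis (altStripes h k) (altStripes h (k - (n + 1))) := by
      intro n
      rw [stripeDis, if_neg h0, Finset.mul_sum]
      push_cast
      rfl
    simp only [e]
    rw [Summable.tsum_finsetSum fun k _ => summable_pow_mul_dis hr0 hr1 _ _]
    simp only [zero_add] at h2
    change ∑ k ∈ Finset.range h, leftField r (altStripes h) k = _
    rw [h2, stripeField, widthPow, if_neg h0]
    have : 1 - r ≠ 0 := by linarith
    have : 1 + r ^ h ≠ 0 := by positivity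
    field_simp

theorem stripeDis_nonneg (h n : ℕ) : 0 ≤ stripeDis h n := by
  unfold stripeDis
  split_ifs
  · positivity
  · exact Finset.sum_nonneg fun _ _ => dis_nonneg _ _

theorem stripeDis_zero_right (h : ℕ) : stripeDis h 0 = 0 := by
  unfold stripeDis
  simp [dis_self]

theorem stripeDis_le (h n : ℕ) : stripeDis h n ≤ n := by
  rcases Nat.eq_zero_or_pos h with rfl | hh
  · simp [stripeDis]
  have h0 : h ≠ 0 := by omega
  induction n with
  | zero => simp [stripeDis_zero_right]
  | succ n ih =>
    simp only [stripeDis, if_neg h0] at ih ⊢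
    have h1 : ∑ k ∈ Finset.range h, dis (altStripes h k) (altStripes h (k - (n + 1 : ℕ))) ≤
        ∑ k ∈ Finset.range h, (dis (altStripes h k) (altStripes h (k - n)) +
          if k = n % h then 1 else 0) := by
      refine Finset.sum_le_sum fun k hk => ?_
      have e : (k : ℤ) - ((n + 1 : ℕ) : ℤ) = k - n - 1 := by push_cast; ring
      rw [e, dis_triangle _ (altStripes h (k - n))]
      have h2 := mul_nonneg (dis_nonneg (altStripes h k) (altStripes h (k - n)))
        (dis_nonneg (altStripes h (k - n)) (altStripes h (k - n - 1)))
      suffices dis (altStripes h (k - n)) (altStripes h (k - n - 1)) ≤ if k = n % h then 1 else 0 by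
        linarith
      split_ifs with hkn
      · exact dis_le_one _ _
      · have hw : ¬ IsWall (altStripes h) (k - n) := by
          rw [isWall_altStripes hh]
          intro hd
          apply hkn
          have := (Nat.modEq_iff_dvd.2 hd)
          rw [← Nat.mod_eq_of_lt (Finset.mem_range.1 hk)]
          exact this.symm
        unfold IsWall at hw
        push Not at hw
        rw [← hw, dis_self]
    rw [Finset.sum_add_distrib, Finset.sum_ite_eq' (Finset.range h) (n % h),
      if_pos (Finset.mem_range.2 (Nat.mod_lt _ hh))] at h1
    push_cast at h1 ih ⊢
    linarith

theorem stripeDis_eq {h n : ℕ} (hn : n ≤ h) : stripeDis h n = n := by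
  rcases Nat.eq_zero_or_pos h with rfl | hh
  · simp [stripeDis]
  have h0 : h ≠ 0 := by omega
  rw [stripeDis, if_neg h0]
  have : ∀ k ∈ Finset.range h, dis (altStripes h k) (altStripes h (k - n)) =
      if k ∈ Finset.range n then 1 else 0 := by
    intro k hk
    have hk := Finset.mem_range.1 hk
    have e1 : altStripes h k = 1 := by
      unfold altStripes
      rw [Int.ediv_eq_zero_of_lt (by omega) (by omega), Int.negOnePow_zero]
    rw [e1]
    split_ifs with hkn
    · have hkn := Finset.mem_range.1 hkn
      have e2 : altStripes h (k - n) = -1 := by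
        unfold altStripes
        have : (k : ℤ) - n = h * (-1) + (h + k - n) := by ring
        rw [this, mul_add_ediv_of_lt _ _ (by omega) (by omega)]
        rfl
      rw [e2, dis_of_ne (by decide)]
    · have hkn : n ≤ k := by simpa using hkn
      have e2 : altStripes h (k - n) = 1 := by
        unfold altStripes
        rw [Int.ediv_eq_zero_of_lt (by omega) (by omega), Int.negOnePow_zero]
      rw [e2, dis_self]
  rw [Finset.sum_congr rfl this, Finset.sum_ite_mem,
    Finset.inter_eq_right.2 (Finset.range_subset_range.2 hn)]
  simp

/-- The walls of `ς` are absent or equally spaced, with spacing `h`. -/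
def IsPeriodicBackground (ς : ℤ → ℤˣ) : Prop :=
  (∀ m, ¬ IsWall ς m) ∨ ∃ (a : ℤ) (h : ℕ), 1 ≤ h ∧ ∀ m, IsWall ς m ↔ (h : ℤ) ∣ m - a

theorem finite_isWall_symmDiff {τ ς : ℤ → ℤˣ} (hX : {m | τ m ≠ ς m}.Finite) :
    {m | ¬ (IsWall τ m ↔ IsWall ς m)}.Finite := by
  refine (hX.union (hX.preimage (f := fun m => m - 1) fun _ _ _ _ h => by simpa using h)).subset ?_
  intro m hm
  by_contra h
  simp only [Set.mem_union, Set.mem_ofPred_eq, Set.mem_preimage, not_or, not_not] at h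
  apply hm
  simp [IsWall, h.1, h.2]

theorem exists_finset_wallWeight_eq {τ ς : ℤ → ℤˣ} (hX : {m | τ m ≠ ς m}.Finite)
    (hς : IsPeriodicBackground ς) :
    ∃ S : Finset ℤ, ∀ m, m ∉ S → (IsWall τ m ↔ IsWall ς m) ∧ ∀ F, wallWeight τ F m = wallWeight ς F m := by
  have hP := finite_isWall_symmDiff hX
  rcases hς with hς | ⟨a, h, h1, hς⟩
  · refine ⟨hP.toFinset, fun m hm => ?_⟩
    have hm : IsWall τ m ↔ IsWall ς m := by simpa using hm
    refine ⟨hm, fun F => ?_⟩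
    rw [wallWeight_of_not_isWall (hς m), wallWeight_of_not_isWall (hm.not.2 (hς m))]
  · have hQ : (⋃ k ∈ Finset.range (h + 1), (fun m : ℤ => m + k) ⁻¹' {m | ¬ (IsWall τ m ↔ IsWall ς m)}).Finite :=
      Set.Finite.biUnion (Finset.finite_toSet _) fun k _ => hP.preimage fun _ _ _ _ h => by simpa using h
    refine ⟨hQ.toFinset, fun m hm => ?_⟩
    have hm : ∀ k : ℕ, k ≤ h → (IsWall τ (m + k) ↔ IsWall ς (m + k)) := by
      intro k hk
      by_contra hne
      apply hm
      simp only [Set.Finite.mem_toFinset, Set.mem_iUnion]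
      exact ⟨k, Finset.mem_range.2 (by omega), hne⟩
    have hm0 : IsWall τ m ↔ IsWall ς m := by simpa using hm 0 (by omega)
    refine ⟨hm0, fun F => ?_⟩
    by_cases hw : IsWall ς m
    · have hg := gap_eq_of_forall_isWall_iff h1 hς hw
      have hg0 : gap ς m ≠ 0 := by omega
      rw [wallWeight_of_isWall hw, wallWeight_of_isWall (hm0.2 hw)]
      congr 1
      rw [hg]
      refine gap_eq_of_isWall h1 ((hm h le_rfl).2 ?_) fun k hk hkh hk2 => ?_
      · have := isWall_add_gap hg0
        rwa [hg] at this
      · exact not_isWall_of_lt_gap hk (by omega) ((hm k hkh.le).1 hk2)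
    · rw [wallWeight_of_not_isWall hw, wallWeight_of_not_isWall (hm0.not.2 hw)]

theorem summable_wallWeight_sub {τ ς : ℤ → ℤˣ} (hX : {m | τ m ≠ ς m}.Finite)
    (hς : IsPeriodicBackground ς) (F : ℕ → ℝ) :
    Summable fun m => wallWeight τ F m - wallWeight ς F m := by
  obtain ⟨S, hS⟩ := exists_finset_wallWeight_eq hX hς
  exact summable_of_ne_finset_zero (s := S) fun m hm => by rw [(hS m hm).2 F, sub_self]

theorem tsum_int_eq_tsum_nat {f : ℤ → ℝ} {A : ℤ} (h : ∀ m < A, f m = 0) :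
    ∑' m, f m = ∑' i : ℕ, f (A + i) := by
  have hinj : Function.Injective fun i : ℕ => A + (i : ℤ) := fun a b h => by simpa using h
  symm
  refine hinj.tsum_eq fun m hm => ?_
  by_contra hne
  apply hm
  apply h
  by_contra! hle
  exact hne ⟨(m - A).toNat, by simp only; omega⟩

theorem summable_nat_of_int {f : ℤ → ℝ} (h : Summable f) (A : ℤ) : Summable fun i : ℕ => f (A + i) :=
  h.comp_injective (i := fun i : ℕ => A + (i : ℤ)) fun a b h => by simpa using h

theorem abs_pow_mul_dis_sub_le (hr0 : 0 < r) (τ ς : ℤ → ℤˣ) (m k : ℤ) (n : ℕ) :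
    |r ^ (n + 1) * (dis (τ m) (τ k) - dis (ς m) (ς k))| ≤
      dis (τ m) (ς m) * r ^ (n + 1) + dis (τ k) (ς k) * r ^ (n + 1) := by
  rw [abs_mul, abs_of_pos (by positivity), ← add_mul, mul_comm]
  exact mul_le_mul_of_nonneg_right (abs_dis_sub_dis_le _ _ _ _) (by positivity)

theorem injective_sub_succ : Function.Injective fun x : ℤ × ℕ => (x.1 - (x.2 + 1 : ℤ), x.2) := by
  rintro ⟨a, b⟩ ⟨c, d⟩ h
  simp only [Prod.mk.injEq] at h
  obtain ⟨h1, rfl⟩ := h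
  simpa using h1

theorem summable_mul_comp {f : ℤ → ℝ} {g : ℕ → ℝ} (h : Summable fun x : ℤ × ℕ => f x.1 * g x.2)
    {i : ℤ × ℕ → ℤ × ℕ} (hi : Function.Injective i) :
    Summable fun x : ℤ × ℕ => f (i x).1 * g (i x).2 := h.comp_injective hi

theorem summable_shift_mul {f : ℤ → ℝ} {g : ℕ → ℝ} (h : Summable fun x : ℤ × ℕ => f x.1 * g x.2) :
    Summable fun x : ℤ × ℕ => f (x.1 - (x.2 + 1)) * g x.2 :=
  summable_mul_comp h (i := fun x => (x.1 - (x.2 + 1 : ℤ), x.2)) injective_sub_succ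

theorem summable_leftField_sub (hr0 : 0 < r) (hr1 : r < 1) {τ ς : ℤ → ℤˣ} (hX : {m | τ m ≠ ς m}.Finite) :
    (Summable fun m => leftField r τ m - leftField r ς m) ∧
      ∑' m, (leftField r τ m - leftField r ς m) = ∑' n : ℕ, r ^ (n + 1) * defect τ ς ((n + 1 : ℕ) : ℤ) := by
  have hgeo : Summable fun n : ℕ => r ^ (n + 1) :=
    (summable_nat_add_iff 1).2 (summable_geometric_of_lt_one hr0.le hr1)
  have hb1 : Summable fun x : ℤ × ℕ => dis (τ x.1) (ς x.1) * r ^ (x.2 + 1) :=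
    (summable_dis hX).mul_of_nonneg hgeo (fun _ => dis_nonneg _ _) fun _ => by positivity
  have hb2 := summable_shift_mul (f := fun m => dis (τ m) (ς m)) (g := fun n => r ^ (n + 1)) hb1
  have hsum : Summable fun x : ℤ × ℕ => r ^ (x.2 + 1) *
      (dis (τ x.1) (τ (x.1 - (x.2 + 1))) - dis (ς x.1) (ς (x.1 - (x.2 + 1)))) := by
    refine Summable.of_norm_bounded (hb1.add hb2) fun x => ?_
    exact abs_pow_mul_dis_sub_le hr0 τ ς x.1 _ x.2
  have e : ∀ m, ∑' n : ℕ, r ^ (n + 1) * (dis (τ m) (τ (m - (n + 1))) - dis (ς m) (ς (m - (n + 1)))) =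
      leftField r τ m - leftField r ς m := by
    intro m
    simp only [mul_sub]
    exact Summable.tsum_sub (summable_pow_mul_dis hr0 hr1 _ _) (summable_pow_mul_dis hr0 hr1 _ _)
  have h1 := hsum.prod
  simp only [e] at h1
  refine ⟨h1, ?_⟩
  simp only [← e]
  rw [← Summable.tsum_comm (f := fun (m : ℤ) (n : ℕ) => r ^ (n + 1) *
    (dis (τ m) (τ (m - (n + 1))) - dis (ς m) (ς (m - (n + 1))))) hsum]
  refine tsum_congr fun n => ?_
  have e2 : ∀ m : ℤ, m - ((n : ℤ) + 1) = m + -((n + 1 : ℕ) : ℤ) := fun m => by push_cast; ring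
  rw [tsum_mul_left, ← defect_neg, defect]
  simp only [e2]

theorem leftField_congr {τ ς : ℤ → ℤˣ} {m : ℤ} (h : ∀ k, k ≤ m → τ k = ς k) :
    leftField r τ m = leftField r ς m := by
  unfold leftField
  refine tsum_congr fun n => ?_
  rw [h m le_rfl, h _ (by omega)]

theorem leftField_eq_zero {τ : ℤ → ℤˣ} {m : ℤ} (h : ∀ k, k ≤ m → ¬ IsWall τ k) :
    leftField r τ m = 0 := by
  unfold leftField
  rw [← tsum_zero (α := ℝ) (β := ℕ)]
  refine tsum_congr fun n => ?_
  have := eq_of_not_isWall h (n + 1)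
  push_cast at this
  rw [this, dis_self, mul_zero]

/-- Comparison with a constant background: the potential vanishes in total, as it takes the same value
at the first wall and behind the last one. -/
theorem tsum_leftField_le_of_no_wall (hr0 : 0 < r) (hr1 : r < 1) {τ ς : ℤ → ℤˣ}
    (hX : {m | τ m ≠ ς m}.Finite) (hς : ∀ m, ¬ IsWall ς m) :
    ∑' m, (leftField r τ m - leftField r ς m) ≤
      ∑' m, (wallWeight τ (stripeField r) m - wallWeight ς (stripeField r) m) := by
  have hs1 := (summable_leftField_sub hr0 hr1 hX).1
  have hs2 := summable_wallWeight_sub hX (Or.inl hς) (stripeField r)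
  simp only [leftField_eq_zero (fun k _ => hς k), wallWeight_of_not_isWall (hς _), sub_zero] at hs1 hs2 ⊢
  have hfin : {m | IsWall τ m}.Finite := by
    refine (finite_isWall_symmDiff hX).subset fun m hm => ?_
    simp only [Set.mem_ofPred_eq] at hm ⊢
    simp [hm, hς m]
  by_cases hne : {m | IsWall τ m}.Nonempty
  · obtain ⟨A, hA, hAmin⟩ := Set.exists_min_image _ id hfin hne
    obtain ⟨U, hU, hUmax⟩ := Set.exists_max_image _ id hfin hne
    simp only [Set.mem_ofPred_eq, id] at hA hAmin hU hUmax
    obtain ⟨n, hn⟩ := Int.eq_ofNat_of_zero_le (sub_nonneg.2 (hAmin U hU))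
    obtain rfl : U = A + n := by omega
    have hbelow : ∀ m, m < A → ∀ k, k ≤ m → ¬ IsWall τ k := fun m hm k hk hw => by
      have := hAmin k hw; omega
    have habove : ∀ k : ℕ, 1 ≤ k → ¬ IsWall τ (A + n + k) := fun k hk hw => by
      have := hUmax _ hw; omega
    rw [tsum_int_eq_tsum_nat (A := A) (f := leftField r τ) fun m hm => leftField_eq_zero (hbelow m hm),
      tsum_int_eq_tsum_nat (A := A) (f := wallWeight τ (stripeField r)) fun m hm =>
        wallWeight_of_not_isWall (hbelow m hm m le_rfl) _,
      ← (summable_nat_of_int hs1 A).sum_add_tsum_nat_add n,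
      ← (summable_nat_of_int hs2 A).sum_add_tsum_nat_add n]
    have e : ∀ i : ℕ, A + ((i + n : ℕ) : ℤ) = A + n + i := fun i => by push_cast; ring
    simp only [e]
    have h1 : ∑' i : ℕ, leftField r τ (A + n + i) = leftField r τ (A + n) * ((1 - 0) / (1 - r)) := by
      have : ∀ i : ℕ, leftField r τ (A + n + i) = r ^ i * leftField r τ (A + n) := fun i =>
        leftField_add hr0 hr1 i fun k hk _ => habove k hk
      simp only [this]
      rw [tsum_mul_right, tsum_geometric_of_lt_one hr0.le hr1, mul_comm, sub_zero, one_div]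
    have h2 : ∑' i : ℕ, wallWeight τ (stripeField r) (A + n + i) = stripeField r 0 := by
      rw [tsum_eq_single 0]
      · rw [Nat.cast_zero, add_zero, wallWeight_of_isWall hU]
        congr 1
        by_contra h0
        exact habove _ (Nat.pos_of_ne_zero h0) (isWall_add_gap h0)
      · intro i hi
        exact wallWeight_of_not_isWall (habove i (Nat.pos_of_ne_zero hi)) _
    have h3 := sum_leftField_le hr0 hr1 n A hA hU
    have h4 := stripe_inequality hr0 hr1 le_rfl one_pos (leftField r τ (A + n))
    have h5 : leftField r τ A = r / (1 - r) := by
      have := leftField_succ_of_isWall hr0 hr1 (τ := τ) (m := A - 1) (by simpa using hA)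
      rw [leftField_eq_zero (hbelow (A - 1) (by omega))] at this
      simpa using this
    have h6 : stripeField r 0 = r / (1 - r) * (1 - 0) / ((1 - r) * (1 + 0)) := by
      simp [stripeField, widthPow]
    rw [h1, h2, h6]
    rw [h5] at h3
    rw [zero_mul, sub_zero (r / (1 - r))] at h4
    linarith
  · have hno : ∀ m, ¬ IsWall τ m := fun m hm => hne ⟨m, hm⟩
    simp only [leftField_eq_zero (fun k _ => hno k), wallWeight_of_not_isWall (hno _), le_refl]

theorem leftField_periodic (hr0 : 0 < r) (hr1 : r < 1) {ς : ℤ → ℤˣ} {a : ℤ} {h : ℕ} (h1 : 1 ≤ h)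
    (hς : ∀ m, IsWall ς m ↔ (h : ℤ) ∣ m - a) (j : ℤ) :
    leftField r ς (a + h * j) = r / (1 - r) / (1 + r ^ h) := by
  rw [← leftField_altStripes hr0 hr1 h1]
  unfold leftField
  refine tsum_congr fun n => ?_
  have hw : ∀ m, IsWall ς m ↔ IsWall (fun m => altStripes h (m - (a + h * j))) m := by
    intro m
    have e : IsWall (fun m => altStripes h (m - (a + h * j))) m ↔ IsWall (altStripes h) (m - (a + h * j)) := by
      simp only [IsWall]
      rw [show m - 1 - (a + h * j) = m - (a + h * j) - 1 by ring]
    rw [e, hς, isWall_altStripes h1, show m - (a + h * j) = m - a - h * j by ring,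
      dvd_sub_left (dvd_mul_right _ _)]
  have := dis_sub_eq_of_isWall_iff hw (a + h * j) (n + 1)
  push_cast at this
  rw [this]
  congr 3 <;> ring_nf

theorem sum_leftField_periodic (hr0 : 0 < r) (hr1 : r < 1) {ς : ℤ → ℤˣ} {a : ℤ} {h : ℕ} (h1 : 1 ≤ h)
    (hς : ∀ m, IsWall ς m ↔ (h : ℤ) ∣ m - a) (j : ℤ) (n : ℕ) :
    ∑ i ∈ Finset.range (h * n), leftField r ς (a + h * j + i) =
      ∑ i ∈ Finset.range (h * n), wallWeight ς (stripeField r) (a + h * j + i) := by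
  induction n with
  | zero => simp
  | succ n ih =>
    rw [Nat.mul_succ, Finset.sum_range_add, Finset.sum_range_add, ih]
    congr 1
    have hw : IsWall ς (a + h * (j + n)) := by
      rw [hς]; exact ⟨j + n, by ring⟩
    have hg : gap ς (a + h * (j + n)) = h := gap_eq_of_forall_isWall_iff h1 hς hw
    have h2 := sum_range_gap_leftField hr0 hr1 (τ := ς) (m := a + h * (j + n))
    rw [hg, leftField_periodic hr0 hr1 h1 hς] at h2
    have e : ∀ i : ℕ, a + h * j + ((h * n + i : ℕ) : ℤ) = a + h * (j + n) + i := fun i => by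
      push_cast; ring
    simp only [e]
    rw [h2, Finset.sum_eq_single_of_mem 0 (Finset.mem_range.2 h1), Nat.cast_zero, add_zero,
      wallWeight_of_isWall hw, hg, stripeField, widthPow, if_neg (by omega)]
    · have : 1 - r ≠ 0 := by linarith
      have : 1 + r ^ h ≠ 0 := by positivity
      field_simp
    · intro i hi hi0
      refine wallWeight_of_not_isWall (not_isWall_of_lt_gap (Nat.pos_of_ne_zero hi0) ?_) _
      rw [hg]; exact Finset.mem_range.1 hi

open Filter Topology in
/-- Comparison with a periodic background: far on the left the two left fields coincide, and far on the
right they approach each other, so that the increments of the potential sum up to zero in the limit. -/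
theorem tsum_leftField_le_of_periodic (hr0 : 0 < r) (hr1 : r < 1) {τ ς : ℤ → ℤˣ}
    (hX : {m | τ m ≠ ς m}.Finite) {a : ℤ} {h : ℕ} (h1 : 1 ≤ h)
    (hς : ∀ m, IsWall ς m ↔ (h : ℤ) ∣ m - a) :
    ∑' m, (leftField r τ m - leftField r ς m) ≤
      ∑' m, (wallWeight τ (stripeField r) m - wallWeight ς (stripeField r) m) := by
  have hb : IsPeriodicBackground ς := Or.inr ⟨a, h, h1, hς⟩
  have hs1 := (summable_leftField_sub hr0 hr1 hX).1
  have hs2 := summable_wallWeight_sub hX hb (stripeField r)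
  obtain ⟨S, hS⟩ := exists_finset_wallWeight_eq hX hb
  -- the two configurations and their walls coincide outside `(-N, N)`; `A` is a wall on the left of it
  obtain ⟨N, hN⟩ : ∃ N : ℕ, ∀ m : ℤ, N ≤ |m| → τ m = ς m ∧ m ∉ S := by
    obtain ⟨b, hb⟩ := ((hX.union S.finite_toSet).image Int.natAbs).bddAbove
    refine ⟨b + 1, fun m hm => ?_⟩
    by_contra hne
    have : m.natAbs ≤ b := hb ⟨m, ?_, rfl⟩
    · have := Int.natCast_natAbs m
      omega
    · by_contra hm2
      simp only [Set.mem_union, Set.mem_ofPred_eq, Finset.mem_coe, not_or, not_not] at hm2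
      exact hne hm2
  have hh : (1 : ℤ) ≤ h := by exact_mod_cast h1
  set j0 : ℤ := -(N + |a|) with hj0
  set A : ℤ := a + h * j0 with hA
  have hAN : ∀ m, m ≤ A → (N : ℤ) ≤ |m| := by
    intro m hm
    have h2 : (h : ℤ) * j0 ≤ j0 := by
      have : 0 ≤ |a| := abs_nonneg a
      nlinarith
    have := le_abs_self a
    have := neg_abs_le m
    have := abs_nonneg m
    rw [le_abs]; right; linarith
  have hwA : ∀ j : ℤ, IsWall ς (a + h * j) := fun j => by
    rw [hς]; exact ⟨j, by ring⟩
  have hBN : ∀ n : ℕ, 2 * (N + |a|) ≤ n → IsWall τ (A + (h * n : ℕ)) := by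
    intro n hn
    have e : A + (h * n : ℕ) = a + h * (j0 + n) := by rw [hA]; push_cast; ring
    rw [e, (hS _ (hN _ _).2).1]
    · exact hwA _
    · have h2 : (N + |a|) ≤ j0 + n := by rw [hj0]; linarith
      have h3 : j0 + n ≤ (h : ℤ) * (j0 + n) := by
        have : 0 ≤ |a| := abs_nonneg a
        have : (0 : ℤ) ≤ N := by positivity
        nlinarith
      have := neg_abs_le a
      rw [le_abs]; left; linarith
  have hAτ : IsWall τ A := (hS _ (hN _ (hAN A le_rfl)).2).1.2 (hwA _)
  have hfA : ∀ m, m ≤ A → leftField r τ m = leftField r ς m := fun m hm =>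
    leftField_congr fun k hk => (hN k (hAN k (hk.trans hm))).1
  rw [tsum_int_eq_tsum_nat (A := A) (f := fun m => leftField r τ m - leftField r ς m)
      fun m hm => by rw [hfA m hm.le, sub_self],
    tsum_int_eq_tsum_nat (A := A) (f := fun m => wallWeight τ (stripeField r) m - wallWeight ς (stripeField r) m)
      fun m hm => by rw [(hS m (hN m (hAN m hm.le)).2).2, sub_self]]
  have hn1 := summable_nat_of_int hs1 A
  have hn2 := summable_nat_of_int hs2 A
  have hmul : Tendsto (fun n : ℕ => h * n) atTop atTop := tendsto_id.const_mul_atTop' h1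
  have ht1 := hn1.hasSum.tendsto_sum_nat.comp hmul
  have ht2 := hn2.hasSum.tendsto_sum_nat.comp hmul
  have ht3 := hn1.tendsto_atTop_zero.comp hmul
  set xs : ℝ := r / (1 - r) / (1 + r ^ h) with hxs
  have hςB : ∀ n : ℕ, leftField r ς (A + (h * n : ℕ)) = xs := by
    intro n
    rw [show A + (h * n : ℕ) = a + h * (j0 + n) by rw [hA]; push_cast; ring, leftField_periodic hr0 hr1 h1 hς]
  have ht4 : Tendsto (fun n : ℕ => leftField r τ (A + (h * n : ℕ))) atTop (𝓝 xs) := by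
    have := ht3.add_const xs
    rw [zero_add] at this
    refine this.congr fun n => ?_
    simp only [Function.comp, hςB n, sub_add_cancel]
  have ht5 : Tendsto (fun n : ℕ => wallPotential r (leftField r τ (A + (h * n : ℕ)))) atTop
      (𝓝 (wallPotential r xs)) := by
    have hc : Continuous (wallPotential r) := by unfold wallPotential; fun_prop
    exact (hc.tendsto xs).comp ht4
  have ht6 := (ht2.add_const (wallPotential r xs)).sub ht5
  rw [add_sub_cancel_right] at ht6
  refine le_of_tendsto_of_tendsto ht1 ht6 ?_
  filter_upwards [eventually_ge_atTop (2 * (N + |a|)).toNat] with n hn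
  have hn' : 2 * (N + |a|) ≤ n := Int.toNat_le.1 hn
  have h2 := sum_leftField_le hr0 hr1 (h * n) A hAτ (hBN n hn')
  have h3 := sum_leftField_periodic hr0 hr1 h1 hς j0 n
  have h4 : leftField r τ A = xs := by rw [hfA A le_rfl, hA, leftField_periodic hr0 hr1 h1 hς]
  simp only [Function.comp, Finset.sum_sub_distrib]
  rw [← hA] at h3
  rw [h4] at h2
  rw [h3]
  linarith

theorem tsum_pow_mul_defect_le (hr0 : 0 < r) (hr1 : r < 1) {τ ς : ℤ → ℤˣ}
    (hX : {m | τ m ≠ ς m}.Finite) (hς : IsPeriodicBackground ς) :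
    ∑' n : ℕ, r ^ (n + 1) * defect τ ς ((n + 1 : ℕ) : ℤ) ≤
      ∑' m, (wallWeight τ (stripeField r) m - wallWeight ς (stripeField r) m) := by
  rw [← (summable_leftField_sub hr0 hr1 hX).2]
  rcases hς with hς | ⟨a, h, h1, hς⟩
  · exact tsum_leftField_le_of_no_wall hr0 hr1 hX hς
  · exact tsum_leftField_le_of_periodic hr0 hr1 hX h1 hς

theorem summable_pow_mul_stripeDis (hr0 : 0 < r) (hr1 : r < 1) (h : ℕ) :
    Summable fun n : ℕ => r ^ (n + 1) * stripeDis h (n + 1) := by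
  have h1 : ‖r‖ < 1 := by rwa [Real.norm_of_nonneg hr0.le]
  have h3 : Summable fun n : ℕ => (n : ℝ) * r ^ n := by
    simpa using summable_pow_mul_geometric_of_norm_lt_one 1 h1
  refine Summable.of_nonneg_of_le (fun n => mul_nonneg (by positivity) (stripeDis_nonneg _ _))
    (fun n => ?_) ((summable_nat_add_iff 1).2 h3)
  rw [mul_comm]
  exact mul_le_mul_of_nonneg_right (stripeDis_le h (n + 1)) (by positivity)

/-- The weights `v` are such that the nonnegativity of a linear functional of `v` may be checked on
the exponentials `n ↦ r ^ (n + 1)`; the `n`-th weight is attributed to the distance `n + 1`. -/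
def IsLaplaceWeight (v : ℕ → ℝ) : Prop :=
  (∀ n, 0 ≤ v n) ∧ (Summable fun n : ℕ => v n * (n + 1)) ∧
    ∀ c : ℕ → ℝ, (Summable fun n => v n * |c n|) →
      (∀ r : ℝ, 0 < r → r < 1 → 0 ≤ ∑' n, r ^ (n + 1) * c n) → 0 ≤ ∑' n, v n * c n

variable {v : ℕ → ℝ}

theorem IsLaplaceWeight.summable_mul (hv : IsLaplaceWeight v) {c : ℕ → ℝ} {C : ℝ}
    (hc : ∀ n : ℕ, |c n| ≤ C * (n + 1)) : Summable fun n => v n * c n := by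
  refine Summable.of_norm_bounded (hv.2.1.mul_left C) fun n => ?_
  rw [norm_mul, Real.norm_of_nonneg (hv.1 n), Real.norm_eq_abs, mul_left_comm]
  exact mul_le_mul_of_nonneg_left (hc n) (hv.1 n)

theorem IsLaplaceWeight.summable_stripeDis (hv : IsLaplaceWeight v) (h : ℕ) :
    Summable fun n => v n * stripeDis h (n + 1) :=
  hv.summable_mul (C := 1) fun n => by
    rw [abs_of_nonneg (stripeDis_nonneg _ _), one_mul]
    exact_mod_cast stripeDis_le h (n + 1)

theorem abs_defect_le_mul {G : Type*} [AddCommGroup G] {t s : G → ℤˣ} (hX : {x | t x ≠ s x}.Finite)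
    (y : G) (n : ℕ) : |defect t s y| ≤ (2 * ∑' x, dis (t x) (s x)) * (n + 1) := by
  have h0 : 0 ≤ ∑' x, dis (t x) (s x) := tsum_nonneg fun _ => dis_nonneg _ _
  refine (abs_defect_le hX y).trans (le_mul_of_one_le_right (by positivity) ?_)
  linarith [(Nat.cast_nonneg n : (0 : ℝ) ≤ n)]

theorem IsLaplaceWeight.summable_defect (hv : IsLaplaceWeight v) {G : Type*} [AddCommGroup G]
    {t s : G → ℤˣ} (hX : {x | t x ≠ s x}.Finite) (f : ℕ → G) :
    Summable fun n => v n * defect t s (f n) :=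
  hv.summable_mul fun n => abs_defect_le_mul hX _ n

theorem abs_wallWeight_stripeDis_le (τ : ℤ → ℤˣ) (n : ℕ) (m : ℤ) :
    |wallWeight τ (fun h => stripeDis h n) m| ≤ n := by
  unfold wallWeight
  split_ifs
  · rw [abs_of_nonneg (stripeDis_nonneg _ _)]; exact stripeDis_le _ _
  · simp

theorem tsum_mul_wallWeight_eq {τ : ℤ → ℤˣ} (w : ℕ → ℝ) (m : ℤ) :
    ∑' n, w n * wallWeight τ (fun h => stripeDis h (n + 1)) m =
      wallWeight τ (fun h => ∑' n, w n * stripeDis h (n + 1)) m := by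
  unfold wallWeight
  split_ifs
  · rfl
  · simp

/-- The energy of one wall in the periodic configuration of stripes of width `h`, for the nearest neighbour
coupling `J` and the weight `v n` of the distance `n + 1`; the value at `h = 0` is the energy of a single
wall. -/
noncomputable def widthEnergy (J : ℝ) (v : ℕ → ℝ) (h : ℕ) : ℝ :=
  2 * J - 2 * ∑' n, v n * stripeDis h (n + 1)

theorem wallWeight_widthEnergy (J : ℝ) (τ : ℤ → ℤˣ) (m : ℤ) :
    wallWeight τ (widthEnergy J v) m = 2 * J * dis (τ m) (τ (m + -1)) -
      2 * ∑' n, v n * wallWeight τ (fun h => stripeDis h (n + 1)) m := by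
  rw [tsum_mul_wallWeight_eq]
  by_cases h : IsWall τ m
  · rw [wallWeight_of_isWall h, wallWeight_of_isWall h, widthEnergy, ← sub_eq_add_neg, dis_of_ne h, mul_one]
  · have h2 := h
    unfold IsWall at h2
    push Not at h2
    rw [wallWeight_of_not_isWall h, wallWeight_of_not_isWall h, ← sub_eq_add_neg, ← h2, dis_self]
    simp

/-- The energy of a finite perturbation along a line is at least the sum of the energies of the walls, each
with the energy of periodic stripes whose width is the distance to the next wall. -/
theorem tsum_wallWeight_widthEnergy_le (hv : IsLaplaceWeight v) (J : ℝ) {τ ς : ℤ → ℤˣ}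
    (hX : {m | τ m ≠ ς m}.Finite) (hς : IsPeriodicBackground ς) :
    ∑' m, (wallWeight τ (widthEnergy J v) m - wallWeight ς (widthEnergy J v) m) ≤
      2 * J * defect τ ς 1 - 2 * ∑' n : ℕ, v n * defect τ ς ((n + 1 : ℕ) : ℤ) := by
  obtain ⟨S, hS⟩ := exists_finset_wallWeight_eq hX hς
  have hsum : ∀ F : ℕ → ℝ, ∑' m, (wallWeight τ F m - wallWeight ς F m) =
      ∑ m ∈ S, (wallWeight τ F m - wallWeight ς F m) := fun F =>
    tsum_eq_sum fun m hm => by rw [(hS m hm).2, sub_self]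
  set W : ℕ → ℝ := fun n => ∑ m ∈ S, (wallWeight τ (fun h => stripeDis h n) m -
    wallWeight ς (fun h => stripeDis h n) m) with hW
  have hWb : ∀ n : ℕ, |W (n + 1)| ≤ (2 * S.card) * (n + 1) := by
    intro n
    have e : (2 * (S.card : ℝ)) * (n + 1) = S.card • (2 * ((n : ℝ) + 1)) := by
      rw [nsmul_eq_mul]; ring
    rw [e]
    refine (Finset.abs_sum_le_sum_abs _ _).trans (Finset.sum_le_card_nsmul _ _ _ fun m _ => ?_)
    have h1 := abs_wallWeight_stripeDis_le τ (n + 1) m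
    have h2 := abs_wallWeight_stripeDis_le ς (n + 1) m
    have h3 := abs_sub (wallWeight τ (fun h => stripeDis h (n + 1)) m) (wallWeight ς (fun h => stripeDis h (n + 1)) m)
    push_cast at h1 h2
    linarith
  -- the inequality for exponential weights transfers to `v`
  have hexp : ∀ r : ℝ, 0 < r → r < 1 → 0 ≤ ∑' n : ℕ, r ^ (n + 1) * (W (n + 1) - defect τ ς ((n + 1 : ℕ) : ℤ)) := by
    intro r hr0 hr1
    have hww : ∀ (τ : ℤ → ℤˣ) m, Summable fun n : ℕ => r ^ (n + 1) * wallWeight τ (fun h => stripeDis h (n + 1)) m := by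
      intro τ m
      unfold wallWeight
      split_ifs
      · exact summable_pow_mul_stripeDis hr0 hr1 _
      · simp
    have h1 := tsum_pow_mul_defect_le hr0 hr1 hX hς
    rw [hsum] at h1
    have h2 : ∀ (τ : ℤ → ℤˣ) m, wallWeight τ (stripeField r) m =
        ∑' n : ℕ, r ^ (n + 1) * wallWeight τ (fun h => stripeDis h (n + 1)) m := by
      intro τ m
      rw [tsum_mul_wallWeight_eq]
      simp only [tsum_pow_mul_stripeDis hr0 hr1]
    simp only [h2] at h1
    have h3 : ∑' n : ℕ, r ^ (n + 1) * W (n + 1) = ∑ m ∈ S,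
        (∑' n : ℕ, r ^ (n + 1) * wallWeight τ (fun h => stripeDis h (n + 1)) m -
        ∑' n : ℕ, r ^ (n + 1) * wallWeight ς (fun h => stripeDis h (n + 1)) m) := by
      simp only [hW, Finset.mul_sum, mul_sub]
      rw [Summable.tsum_finsetSum fun m _ => (hww τ m).sub (hww ς m)]
      exact Finset.sum_congr rfl fun m _ => (hww τ m).tsum_sub (hww ς m)
    have h4 : Summable fun n : ℕ => r ^ (n + 1) * W (n + 1) := by
      simp only [hW, Finset.mul_sum, mul_sub]
      exact summable_sum fun m _ => (hww τ m).sub (hww ς m)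
    have h5 : Summable fun n : ℕ => r ^ (n + 1) * defect τ ς ((n + 1 : ℕ) : ℤ) := by
      refine Summable.of_norm_bounded (((summable_nat_add_iff 1).2
        (summable_geometric_of_lt_one hr0.le hr1)).mul_right (2 * ∑' x, dis (τ x) (ς x))) fun n => ?_
      rw [norm_mul, Real.norm_of_nonneg (by positivity), Real.norm_eq_abs]
      exact mul_le_mul_of_nonneg_left (abs_defect_le hX _) (by positivity)
    simp only [mul_sub]
    rw [h4.tsum_sub h5, h3]
    linarith
  have hcb : ∀ n : ℕ, |W (n + 1) - defect τ ς ((n + 1 : ℕ) : ℤ)| ≤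
      (2 * S.card + 2 * ∑' x, dis (τ x) (ς x)) * (n + 1) := by
    intro n
    refine (abs_sub _ _).trans ?_
    rw [add_mul]
    exact add_le_add (hWb n) (abs_defect_le_mul hX _ n)
  have h1 := hv.2.2 (fun n => W (n + 1) - defect τ ς ((n + 1 : ℕ) : ℤ))
    (hv.summable_mul fun n => by rw [abs_abs]; exact hcb n) hexp
  simp only [mul_sub] at h1
  rw [(hv.summable_mul hWb).tsum_sub (hv.summable_defect hX _)] at h1
  have hvw : ∀ (τ : ℤ → ℤˣ) m, Summable fun n : ℕ => v n * wallWeight τ (fun h => stripeDis h (n + 1)) m := by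
    intro τ m
    exact hv.summable_mul (C := 1) fun n => by
      rw [one_mul]; exact_mod_cast abs_wallWeight_stripeDis_le τ (n + 1) m
  have h2 : ∑' n : ℕ, v n * W (n + 1) = ∑ m ∈ S,
      (∑' n : ℕ, v n * wallWeight τ (fun h => stripeDis h (n + 1)) m -
      ∑' n : ℕ, v n * wallWeight ς (fun h => stripeDis h (n + 1)) m) := by
    simp only [hW, Finset.mul_sum, mul_sub]
    rw [Summable.tsum_finsetSum fun m _ => (hvw τ m).sub (hvw ς m)]
    exact Finset.sum_congr rfl fun m _ => (hvw τ m).tsum_sub (hvw ς m)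
  have h3 : ∑ m ∈ S, (dis (τ m) (τ (m + -1)) - dis (ς m) (ς (m + -1))) = defect τ ς 1 := by
    rw [← defect_neg, defect]
    symm
    refine tsum_eq_sum fun m hm => ?_
    have h4 := (hS m hm).1
    rw [← sub_eq_add_neg]
    by_cases hw : IsWall ς m
    · rw [dis_of_ne hw, dis_of_ne (h4.2 hw), sub_self]
    · have hw' := h4.not.2 hw
      unfold IsWall at hw hw'
      push Not at hw hw'
      rw [← hw, ← hw', dis_self, dis_self, sub_self]
  rw [hsum]
  simp only [wallWeight_widthEnergy]
  have h4 : ∑ m ∈ S, ((2 * J * dis (τ m) (τ (m + -1)) -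
      2 * ∑' n, v n * wallWeight τ (fun h => stripeDis h (n + 1)) m) -
      (2 * J * dis (ς m) (ς (m + -1)) - 2 * ∑' n, v n * wallWeight ς (fun h => stripeDis h (n + 1)) m)) =
      2 * J * ∑ m ∈ S, (dis (τ m) (τ (m + -1)) - dis (ς m) (ς (m + -1))) -
      2 * ∑ m ∈ S, (∑' n : ℕ, v n * wallWeight τ (fun h => stripeDis h (n + 1)) m -
      ∑' n : ℕ, v n * wallWeight ς (fun h => stripeDis h (n + 1)) m) := by
    rw [Finset.mul_sum, Finset.mul_sum, ← Finset.sum_sub_distrib]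
    exact Finset.sum_congr rfl fun m _ => by ring
  rw [h4, h3, ← h2]
  linarith
end Line

/-! ### Localization of the energy of a line near its walls -/

section Line

/-- The indicator of `m` being a wall of `τ` with no other wall up to `m + k`. -/
noncomputable def freeWall (τ : ℤ → ℤˣ) (k : ℕ) (m : ℤ) : ℝ :=
  open Classical in if IsWall τ m ∧ ∀ i : ℕ, 1 ≤ i → i ≤ k → ¬ IsWall τ (m + i) then 1 else 0

/-- The indicator of the presence of a wall of `τ` among the sites `x - l + 1, …, x`. -/
noncomputable def nearWall (τ : ℤ → ℤˣ) (l : ℕ) (x : ℤ) : ℝ :=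
  open Classical in if ∃ k < l, IsWall τ (x - (k : ℕ)) then 1 else 0

/-- The smaller of `h` and `l`, where `h = 0` stands for an infinite width. -/
def capWidth (l h : ℕ) : ℕ := if h = 0 then l else min h l

/-- The number of `k < l` such that `m` is a wall at distance more than `k` from its successor. -/
theorem sum_freeWall (τ : ℤ → ℤˣ) (l : ℕ) (m : ℤ) :
    ∑ k ∈ Finset.range l, freeWall τ k m = wallWeight τ (fun h => (capWidth l h : ℝ)) m := by
  classical
  by_cases hw : IsWall τ m
  · rw [wallWeight_of_isWall hw]
    have h1 : ∀ k, freeWall τ k m = if k ∈ Finset.range (if gap τ m = 0 then k + 1 else gap τ m) then 1 else 0 := by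
      intro k
      unfold freeWall
      refine if_congr ?_ rfl rfl
      simp only [hw, true_and, Finset.mem_range]
      split_ifs with h0
      · simp only [Nat.lt_succ_self, iff_true]
        exact fun i hi _ => not_isWall_of_gap_eq_zero h0 hi
      · constructor
        · intro h
          by_contra! hle
          exact h _ (Nat.pos_of_ne_zero h0) hle (isWall_add_gap h0)
        · exact fun h i hi hik => not_isWall_of_lt_gap hi (by omega)
    simp only [h1]
    unfold capWidth
    split_ifs with h0
    · simp
    · rw [Finset.sum_ite_mem, Finset.sum_const, nsmul_eq_mul, mul_one]
      congr 1
      rw [min_comm]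
      rcases le_total l (gap τ m) with h | h
      · rw [Finset.inter_eq_left.2 (Finset.range_subset_range.2 h), Finset.card_range, min_eq_left h]
      · rw [Finset.inter_eq_right.2 (Finset.range_subset_range.2 h), Finset.card_range, min_eq_right h]
  · rw [wallWeight_of_not_isWall hw]
    exact Finset.sum_eq_zero fun k _ => if_neg fun h => hw h.1

/-- A site is near a wall if and only if exactly one wall is the last one before it at distance `k < l`. -/
theorem sum_freeWall_shift (τ : ℤ → ℤˣ) (l : ℕ) (x : ℤ) :
    ∑ k ∈ Finset.range l, freeWall τ k (x - k) = nearWall τ l x := by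
  classical
  by_cases h : ∃ k, k < l ∧ IsWall τ (x - (k : ℕ))
  · rw [nearWall, if_pos h]
    have hk := Nat.find_spec h
    have hmin := fun i => Nat.find_min h (m := i)
    set k := Nat.find h
    rw [Finset.sum_eq_single_of_mem k (Finset.mem_range.2 hk.1)]
    · refine if_pos ⟨hk.2, fun i h1 h2 hw => hmin (k - i) (by omega) ⟨by omega, ?_⟩⟩
      convert hw using 1
      omega
    · intro j hj hjk
      refine if_neg fun hfw => ?_
      rcases Nat.lt_or_gt_of_ne hjk with hlt | hlt
      · exact hmin j hlt ⟨Finset.mem_range.1 hj, hfw.1⟩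
      · refine hfw.2 (j - k) (by omega) (by omega) ?_
        convert hk.2 using 1
        omega
  · rw [nearWall, if_neg h]
    exact Finset.sum_eq_zero fun k hk => if_neg fun hw => h ⟨k, Finset.mem_range.1 hk, hw.1⟩

theorem summable_freeWall_sub {τ ς : ℤ → ℤˣ} (hX : {m | τ m ≠ ς m}.Finite) (k : ℕ) :
    Summable fun m => freeWall τ k m - freeWall ς k m := by
  classical
  have hP := finite_isWall_symmDiff hX
  have hQ : (⋃ i ∈ Finset.range (k + 1), (fun m : ℤ => m + i) ⁻¹' {m | ¬ (IsWall τ m ↔ IsWall ς m)}).Finite :=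
    Set.Finite.biUnion (Finset.finite_toSet _) fun k _ => hP.preimage fun _ _ _ _ h => by simpa using h
  refine summable_of_ne_finset_zero (s := hQ.toFinset) fun m hm => ?_
  have hm : ∀ i : ℕ, i ≤ k → (IsWall τ (m + i) ↔ IsWall ς (m + i)) := by
    intro i hi
    by_contra hne
    apply hm
    simp only [Set.Finite.mem_toFinset, Set.mem_iUnion]
    exact ⟨i, Finset.mem_range.2 (by omega), hne⟩
  have hm0 : IsWall τ m ↔ IsWall ς m := by simpa using hm 0 (by omega)
  rw [sub_eq_zero]
  unfold freeWall
  refine if_congr (and_congr hm0 ?_) rfl rfl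
  exact forall_congr' fun i => forall_congr' fun _ => forall_congr' fun h => (hm i h).not

theorem tsum_nearWall_sub {τ ς : ℤ → ℤˣ} (hX : {m | τ m ≠ ς m}.Finite) (l : ℕ) :
    (Summable fun x => nearWall τ l x - nearWall ς l x) ∧
    ∑' x, (nearWall τ l x - nearWall ς l x) =
      ∑' m, (wallWeight τ (fun h => (capWidth l h : ℝ)) m - wallWeight ς (fun h => (capWidth l h : ℝ)) m) := by
  have h1 : ∀ k : ℕ, Summable fun x : ℤ => freeWall τ k (x - k) - freeWall ς k (x - k) := fun k =>
    ((Equiv.subRight (k : ℤ)).summable_iff (f := fun x => freeWall τ k x - freeWall ς k x)).2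
      (summable_freeWall_sub hX k)
  simp only [← sum_freeWall, ← sum_freeWall_shift, ← Finset.sum_sub_distrib]
  refine ⟨summable_sum fun k _ => h1 k, ?_⟩
  rw [Summable.tsum_finsetSum fun k _ => h1 k,
    Summable.tsum_finsetSum fun k _ => summable_freeWall_sub hX k]
  exact Finset.sum_congr rfl fun k _ =>
    (Equiv.subRight (k : ℤ)).tsum_eq fun x => freeWall τ k x - freeWall ς k x

/-- Lower bound for the energy along a line, localized near the walls. -/
theorem mul_tsum_nearWall_le {v : ℕ → ℝ} (hv : IsLaplaceWeight v) {J e : ℝ} {l : ℕ}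
    (hE : ∀ h, e * capWidth l h ≤ widthEnergy J v h) {τ ς : ℤ → ℤˣ}
    (hX : {m | τ m ≠ ς m}.Finite)
    (hς : (∀ m, ¬ IsWall ς m) ∨ ∃ (a : ℤ) (h : ℕ), 1 ≤ h ∧ h ≤ l ∧ widthEnergy J v h = e * h ∧
      ∀ m, IsWall ς m ↔ (h : ℤ) ∣ m - a) :
    e * ∑' x, (nearWall τ l x - nearWall ς l x) ≤
      2 * J * defect τ ς 1 - 2 * ∑' n : ℕ, v n * defect τ ς ((n + 1 : ℕ) : ℤ) := by
  have hb : IsPeriodicBackground ς := by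
    rcases hς with hς | ⟨a, h, h1, -, -, hς⟩
    · exact Or.inl hς
    · exact Or.inr ⟨a, h, h1, hς⟩
  refine le_trans ?_ (tsum_wallWeight_widthEnergy_le hv J hX hb)
  rw [(tsum_nearWall_sub hX l).2, ← tsum_mul_left]
  refine Summable.tsum_le_tsum (fun m => ?_) ((summable_wallWeight_sub hX hb _).mul_left e)
    (summable_wallWeight_sub hX hb _)
  have hτ : e * wallWeight τ (fun h => (capWidth l h : ℝ)) m ≤ wallWeight τ (widthEnergy J v) m := by
    unfold wallWeight
    split_ifs
    · exact hE _
    · simp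
  have hς' : wallWeight ς (widthEnergy J v) m = e * wallWeight ς (fun h => (capWidth l h : ℝ)) m := by
    by_cases hw : IsWall ς m
    · rcases hς with hς | ⟨a, h, h1, hl, he, hς⟩
      · exact absurd hw (hς m)
      · rw [wallWeight_of_isWall hw, wallWeight_of_isWall hw, gap_eq_of_forall_isWall_iff h1 hς hw, he,
          capWidth, if_neg (by omega), min_eq_left hl]
    · rw [wallWeight_of_not_isWall hw, wallWeight_of_not_isWall hw, mul_zero]
  rw [mul_sub, hς']
  linarith

theorem nearWall_eq_one {ς : ℤ → ℤˣ} {a : ℤ} {h l : ℕ} (h1 : 1 ≤ h) (hl : h ≤ l)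
    (hς : ∀ m, IsWall ς m ↔ (h : ℤ) ∣ m - a) (x : ℤ) : nearWall ς l x = 1 := by
  refine if_pos ⟨((x - a) % h).toNat, ?_, (hς _).2 ?_⟩
  · have h2 := Int.emod_lt_of_pos (x - a) (show (0 : ℤ) < h by omega)
    have h3 := Int.emod_nonneg (x - a) (show (h : ℤ) ≠ 0 by omega)
    omega
  · rw [Int.toNat_of_nonneg (Int.emod_nonneg (x - a) (show (h : ℤ) ≠ 0 by omega)),
      sub_right_comm]
    exact Int.dvd_self_sub_emod

end Line

/-! ### The energy of a finite perturbation on the lattice -/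

section Lattice
variable {d : ℕ}

/-- The Euclidean norm of a lattice vector. -/
noncomputable def siteNorm (y : Site d) : ℝ := Real.sqrt (∑ i, (y i : ℝ) ^ 2)

theorem siteDist_eq (x y : Site d) : siteDist x y = siteNorm (y - x) := by
  unfold siteDist siteNorm
  congr 1
  refine Finset.sum_congr rfl fun i _ => ?_
  simp only [Pi.sub_apply, Int.cast_sub]
  ring

theorem siteNorm_neg (y : Site d) : siteNorm (-y) = siteNorm y := by
  simp [siteNorm]

theorem siteNorm_nonneg (y : Site d) : 0 ≤ siteNorm y := Real.sqrt_nonneg _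

theorem siteNorm_zero : siteNorm (0 : Site d) = 0 := by simp [siteNorm]

/-- The power law `|y| ^ (-p)`; for `p ≠ 0` its value at `y = 0` is the junk value `0`, so that sums over
`y ≠ 0` may be taken over all `y`. -/
noncomputable def decay (p : ℝ) (y : Site d) : ℝ := 1 / siteNorm y ^ p

theorem decay_nonneg (p : ℝ) (y : Site d) : 0 ≤ decay p y :=
  one_div_nonneg.2 (Real.rpow_nonneg (siteNorm_nonneg y) p)

theorem decay_zero {p : ℝ} (hp : p ≠ 0) : decay p (0 : Site d) = 0 := by
  rw [decay, siteNorm_zero, Real.zero_rpow hp, div_zero]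

/-- The coefficient of the disagreement at displacement `y` in the energy. -/
noncomputable def pairWeight (J p : ℝ) (y : Site d) : ℝ :=
  open Classical in decay p y - if siteNorm y = 1 then J else 0

theorem pairEnergy_eq (J p : ℝ) (x y : Site d) (a b : ℤˣ) :
    pairEnergy J p x y a b = -2 * pairWeight J p (y - x) * dis a b := by
  unfold pairEnergy pairWeight decay
  rw [siteDist_eq, dis_eq_half]
  split_ifs <;> ring

theorem pairWeight_neg (J p : ℝ) (y : Site d) : pairWeight J p (-y) = pairWeight J p y := by
  simp only [pairWeight, decay, siteNorm_neg]

/-- The vector `n e_k`. -/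
abbrev axisVec (k : Fin d) (n : ℤ) : Site d := Pi.single k n

theorem siteNorm_add_axisVec {i j : Fin d} (h : i ≠ j) (a b : ℤ) :
    siteNorm (axisVec i a + axisVec j b) = Real.sqrt ((a : ℝ) ^ 2 + (b : ℝ) ^ 2) := by
  unfold siteNorm
  congr 1
  have : ∀ k, (((axisVec i a + axisVec j b : Site d) k : ℤ) : ℝ) ^ 2 =
      (if k = i then (a : ℝ) ^ 2 else 0) + (if k = j then (b : ℝ) ^ 2 else 0) := by
    intro k
    simp only [axisVec, Pi.add_apply, Pi.single_apply]
    by_cases hi : k = i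
    · have hj : k ≠ j := fun hj => h (hi.symm.trans hj)
      simp [hi, h]
    · by_cases hj : k = j <;> simp [hi, hj, h.symm]
  simp only [this]
  rw [Finset.sum_add_distrib]
  simp

theorem abs_apply_le_siteNorm (y : Site d) (k : Fin d) : |(y k : ℝ)| ≤ siteNorm y := by
  unfold siteNorm
  rw [← Real.sqrt_sq_eq_abs]
  exact Real.sqrt_le_sqrt (Finset.single_le_sum (f := fun i => (y i : ℝ) ^ 2) (fun i _ => sq_nonneg _) (Finset.mem_univ k))

theorem siteNorm_sq (y : Site d) : siteNorm y ^ 2 = ∑ i, (y i : ℝ) ^ 2 :=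
  Real.sq_sqrt (Finset.sum_nonneg fun _ _ => sq_nonneg _)

theorem one_le_siteNorm {y : Site d} (hy : y ≠ 0) : 1 ≤ siteNorm y := by
  obtain ⟨k, hk⟩ := Function.ne_iff.1 hy
  refine le_trans ?_ (abs_apply_le_siteNorm y k)
  have : (1 : ℤ) ≤ |y k| := Int.one_le_abs hk
  exact_mod_cast this

theorem eq_axisVec_of_siteNorm_eq_one {y : Site d} (hy : siteNorm y = 1) {k : Fin d} (hk : y k ≠ 0) :
    y = axisVec k (y k) ∧ (y k = 1 ∨ y k = -1) := by
  have h1 := siteNorm_sq y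
  rw [hy, one_pow, ← Finset.add_sum_erase _ _ (Finset.mem_univ k)] at h1
  have h2 : (1 : ℝ) ≤ (y k : ℝ) ^ 2 := by
    have : (1 : ℤ) ≤ |y k| := Int.one_le_abs hk
    have : (1 : ℝ) ≤ |(y k : ℝ)| := by exact_mod_cast this
    rw [← sq_abs]; nlinarith
  have h3 : 0 ≤ ∑ i ∈ Finset.univ.erase k, (y i : ℝ) ^ 2 := Finset.sum_nonneg fun _ _ => sq_nonneg _
  have h4 : ∑ i ∈ Finset.univ.erase k, (y i : ℝ) ^ 2 = 0 := by linarith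
  have h5 := (Finset.sum_eq_zero_iff_of_nonneg fun _ _ => sq_nonneg _).1 h4
  constructor
  · ext i
    by_cases hi : i = k
    · subst hi; simp [axisVec]
    · have := h5 i (Finset.mem_erase.2 ⟨hi, Finset.mem_univ i⟩)
      have : y i = 0 := by simpa using this
      rw [this, axisVec, Pi.single_eq_of_ne hi]
  · have : (y k : ℝ) ^ 2 = 1 := by linarith
    have : (y k) ^ 2 = 1 := by exact_mod_cast this
    exact sq_eq_one_iff.1 this

theorem siteNorm_axisVec (k : Fin d) (n : ℤ) : siteNorm (axisVec k n) = |(n : ℝ)| := by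
  unfold siteNorm
  rw [← Real.sqrt_sq_eq_abs, Finset.sum_eq_single k]
  · simp [axisVec]
  · intro i _ hi; simp [axisVec, Pi.single_eq_of_ne hi]
  · simp

theorem finite_siteNorm_eq_one : {y : Site d | siteNorm y = 1}.Finite := by
  refine (Set.Finite.union (Set.finite_range fun k : Fin d => axisVec k 1)
    (Set.finite_range fun k : Fin d => axisVec k (-1))).subset fun y hy => ?_
  simp only [Set.mem_ofPred_eq] at hy
  have hy0 : y ≠ 0 := by rintro rfl; rw [siteNorm_zero] at hy; norm_num at hy
  obtain ⟨k, hk⟩ := Function.ne_iff.1 hy0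
  obtain ⟨h1, h2 | h2⟩ := eq_axisVec_of_siteNorm_eq_one hy hk
  · left; exact ⟨k, by rw [h1, h2]⟩
  · right; exact ⟨k, by rw [h1, h2]⟩

open scoped ENNReal in
/-- The comparison of `|y|` with the coordinates bounds the power law by a product of summable functions of
the coordinates. -/
theorem summable_decay {p : ℝ} (hp : (d : ℝ) < p) : Summable fun y : Site d => decay p y := by
  rcases Nat.eq_zero_or_pos d with rfl | hd
  · exact summable_of_hasFiniteSupport (Set.toFinite _)
  have hd' : (0 : ℝ) < d := by exact_mod_cast hd
  set q : ℝ := p / d with hq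
  have hq1 : 1 < q := by rw [hq, lt_div_iff₀ hd']; linarith
  -- the summable weight of one coordinate
  have h1 : Summable fun k : ℤ => (1 + |(k : ℝ)|) ^ (-q) := by
    have h : Summable fun n : ℕ => (1 + |((n : ℕ) : ℝ)|) ^ (-q) := by
      have := (summable_nat_add_iff 1).2 (Real.summable_nat_rpow.2 (show -q < -1 by linarith))
      refine this.congr fun n => ?_
      push_cast
      rw [abs_of_nonneg (by positivity), add_comm]
    exact Summable.of_nat_of_neg (by simpa using h) (by simpa using h)
  have h2 : Summable fun y : Site d => ∏ i, (1 + |(y i : ℝ)|) ^ (-q) := by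
    have h3 := tsum_pi_fin_prod (n := d) fun _ k => ENNReal.ofReal ((1 + |(k : ℝ)|) ^ (-q))
    have h4 : ∑' k : ℤ, ENNReal.ofReal ((1 + |(k : ℝ)|) ^ (-q)) ≠ ∞ := h1.tsum_ofReal_ne_top
    have h5 : ∑' y : Site d, ENNReal.ofReal (∏ i, (1 + |(y i : ℝ)|) ^ (-q)) ≠ ∞ := by
      have e : ∀ y : Site d, ENNReal.ofReal (∏ i, (1 + |(y i : ℝ)|) ^ (-q)) =
          ∏ i, ENNReal.ofReal ((1 + |(y i : ℝ)|) ^ (-q)) := fun y =>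
        ENNReal.ofReal_prod_of_nonneg fun i _ => by positivity
      simp only [e]
      rw [h3]
      exact ENNReal.prod_ne_top fun i _ => h4
    have h6 := ENNReal.summable_toReal h5
    refine h6.congr fun y => ?_
    rw [ENNReal.toReal_ofReal (Finset.prod_nonneg fun i _ => by positivity)]
  refine Summable.of_nonneg_of_le (decay_nonneg p) (fun y => ?_) (h2.mul_left (2 ^ p))
  by_cases hy : y = 0
  · rw [hy, decay_zero (by linarith)]
    exact mul_nonneg (by positivity) (Finset.prod_nonneg fun i _ => by positivity)
  · have hn := one_le_siteNorm hy
    have h3 : ∀ i, (2 * siteNorm y) ^ (-q) ≤ (1 + |(y i : ℝ)|) ^ (-q) := fun i =>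
      Real.rpow_le_rpow_of_nonpos (by positivity) (by linarith [abs_apply_le_siteNorm y i]) (by linarith)
    have h4 : ((2 * siteNorm y) ^ (-q)) ^ d ≤ ∏ i, (1 + |(y i : ℝ)|) ^ (-q) := by
      calc ((2 * siteNorm y) ^ (-q)) ^ d = ∏ _i : Fin d, (2 * siteNorm y) ^ (-q) := by simp
        _ ≤ _ := Finset.prod_le_prod (fun i _ => by positivity) fun i _ => h3 i
    have h5 : ((2 * siteNorm y) ^ (-q)) ^ d = (2 ^ p)⁻¹ * decay p y := by
      rw [← Real.rpow_natCast, ← Real.rpow_mul (by positivity), hq, decay]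
      have : -(p / d) * (d : ℝ) = -p := by field_simp
      rw [this, Real.rpow_neg (by positivity), Real.mul_rpow (by norm_num) (siteNorm_nonneg y), mul_inv, one_div]
    rw [h5] at h4
    have h6 : (0 : ℝ) < 2 ^ p := by positivity
    calc decay p y = 2 ^ p * ((2 ^ p)⁻¹ * decay p y) := by field_simp
      _ ≤ _ := mul_le_mul_of_nonneg_left h4 h6.le

theorem summable_siteNorm_eq_one (J : ℝ) (f : Site d → ℝ) :
    Summable fun y : Site d => (open Classical in if siteNorm y = 1 then J else 0) * f y := by
  refine summable_of_ne_finset_zero (s := finite_siteNorm_eq_one.toFinset) fun y hy => ?_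
  have : siteNorm y ≠ 1 := by simpa using hy
  rw [if_neg this, zero_mul]

theorem summable_mul_of_abs_le {p C : ℝ} (hp : (d : ℝ) < p) {f : Site d → ℝ} (hf : ∀ y, |f y| ≤ C) :
    Summable fun y => decay p y * f y := by
  refine Summable.of_norm_bounded ((summable_decay hp).mul_right C) fun y => ?_
  rw [norm_mul, Real.norm_of_nonneg (decay_nonneg p y)]
  exact mul_le_mul_of_nonneg_left (hf y) (decay_nonneg p y)

theorem summable_pairWeight_mul {p C : ℝ} (hp : (d : ℝ) < p) (J : ℝ) {f : Site d → ℝ}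
    (hf : ∀ y, |f y| ≤ C) : Summable fun y => pairWeight J p y * f y := by
  simp only [pairWeight, sub_mul]
  exact (summable_mul_of_abs_le hp hf).sub (summable_siteNorm_eq_one J f)

/-- The energy difference between a configuration `t`, equal to `σ` in `X` and to `s` outside, and `s`. -/
theorem hamiltonian_sub_eq {J p : ℝ} (hp : (d : ℝ) < p) (X : Finset (Site d)) {σ t s : SpinConfig d}
    (htX : ∀ x ∈ X, t x = σ x) (hts : ∀ x ∉ X, t x = s x) :
    hamiltonian J p X σ s - hamiltonian J p X s s = -∑' y, pairWeight J p y * defect t s y := by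
  classical
  set G : Site d → Site d → ℝ := fun x z => dis (t x) (t z) - dis (s x) (s z) with hG
  have hGb : ∀ x z, |G x z| ≤ 2 := fun x z => by
    refine (abs_dis_sub_dis_le _ _ _ _).trans ?_
    linarith [dis_le_one (t x) (s x), dis_le_one (t z) (s z)]
  have hGsymm : ∀ x z, G x z = G z x := fun x z => by simp only [hG, dis_comm]
  have hGself : ∀ x, G x x = 0 := fun x => by simp [hG, dis_self]
  have hG0 : ∀ x z, x ∉ X → z ∉ X → G x z = 0 := fun x z hx hz => by
    simp only [hG, hts x hx, hts z hz, sub_self]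
  set P : Site d → Site d → ℝ := fun x z => pairWeight J p (z - x) * G x z with hP
  have hPsum' : ∀ x, Summable fun y => pairWeight J p y * G x (x + y) := fun x =>
    summable_pairWeight_mul hp J fun y => hGb _ _
  have hPsum : ∀ x, Summable fun z => P x z := fun x => by
    rw [← (Equiv.addLeft x).summable_iff]
    refine (hPsum' x).congr fun y => ?_
    simp [hP]
  have hPtsum : ∀ x, ∑' y, pairWeight J p y * G x (x + y) = ∑' z, P x z := fun x => by
    rw [← (Equiv.addLeft x).tsum_eq fun z => P x z]
    refine tsum_congr fun y => ?_
    simp [hP]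
  have hPE : ∀ x z, pairEnergy J p x z (t x) (t z) - pairEnergy J p x z (s x) (s z) = -2 * P x z := by
    intro x z
    rw [pairEnergy_eq, pairEnergy_eq]
    simp only [hP, hG]; ring
  -- the left-hand side
  have hL : hamiltonian J p X σ s - hamiltonian J p X s s =
      ∑ x ∈ X, (-2 * ∑' z, P x z + ∑ z ∈ X, P x z) := by
    unfold hamiltonian
    have hsumE : ∀ u : SpinConfig d, ∀ x, Summable fun z : {z // z ∉ X} => pairEnergy J p x z (u x) (s z) := by
      intro u x
      have : Summable fun z : Site d => pairEnergy J p x z (u x) (s z) := by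
        rw [← (Equiv.addLeft x).summable_iff]
        refine ((summable_pairWeight_mul hp J (C := 1) (f := fun y => dis (u x) (s (x + y)))
          fun y => ?_).mul_left (-2)).congr fun y => ?_
        · rw [abs_of_nonneg (dis_nonneg _ _)]; exact dis_le_one _ _
        · simp only [Function.comp, Equiv.coe_addLeft, pairEnergy_eq, add_sub_cancel_left]; ring
      exact this.subtype _
    have h1 : ∑ x ∈ X, ∑ y ∈ X.erase x, pairEnergy J p x y (σ x) (σ y) -
        ∑ x ∈ X, ∑ y ∈ X.erase x, pairEnergy J p x y (s x) (s y) = ∑ x ∈ X, (-2 * ∑ z ∈ X, P x z) := by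
      rw [← Finset.sum_sub_distrib]
      refine Finset.sum_congr rfl fun x hx => ?_
      rw [← Finset.sum_sub_distrib, Finset.mul_sum, ← Finset.add_sum_erase _ _ hx]
      have : P x x = 0 := by simp [hP, hGself]
      rw [this, mul_zero, zero_add]
      refine Finset.sum_congr rfl fun z hz => ?_
      rw [← hPE, htX x hx, htX z (Finset.mem_of_mem_erase hz)]
    have h2 : ∑ x ∈ X, ∑' y : {y // y ∉ X}, pairEnergy J p x y (σ x) (s y) -
        ∑ x ∈ X, ∑' y : {y // y ∉ X}, pairEnergy J p x y (s x) (s y) =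
        ∑ x ∈ X, (-2 * ∑' z, P x z + 2 * ∑ z ∈ X, P x z) := by
      rw [← Finset.sum_sub_distrib]
      refine Finset.sum_congr rfl fun x hx => ?_
      rw [← (hsumE σ x).tsum_sub (hsumE s x), ← (hPsum x).sum_add_tsum_subtype_compl X]
      have : ∀ y : {y // y ∉ X}, pairEnergy J p x y (σ x) (s y) - pairEnergy J p x y (s x) (s y) =
          -2 * P x y := fun y => by rw [← hPE, htX x hx, hts y y.2]
      simp only [this]
      rw [tsum_mul_left]
      ring
    have h3 : ∑ x ∈ X, (-2 * ∑' z, P x z + ∑ z ∈ X, P x z) =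
        1 / 2 * ∑ x ∈ X, (-2 * ∑ z ∈ X, P x z) + ∑ x ∈ X, (-2 * ∑' z, P x z + 2 * ∑ z ∈ X, P x z) := by
      rw [Finset.mul_sum, ← Finset.sum_add_distrib]
      exact Finset.sum_congr rfl fun x _ => by ring
    rw [h3, ← h1, ← h2]
    ring
  -- the right-hand side
  have hXsum : ∀ f : Site d → ℝ, HasSum (fun x => if x ∈ X then f x else 0) (∑ x ∈ X, f x) := by
    intro f
    have : ∑ x ∈ X, f x = ∑ x ∈ X, if x ∈ X then f x else 0 :=
      Finset.sum_congr rfl fun x hx => (if_pos hx).symm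
    rw [this]
    exact hasSum_sum_of_ne_finset_zero fun x hx => if_neg hx
  -- inclusion-exclusion over the endpoint of the pair lying in `X`
  have hdef : ∀ y, defect t s y = ∑ x ∈ X, G x (x + y) + ∑ x ∈ X, G x (x + -y) -
      ∑ x ∈ X, if x + y ∈ X then G x (x + y) else 0 := by
    intro y
    have e : ∀ x, dis (t x) (t (x + y)) - dis (s x) (s (x + y)) =
        (if x ∈ X then G x (x + y) else 0) + (if x + y ∈ X then G x (x + y) else 0) -
          (if x ∈ X then (if x + y ∈ X then G x (x + y) else 0) else 0) := by
      intro x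
      change G x (x + y) = _
      by_cases h1 : x ∈ X <;> by_cases h2 : x + y ∈ X <;> simp [h1, h2, hG0]
    have s2 : HasSum (fun x => if x + y ∈ X then G x (x + y) else 0) (∑ x ∈ X, G x (x + -y)) := by
      rw [← (Equiv.addRight (-y)).hasSum_iff]
      convert hXsum fun x => G x (x + -y) using 1
      ext x
      simp [hGsymm x]
    unfold defect
    simp only [e]
    exact (((hXsum _).add s2).sub (hXsum _)).tsum_eq
  have hR : ∑' y, pairWeight J p y * defect t s y = ∑ x ∈ X, (2 * ∑' z, P x z - ∑ z ∈ X, P x z) := by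
    have e : ∀ y, pairWeight J p y * defect t s y = ∑ x ∈ X, (pairWeight J p y * G x (x + y) +
        pairWeight J p y * G x (x + -y) -
        pairWeight J p y * (if x + y ∈ X then G x (x + y) else 0)) := by
      intro y
      rw [hdef, ← Finset.sum_add_distrib, ← Finset.sum_sub_distrib, Finset.mul_sum]
      exact Finset.sum_congr rfl fun x _ => by ring
    have s2 : ∀ x, HasSum (fun y => pairWeight J p y * G x (x + -y)) (∑' z, P x z) := by
      intro x
      rw [← hPtsum, ← (Equiv.neg (Site d)).hasSum_iff]
      convert (hPsum' x).hasSum using 1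
      ext y
      simp [pairWeight_neg]
    have s3 : ∀ x, HasSum (fun y => pairWeight J p y * (if x + y ∈ X then G x (x + y) else 0))
        (∑ z ∈ X, P x z) := by
      intro x
      rw [← (Equiv.subRight x).hasSum_iff]
      convert hXsum fun z => P x z using 1
      ext z
      by_cases hz : z ∈ X <;> simp [hP, hz]
    have s1 : ∀ x, HasSum (fun y => pairWeight J p y * G x (x + y)) (∑' z, P x z) := fun x => by
      rw [← hPtsum]; exact (hPsum' x).hasSum
    simp only [e]
    rw [(hasSum_sum fun x _ => ((s1 x).add (s2 x)).sub (s3 x)).tsum_eq]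
    exact Finset.sum_congr rfl fun x _ => by ring
  rw [hL, hR, ← Finset.sum_neg_distrib]
  exact Finset.sum_congr rfl fun x _ => by ring

end Lattice

/-! ### Corners -/

section Corners
variable {G : Type*} [AddCommGroup G]

/-- The number of pairs of disagreements at the consecutive displacements `y` and `z`, counted at the
common endpoint of the two bonds. -/
noncomputable def cornerSum (t : G → ℤˣ) (y z : G) : ℝ :=
  ∑' x, dis (t (x - y)) (t x) * dis (t x) (t (x + z))

theorem cornerSum_nonneg (t : G → ℤˣ) (y z : G) : 0 ≤ cornerSum t y z :=
  tsum_nonneg fun _ => mul_nonneg (dis_nonneg _ _) (dis_nonneg _ _)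

/-- The defect at `y + z` falls short of the sum of the defects at `y` and `z` by twice the number of
corners of `t`, if `s` has none. -/
theorem summable_cornerSum_and_defect_add {t s : G → ℤˣ} (hX : {x | t x ≠ s x}.Finite) {y z : G}
    (h : ∀ x, dis (s (x - y)) (s x) * dis (s x) (s (x + z)) = 0) :
    (Summable fun x => dis (t (x - y)) (t x) * dis (t x) (t (x + z))) ∧
      defect t s (y + z) = defect t s y + defect t s z - 2 * cornerSum t y z := by
  have s1 : HasSum (fun x => dis (t (x - y)) (t x) - dis (s (x - y)) (s x)) (defect t s y) := by
    have h1 := (summable_defect_shift hX y (-y)).hasSum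
    rw [defect_shift] at h1
    simpa [sub_eq_add_neg] using h1
  have s2 : HasSum (fun x => dis (t x) (t (x + z)) - dis (s x) (s (x + z))) (defect t s z) :=
    (summable_defect hX z).hasSum
  have s3 : HasSum (fun x => dis (t (x - y)) (t (x + z)) - dis (s (x - y)) (s (x + z)))
      (defect t s (y + z)) := by
    have h1 := (summable_defect_shift hX (y + z) (-y)).hasSum
    rw [defect_shift] at h1
    simpa [sub_eq_add_neg] using h1
  have e : ∀ x, dis (t (x - y)) (t x) * dis (t x) (t (x + z)) =
      (1 / 2) * ((dis (t (x - y)) (t x) - dis (s (x - y)) (s x)) +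
        (dis (t x) (t (x + z)) - dis (s x) (s (x + z))) -
        (dis (t (x - y)) (t (x + z)) - dis (s (x - y)) (s (x + z)))) := by
    intro x
    rw [dis_triangle (t (x - y)) (t x) (t (x + z)), dis_triangle (s (x - y)) (s x) (s (x + z)), h x]
    ring
  have s4 : HasSum (fun x => dis (t (x - y)) (t x) * dis (t x) (t (x + z)))
      (1 / 2 * (defect t s y + defect t s z - defect t s (y + z))) := by
    simp only [e]
    exact ((s1.add s2).sub s3).mul_left _
  refine ⟨s4.summable, ?_⟩
  rw [cornerSum, s4.tsum_eq]
  ring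
end Corners

section Lattice
variable {d : ℕ} {t s : SpinConfig d} {i₀ : Fin d} {g : ℤ → ℤˣ}

theorem dis_mul_dis_eq_zero (hs : ∀ x, s x = g (x i₀)) {y z : Site d} (h : y i₀ = 0 ∨ z i₀ = 0)
    (x : Site d) : dis (s (x - y)) (s x) * dis (s x) (s (x + z)) = 0 := by
  simp only [hs]
  rcases h with h | h <;> simp [h, dis_self]

theorem defect_sum_axisVec_le (hX : {x | t x ≠ s x}.Finite) (hs : ∀ x, s x = g (x i₀)) (y : Site d)
    (S : Finset (Fin d)) :
    defect t s (∑ k ∈ S, axisVec k (y k)) ≤ ∑ k ∈ S, defect t s (axisVec k (y k)) := by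
  classical
  induction S using Finset.induction_on with
  | empty => simp [defect_zero]
  | insert k S hk ih =>
    rw [Finset.sum_insert hk, Finset.sum_insert hk]
    have h0 : (axisVec k (y k)) i₀ = 0 ∨ (∑ k ∈ S, axisVec k (y k)) i₀ = 0 := by
      by_cases hki : i₀ = k
      · right
        rw [Finset.sum_apply]
        refine Finset.sum_eq_zero fun j hj => ?_
        rw [axisVec, Pi.single_eq_of_ne]
        rintro rfl
        exact hk (hki ▸ hj)
      · left; rw [axisVec, Pi.single_eq_of_ne hki]
    rw [(summable_cornerSum_and_defect_add hX (dis_mul_dis_eq_zero hs h0)).2]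
    linarith [cornerSum_nonneg t (axisVec k (y k)) (∑ k ∈ S, axisVec k (y k))]

/-- Disagreements along a path through the axes: a configuration `s` depending on one coordinate has no
corners, hence the inequality for the defect. -/
theorem defect_le_sum_axisVec (hX : {x | t x ≠ s x}.Finite) (hs : ∀ x, s x = g (x i₀)) (y : Site d) :
    defect t s y ≤ ∑ k, defect t s (axisVec k (y k)) := by
  have := defect_sum_axisVec_le hX hs y Finset.univ
  rwa [Finset.univ_sum_single y] at this

/-- The excess of the long range energy over its decomposition into energies of lines. -/
noncomputable def cornerEnergy (p : ℝ) (t s : SpinConfig d) : ℝ :=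
  ∑' y, decay p y * (∑ k, defect t s (axisVec k (y k)) - defect t s y)

theorem abs_sum_defect_sub_le (hX : {x | t x ≠ s x}.Finite) (y : Site d) :
    |∑ k, defect t s (axisVec k (y k)) - defect t s y| ≤ (d + 1) * (2 * ∑' x, dis (t x) (s x)) := by
  refine (abs_sub _ _).trans ?_
  rw [add_mul, one_mul]
  refine add_le_add ((Finset.abs_sum_le_sum_abs _ _).trans ?_) (abs_defect_le hX y)
  refine (Finset.sum_le_sum fun k _ => abs_defect_le hX _).trans (le_of_eq ?_)
  simp

theorem cornerEnergy_term_nonneg (hX : {x | t x ≠ s x}.Finite) (hs : ∀ x, s x = g (x i₀)) (p : ℝ)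
    (y : Site d) : 0 ≤ decay p y * (∑ k, defect t s (axisVec k (y k)) - defect t s y) :=
  mul_nonneg (decay_nonneg p y) (sub_nonneg.2 (defect_le_sum_axisVec hX hs y))

theorem cornerEnergy_ge_cornerSum {p : ℝ} (hp : (d : ℝ) < p) (hX : {x | t x ≠ s x}.Finite)
    (hs : ∀ x, s x = g (x i₀)) {i j : Fin d} (hij : i ≠ j) (a b : ℤˣ) :
    2 * (1 / Real.sqrt 2 ^ p) * cornerSum t (axisVec i a) (axisVec j b) ≤ cornerEnergy p t s := by
  set y : Site d := axisVec i a + axisVec j b with hy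
  have h1 : decay p y * (∑ k, defect t s (axisVec k (y k)) - defect t s y) ≤ cornerEnergy p t s :=
    (summable_mul_of_abs_le hp fun y => abs_sum_defect_sub_le hX y).le_tsum y fun z _ =>
      cornerEnergy_term_nonneg hX hs p z
  refine le_trans (le_of_eq ?_) h1
  have h0 : (axisVec i (a : ℤ)) i₀ = 0 ∨ (axisVec j (b : ℤ)) i₀ = 0 := by
    by_cases hi : i₀ = i
    · right; rw [axisVec, Pi.single_eq_of_ne]; rw [hi]; exact hij
    · left; rw [axisVec, Pi.single_eq_of_ne hi]
  have h2 : ∑ k, defect t s (axisVec k (y k)) = defect t s (axisVec i a) + defect t s (axisVec j b) := by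
    rw [Fintype.sum_eq_add i j hij]
    · congr 3 <;> simp [hy, axisVec, hij, hij.symm]
    · rintro k ⟨hki, hkj⟩
      have : y k = 0 := by simp [hy, axisVec, hki, hkj]
      rw [this, axisVec, Pi.single_zero, defect_zero]
  have h3 : decay p y = 1 / Real.sqrt 2 ^ p := by
    rw [decay, hy, siteNorm_add_axisVec hij]
    have : ∀ u : ℤˣ, ((u : ℤ) : ℝ) ^ 2 = 1 := fun u => by
      rcases Int.units_eq_one_or u with rfl | rfl <;> simp
    rw [this, this, one_add_one_eq_two]
  rw [h2, h3, hy, (summable_cornerSum_and_defect_add hX (dis_mul_dis_eq_zero hs h0)).2]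
  ring

/-- The sites at which bonds with a disagreement in two different directions meet. -/
def cornerSites (t : SpinConfig d) : Set (Site d) :=
  {z | ∃ i j : Fin d, i ≠ j ∧ (∃ a : ℤˣ, t (z - axisVec i a) ≠ t z) ∧
    ∃ b : ℤˣ, t z ≠ t (z + axisVec j b)}

theorem finite_cornerSites (hX : {x | t x ≠ s x}.Finite) (hs : ∀ x, s x = g (x i₀)) :
    (cornerSites t).Finite := by
  have hfin : ({x | t x ≠ s x} ∪ (⋃ k : Fin d × ℤˣ, (fun x => x - axisVec k.1 k.2) ⁻¹' {x | t x ≠ s x}) ∪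
      (⋃ k : Fin d × ℤˣ, (fun x => x + axisVec k.1 k.2) ⁻¹' {x | t x ≠ s x})).Finite := by
    refine (hX.union (Set.finite_iUnion fun k => ?_)).union (Set.finite_iUnion fun k => ?_)
    · exact hX.preimage fun _ _ _ _ h => by simpa using h
    · exact hX.preimage fun _ _ _ _ h => by simpa using h
  refine hfin.subset fun z hz => ?_
  by_contra hne
  simp only [Set.mem_union, Set.mem_iUnion, Set.mem_preimage, Set.mem_ofPred_eq, not_or, not_exists,
    not_not, Prod.forall] at hne
  obtain ⟨i, j, hij, ⟨a, ha⟩, b, hb⟩ := hz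
  rw [hne.1.1, hne.1.2 i a] at ha
  rw [hne.1.1, hne.2 j b] at hb
  rw [hs, hs z] at ha
  rw [hs, hs (_ + _)] at hb
  have hi : i = i₀ := by
    by_contra hi
    apply ha
    simp [axisVec, Pi.single_eq_of_ne (Ne.symm hi)]
  have hj : j = i₀ := by
    by_contra hj
    apply hb
    simp [axisVec, Pi.single_eq_of_ne (Ne.symm hj)]
  exact hij (hi.trans hj.symm)

/-- Each corner contributes to the energy through one of the displacements `±e_i ± e_j`, of length `√2`; there
are at most `4 d²` choices of the directions and signs of the two steps. -/
theorem card_cornerSites_le {p : ℝ} (hp : (d : ℝ) < p) (hX : {x | t x ≠ s x}.Finite)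
    (hs : ∀ x, s x = g (x i₀)) :
    1 / Real.sqrt 2 ^ p / (2 * d ^ 2) * (cornerSites t).ncard ≤ cornerEnergy p t s := by
  classical
  have hC := finite_cornerSites hX hs
  set Q : Finset (Fin d × Fin d × ℤˣ × ℤˣ) := Finset.univ.filter fun q => q.1 ≠ q.2.1 with hQ
  set f : Fin d × Fin d × ℤˣ × ℤˣ → Site d → ℝ := fun q x =>
    dis (t (x - axisVec q.1 q.2.2.1)) (t x) * dis (t x) (t (x + axisVec q.2.1 q.2.2.2)) with hf
  have hf0 : ∀ q x, 0 ≤ f q x := fun q x => mul_nonneg (dis_nonneg _ _) (dis_nonneg _ _)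
  have hsum : ∀ q ∈ Q, Summable (f q) := by
    intro q hq
    have hij : q.1 ≠ q.2.1 := (Finset.mem_filter.1 hq).2
    refine (summable_cornerSum_and_defect_add hX (dis_mul_dis_eq_zero hs ?_)).1
    by_cases hi : i₀ = q.1
    · right; rw [axisVec, Pi.single_eq_of_ne]; rw [hi]; exact hij
    · left; rw [axisVec, Pi.single_eq_of_ne hi]
  set c : ℝ := 1 / Real.sqrt 2 ^ p with hc
  have hc0 : 0 < c := by positivity
  have h0 : 0 ≤ cornerEnergy p t s := tsum_nonneg fun y => cornerEnergy_term_nonneg hX hs p y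
  have h1 : ((cornerSites t).ncard : ℝ) ≤ ∑ q ∈ Q, ∑' x, f q x := by
    rw [← Summable.tsum_finsetSum hsum, Set.ncard_eq_toFinset_card _ hC]
    have h2 : ∀ x ∈ hC.toFinset, (1 : ℝ) ≤ ∑ q ∈ Q, f q x := by
      intro x hx
      obtain ⟨i, j, hij, ⟨a, ha⟩, b, hb⟩ := (Set.Finite.mem_toFinset hC).1 hx
      have h3 : f (i, j, a, b) x = 1 := by
        simp only [hf]
        rw [dis_of_ne ha, dis_of_ne hb, one_mul]
      rw [← h3]
      exact Finset.single_le_sum (f := fun q => f q x) (fun q _ => hf0 q x)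
        (Finset.mem_filter.2 ⟨Finset.mem_univ _, hij⟩)
    calc (hC.toFinset.card : ℝ) = ∑ x ∈ hC.toFinset, (1 : ℝ) := by simp
      _ ≤ ∑ x ∈ hC.toFinset, ∑ q ∈ Q, f q x := Finset.sum_le_sum h2
      _ ≤ _ := (summable_sum hsum).sum_le_tsum _ fun x _ => Finset.sum_nonneg fun q _ => hf0 q x
  have h2 : 2 * c * ∑ q ∈ Q, ∑' x, f q x ≤ (4 * d ^ 2) * cornerEnergy p t s := by
    rw [Finset.mul_sum]
    refine (Finset.sum_le_card_nsmul _ _ _ fun q hq =>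
      cornerEnergy_ge_cornerSum hp hX hs (Finset.mem_filter.1 hq).2 q.2.2.1 q.2.2.2).trans ?_
    rw [nsmul_eq_mul]
    refine mul_le_mul_of_nonneg_right ?_ h0
    have : (Q.card : ℝ) ≤ (Finset.univ : Finset (Fin d × Fin d × ℤˣ × ℤˣ)).card := by
      exact_mod_cast Finset.card_filter_le _ _
    refine this.trans (le_of_eq ?_)
    rw [Finset.card_univ]
    simp only [Fintype.card_prod, Fintype.card_fin, Fintype.card_units_int]
    push_cast; ring
  have hd : (0 : ℝ) < d := by exact_mod_cast Fin.pos i₀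
  rw [div_mul_eq_mul_div, div_le_iff₀ (by positivity)]
  nlinarith [mul_le_mul_of_nonneg_left h1 hc0.le]
end Lattice

/-! ### Decomposition of the energy into lines -/

section Lattice
variable {D : ℕ}

theorem insertNth_add_axisVec (k : Fin (D + 1)) (m n : ℤ) (z : Fin D → ℤ) :
    (k.insertNth m z : Site (D + 1)) + axisVec k n = k.insertNth (m + n) z := by
  ext i
  refine Fin.succAboveCases k ?_ (fun j => ?_) i
  · simp [axisVec]
  · simp [axisVec]

theorem insertNth_sub_axisVec (k : Fin (D + 1)) (m n : ℤ) (z : Fin D → ℤ) :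
    (k.insertNth m z : Site (D + 1)) - axisVec k n = k.insertNth (m - n) z := by
  rw [sub_eq_iff_eq_add, insertNth_add_axisVec, sub_add_cancel]

theorem siteNorm_insertNth (k : Fin (D + 1)) (m : ℤ) (z : Fin D → ℤ) :
    siteNorm (k.insertNth m z : Site (D + 1)) = Real.sqrt ((m : ℝ) ^ 2 + ∑ i, (z i : ℝ) ^ 2) := by
  unfold siteNorm
  rw [Fin.sum_univ_succAbove _ k]
  simp

/-- The power law summed over the directions transverse to a line, at distance `n` along it. -/
noncomputable def transverseSum (D : ℕ) (p : ℝ) (n : ℤ) : ℝ :=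
  ∑' z : Fin D → ℤ, 1 / Real.sqrt ((n : ℝ) ^ 2 + ∑ i, (z i : ℝ) ^ 2) ^ p

/-- The effective interaction along a line: the weight of the distance `n + 1`. -/
noncomputable def lineWeight (D : ℕ) (p : ℝ) (n : ℕ) : ℝ := transverseSum D p ((n + 1 : ℕ) : ℤ)

theorem transverseSum_nonneg (p : ℝ) (n : ℤ) : 0 ≤ transverseSum D p n :=
  tsum_nonneg fun _ => by positivity

theorem transverseSum_neg (p : ℝ) (n : ℤ) : transverseSum D p (-n) = transverseSum D p n := by
  simp [transverseSum]

theorem tsum_eq_tsum_insertNth {F : Site (D + 1) → ℝ} (hF : Summable F) (k : Fin (D + 1)) :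
    Summable (fun x : ℤ × (Fin D → ℤ) => F (k.insertNth x.1 x.2)) ∧
      ∑' x : ℤ × (Fin D → ℤ), F (k.insertNth x.1 x.2) = ∑' y, F y :=
  ⟨((Fin.insertNthEquiv (fun _ => ℤ) k).summable_iff (f := F)).2 hF,
    (Fin.insertNthEquiv (fun _ => ℤ) k).tsum_eq F⟩

/-- A sum of the power law against a function of one coordinate is a one-dimensional sum. -/
theorem tsum_decay_mul {p : ℝ} {f : ℤ → ℝ} (k : Fin (D + 1))
    (h : Summable fun y : Site (D + 1) => decay p y * f (y k)) :
    (Summable fun n : ℤ => transverseSum D p n * f n) ∧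
      ∑' n : ℤ, transverseSum D p n * f n = ∑' y : Site (D + 1), decay p y * f (y k) := by
  obtain ⟨h1, h2⟩ := tsum_eq_tsum_insertNth h k
  have e : ∀ x : ℤ × (Fin D → ℤ), decay p (k.insertNth x.1 x.2 : Site (D + 1)) *
      f ((k.insertNth x.1 x.2 : Site (D + 1)) k) =
      1 / Real.sqrt ((x.1 : ℝ) ^ 2 + ∑ i, (x.2 i : ℝ) ^ 2) ^ p * f x.1 := by
    intro x
    rw [decay, siteNorm_insertNth, Fin.insertNth_apply_same]
  simp only [e] at h1 h2
  have h3 := h1.prod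
  rw [← h2, h1.tsum_prod]
  simp only [tsum_mul_right] at h3 ⊢
  exact ⟨h3, rfl⟩

theorem tsum_transverseSum_even {p : ℝ} {f : ℤ → ℝ} (h : Summable fun n : ℤ => transverseSum D p n * f n)
    (hf0 : f 0 = 0) (hf : ∀ n, f (-n) = f n) :
    ∑' n : ℤ, transverseSum D p n * f n = 2 * ∑' n : ℕ, lineWeight D p n * f ((n + 1 : ℕ) : ℤ) := by
  have hn : Summable fun n : ℕ => transverseSum D p (n : ℤ) * f (n : ℤ) :=
    h.comp_injective Nat.cast_injective
  have hn1 : Summable fun n : ℕ => lineWeight D p n * f ((n + 1 : ℕ) : ℤ) := (summable_nat_add_iff 1).2 hn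
  have e : ∀ n : ℕ, transverseSum D p (-((n : ℤ) + 1)) * f (-((n : ℤ) + 1)) =
      lineWeight D p n * f ((n + 1 : ℕ) : ℤ) := by
    intro n
    rw [transverseSum_neg, hf, lineWeight]
    push_cast; rfl
  rw [tsum_of_nat_of_neg_add_one hn (by simp only [e]; exact hn1), hn.tsum_eq_zero_add]
  simp only [e, Nat.cast_zero, hf0, mul_zero, zero_add]
  rw [two_mul]
  rfl

theorem tsum_nat_lineWeight {p : ℝ} {f : ℤ → ℝ} (k : Fin (D + 1))
    (h : Summable fun y : Site (D + 1) => decay p y * f (y k)) :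
    Summable fun n : ℕ => lineWeight D p n * f ((n + 1 : ℕ) : ℤ) := by
  have hn : Summable fun n : ℕ => transverseSum D p (n : ℤ) * f (n : ℤ) :=
    (tsum_decay_mul k h).1.comp_injective Nat.cast_injective
  exact (summable_nat_add_iff 1).2 hn

theorem decay_mul_rpow {d : ℕ} {p q : ℝ} (hp : p ≠ 0) (y : Site d) :
    decay p y * siteNorm y ^ q ≤ decay (p - q) y := by
  by_cases hy : y = 0
  · rw [hy, decay_zero hp, zero_mul]; exact decay_nonneg _ _
  · have : 0 < siteNorm y := by linarith [one_le_siteNorm hy]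
    rw [decay, decay, Real.rpow_sub this]
    refine le_of_eq ?_
    field_simp

theorem summable_decay_mul_abs_rpow {p q : ℝ} (hp : (D : ℝ) + 1 < p - q) (hq : 0 ≤ q) (k : Fin (D + 1)) :
    Summable fun y : Site (D + 1) => decay p y * |(y k : ℝ)| ^ q := by
  have hp0 : p ≠ 0 := by
    have : (0 : ℝ) ≤ D := Nat.cast_nonneg D
    intro h; linarith
  refine Summable.of_nonneg_of_le (fun y => mul_nonneg (decay_nonneg _ _) (by positivity)) (fun y => ?_)
    (summable_decay (d := D + 1) (p := p - q) (by push_cast; exact hp))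
  refine le_trans ?_ (decay_mul_rpow hp0 y)
  exact mul_le_mul_of_nonneg_left (Real.rpow_le_rpow (abs_nonneg _) (abs_apply_le_siteNorm y k) hq)
    (decay_nonneg p y)

theorem summable_transverse {p : ℝ} (hp : (D : ℝ) + 1 < p) (n : ℤ) :
    Summable fun z : Fin D → ℤ => 1 / Real.sqrt ((n : ℝ) ^ 2 + ∑ i, (z i : ℝ) ^ 2) ^ p := by
  have h1 := (tsum_eq_tsum_insertNth (summable_decay (d := D + 1) (p := p) (by push_cast; exact hp)) 0).1
  have h2 := h1.prod_factor n
  refine h2.congr fun z => ?_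
  rw [decay, siteNorm_insertNth]

/-- The interaction along a line is a superposition of exponentials. -/
theorem isLaplaceWeight_lineWeight {p : ℝ} (hp : (D : ℝ) + 2 < p) : IsLaplaceWeight (lineWeight D p) := by
  refine ⟨fun n => transverseSum_nonneg _ _, ?_, fun c hc1 hc2 => ?_⟩
  · have h := tsum_nat_lineWeight (f := fun n => |(n : ℝ)| ^ (1 : ℝ)) 0
      (summable_decay_mul_abs_rpow (D := D) (p := p) (q := 1) (by linarith) zero_le_one 0)
    refine h.congr fun n => ?_
    rw [Real.rpow_one]
    push_cast
    rw [abs_of_nonneg (by positivity)]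
  · obtain ⟨μ, hμ, hμ2⟩ := exists_laplace_measure (D := D) (p := p) (by linarith)
    refine tsum_nonneg_of_laplace hμ (fun n => transverseSum_nonneg _ _) (fun n => ?_) hc1 hc2
    have e : transverseSum D p ((n + 1 : ℕ) : ℤ) =
        ∑' z : Fin D → ℤ, 1 / Real.sqrt ((((n + 1 : ℕ) : ℤ) : ℝ) ^ 2 + ∑ i, (z i : ℝ) ^ 2) ^ p := rfl
    rw [← hμ2 (n + 1) (by omega), e, ENNReal.ofReal_tsum_of_nonneg (fun z => by positivity) (summable_transverse (by linarith) _)]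
    refine tsum_congr fun z => ?_
    rw [Real.rpow_neg (Real.sqrt_nonneg _), one_div]
    push_cast
    rfl

theorem tsum_siteNorm_eq_one_mul {d : ℕ} (J : ℝ) {f : ℤ → ℝ} (hf0 : f 0 = 0) (hf : ∀ n, f (-n) = f n)
    (k : Fin d) :
    ∑' y : Site d, (open Classical in if siteNorm y = 1 then J else 0) * f (y k) = 2 * J * f 1 := by
  classical
  have hne : (axisVec k 1 : Site d) ≠ axisVec k (-1) := fun h => by
    have := congrFun h k
    simp [axisVec] at this
  rw [tsum_eq_sum (s := {axisVec k 1, axisVec k (-1)}), Finset.sum_pair hne]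
  · have h1 : ∀ n : ℤ, (axisVec k n : Site d) k = n := fun n => by simp [axisVec]
    rw [if_pos (by rw [siteNorm_axisVec]; simp), if_pos (by rw [siteNorm_axisVec]; simp), h1, h1, hf]
    ring
  · intro y hy
    by_cases hn : siteNorm y = 1
    · by_cases hk : y k = 0
      · rw [hk, hf0, mul_zero]
      · exfalso
        apply hy
        obtain ⟨h1, h2 | h2⟩ := eq_axisVec_of_siteNorm_eq_one hn hk
        · rw [h1, h2]; simp
        · rw [h1, h2]; simp
    · rw [if_neg hn, zero_mul]

variable {t s : SpinConfig (D + 1)} {i₀ : Fin (D + 1)} {g : ℤ → ℤˣ}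

theorem defect_axisVec_neg (k : Fin (D + 1)) (n : ℤ) :
    defect t s (axisVec k (-n)) = defect t s (axisVec k n) := by
  rw [← defect_neg, axisVec, axisVec, ← Pi.single_neg, neg_neg]

theorem defect_axisVec_zero (k : Fin (D + 1)) : defect t s (axisVec k 0) = 0 := by
  rw [axisVec, Pi.single_zero, defect_zero]

theorem defect_eq_sum_of_siteNorm_eq_one {y : Site (D + 1)} (hy : siteNorm y = 1) :
    defect t s y = ∑ k, defect t s (axisVec k (y k)) := by
  have hy0 : y ≠ 0 := by rintro rfl; rw [siteNorm_zero] at hy; norm_num at hy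
  obtain ⟨k, hk⟩ := Function.ne_iff.1 hy0
  obtain ⟨h1, -⟩ := eq_axisVec_of_siteNorm_eq_one hy hk
  rw [Finset.sum_eq_single k]
  · rw [← h1]
  · intro j _ hj
    have : y j = 0 := by rw [h1, axisVec, Pi.single_eq_of_ne hj]
    rw [this, defect_axisVec_zero]
  · simp

/-- The energy difference splits into one-dimensional energies and the energy of the corners. -/
theorem neg_tsum_pairWeight_mul_defect {J p : ℝ} (hp : (D : ℝ) + 1 < p) (hX : {x | t x ≠ s x}.Finite) :
    -∑' y, pairWeight J p y * defect t s y =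
      ∑ k, (2 * J * defect t s (axisVec k 1) -
        2 * ∑' n : ℕ, lineWeight D p n * defect t s (axisVec k ((n + 1 : ℕ) : ℤ))) + cornerEnergy p t s := by
  have hp' : ((D + 1 : ℕ) : ℝ) < p := by push_cast; exact hp
  have hk : ∀ k : Fin (D + 1), Summable fun y : Site (D + 1) => decay p y * defect t s (axisVec k (y k)) :=
    fun k => summable_mul_of_abs_le hp' fun y => abs_defect_le hX _
  have h1 : ∑' y, decay p y * defect t s y = ∑ k, 2 * ∑' n : ℕ, lineWeight D p n *
      defect t s (axisVec k ((n + 1 : ℕ) : ℤ)) - cornerEnergy p t s := by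
    have e : ∀ y, decay p y * defect t s y = ∑ k, decay p y * defect t s (axisVec k (y k)) -
        decay p y * (∑ k, defect t s (axisVec k (y k)) - defect t s y) := by
      intro y; rw [← Finset.mul_sum]; ring
    simp only [e]
    rw [(summable_sum fun k _ => hk k).tsum_sub (summable_mul_of_abs_le hp' fun y => abs_sum_defect_sub_le hX y),
      Summable.tsum_finsetSum fun k _ => hk k]
    congr 1
    refine Finset.sum_congr rfl fun k _ => ?_
    obtain ⟨h2, h3⟩ := tsum_decay_mul (f := fun n => defect t s (axisVec k n)) k (hk k)
    rw [← h3, tsum_transverseSum_even h2 (defect_axisVec_zero k) (defect_axisVec_neg k)]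
  have h2 : ∑' y, (open Classical in if siteNorm y = 1 then J else 0) * defect t s y =
      ∑ k, 2 * J * defect t s (axisVec k 1) := by
    classical
    have e : ∀ y : Site (D + 1), (if siteNorm y = 1 then J else 0) * defect t s y =
        ∑ k, (if siteNorm y = 1 then J else 0) * defect t s (axisVec k (y k)) := by
      intro y
      by_cases hy : siteNorm y = 1
      · rw [← Finset.mul_sum, ← defect_eq_sum_of_siteNorm_eq_one hy]
      · simp [hy]
    simp only [e]
    rw [Summable.tsum_finsetSum fun k _ => summable_siteNorm_eq_one J _]
    refine Finset.sum_congr rfl fun k _ => ?_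
    exact tsum_siteNorm_eq_one_mul J (f := fun n => defect t s (axisVec k n)) (defect_axisVec_zero k)
      (defect_axisVec_neg k) k
  simp only [pairWeight, sub_mul]
  rw [(summable_mul_of_abs_le hp' fun y => abs_defect_le hX y).tsum_sub (summable_siteNorm_eq_one J _),
    h1, h2, Finset.sum_sub_distrib]
  ring

/-- The restriction of a configuration to the line in direction `k` with transverse position `z`. -/
def lineConfig (t : SpinConfig (D + 1)) (k : Fin (D + 1)) (z : Fin D → ℤ) (m : ℤ) : ℤˣ :=
  t (k.insertNth m z)

theorem finite_lineConfig_ne (hX : {x | t x ≠ s x}.Finite) (k : Fin (D + 1)) (z : Fin D → ℤ) :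
    {m | lineConfig t k z m ≠ lineConfig s k z m}.Finite :=
  hX.preimage (f := fun m => (k.insertNth m z : Site (D + 1))) fun a _ b _ h => by
    simpa using congrFun h k

theorem exists_finset_lineConfig_eq (hX : {x | t x ≠ s x}.Finite) (k : Fin (D + 1)) :
    ∃ B : Finset (Fin D → ℤ), ∀ z ∉ B, lineConfig t k z = lineConfig s k z := by
  classical
  refine ⟨hX.toFinset.image k.removeNth, fun z hz => funext fun m => ?_⟩
  by_contra hne
  apply hz
  rw [Finset.mem_image]
  exact ⟨k.insertNth m z, by simpa [lineConfig] using hne, by simp⟩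

theorem tsum_eq_sum_tsum_line {F : Site (D + 1) → ℝ} (hF : Summable F) (k : Fin (D + 1))
    {B : Finset (Fin D → ℤ)} (hB : ∀ z ∉ B, ∀ m : ℤ, F (k.insertNth m z) = 0) :
    ∑' x, F x = ∑ z ∈ B, ∑' m : ℤ, F (k.insertNth m z) := by
  obtain ⟨h1, h2⟩ := tsum_eq_tsum_insertNth hF k
  have h3 : Summable fun x : (Fin D → ℤ) × ℤ => F (k.insertNth x.2 x.1) :=
    ((Equiv.prodComm (Fin D → ℤ) ℤ).summable_iff (f := fun x : ℤ × (Fin D → ℤ) => F (k.insertNth x.1 x.2))).2 h1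
  have h4 : ∑' x : (Fin D → ℤ) × ℤ, F (k.insertNth x.2 x.1) =
      ∑' x : ℤ × (Fin D → ℤ), F (k.insertNth x.1 x.2) :=
    (Equiv.prodComm (Fin D → ℤ) ℤ).tsum_eq (fun x : ℤ × (Fin D → ℤ) => F (k.insertNth x.1 x.2))
  rw [← h2, ← h4, h3.tsum_prod]
  exact tsum_eq_sum fun z hz => by simp [hB z hz]

theorem defect_axisVec_eq_sum (hX : {x | t x ≠ s x}.Finite) (k : Fin (D + 1))
    {B : Finset (Fin D → ℤ)} (hB : ∀ z ∉ B, lineConfig t k z = lineConfig s k z) (n : ℤ) :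
    defect t s (axisVec k n) = ∑ z ∈ B, defect (lineConfig t k z) (lineConfig s k z) n := by
  unfold defect
  rw [tsum_eq_sum_tsum_line (summable_defect hX _) k (B := B)]
  · refine Finset.sum_congr rfl fun z _ => tsum_congr fun m => ?_
    rw [insertNth_add_axisVec]; rfl
  · intro z hz m
    rw [insertNth_add_axisVec]
    have h : ∀ m, t (k.insertNth m z) = s (k.insertNth m z) := fun m => congrFun (hB z hz) m
    rw [h, h, sub_self]

/-- The indicator of the presence, on the line through `x` in direction `k`, of a wall among the
`l` bonds preceding `x`. -/
noncomputable def nearIndicator (t : SpinConfig (D + 1)) (k : Fin (D + 1)) (l : ℕ) (x : Site (D + 1)) : ℝ :=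
  open Classical in
  if ∃ q : ℕ, q < l ∧ t (x - axisVec k q) ≠ t (x - axisVec k ((q + 1 : ℕ) : ℤ)) then 1 else 0

theorem nearIndicator_insertNth (t : SpinConfig (D + 1)) (k : Fin (D + 1)) (l : ℕ) (m : ℤ) (z : Fin D → ℤ) :
    nearIndicator t k l (k.insertNth m z) = nearWall (lineConfig t k z) l m := by
  classical
  unfold nearIndicator nearWall
  refine if_congr (exists_congr fun q => and_congr_right fun _ => ?_) rfl rfl
  rw [insertNth_sub_axisVec, insertNth_sub_axisVec, IsWall, lineConfig, lineConfig]
  have : m - ((q + 1 : ℕ) : ℤ) = m - q - 1 := by push_cast; ring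
  rw [this]

theorem summable_nearIndicator_sub (hX : {x | t x ≠ s x}.Finite) (k : Fin (D + 1)) (l : ℕ) :
    Summable fun x => nearIndicator t k l x - nearIndicator s k l x := by
  classical
  have hQ : (⋃ i ∈ Finset.range (l + 1), (fun x : Site (D + 1) => x - axisVec k (i : ℕ)) ⁻¹' {x | t x ≠ s x}).Finite :=
    Set.Finite.biUnion (Finset.finite_toSet _) fun k _ => hX.preimage fun _ _ _ _ h => by simpa using h
  refine summable_of_ne_finset_zero (s := hQ.toFinset) fun x hx => ?_
  have hx : ∀ i : ℕ, i ≤ l → t (x - axisVec k i) = s (x - axisVec k i) := by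
    intro i hi
    by_contra hne
    apply hx
    simp only [Set.Finite.mem_toFinset, Set.mem_iUnion]
    exact ⟨i, Finset.mem_range.2 (by omega), hne⟩
  rw [sub_eq_zero]
  unfold nearIndicator
  refine if_congr (exists_congr fun q => and_congr_right fun hq => ?_) rfl rfl
  rw [hx q hq.le, hx (q + 1) hq]

/-- The bound for the energy of a line, summed over the lines in direction `k`. These lines are transverse to
the stripes of `s` for `k = i₀`, and carry no wall of `s` otherwise. -/
theorem mul_tsum_nearIndicator_le {p : ℝ} (hp : (D : ℝ) + 2 < p) {J e : ℝ} {l : ℕ}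
    (hE : ∀ h, e * capWidth l h ≤ widthEnergy J (lineWeight D p) h)
    (hX : {x | t x ≠ s x}.Finite) (hs : ∀ x, s x = g (x i₀)) {a : ℤ} {h : ℕ} (h1 : 1 ≤ h)
    (hl : h ≤ l) (he : widthEnergy J (lineWeight D p) h = e * h)
    (hg : ∀ m, IsWall g m ↔ (h : ℤ) ∣ m - a) (k : Fin (D + 1)) :
    e * ∑' x, (nearIndicator t k l x - nearIndicator s k l x) ≤ 2 * J * defect t s (axisVec k 1) -
      2 * ∑' n : ℕ, lineWeight D p n * defect t s (axisVec k ((n + 1 : ℕ) : ℤ)) := by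
  have hv := isLaplaceWeight_lineWeight (D := D) hp
  obtain ⟨B, hB⟩ := exists_finset_lineConfig_eq hX k
  have hline : ∀ z, e * ∑' m, (nearWall (lineConfig t k z) l m - nearWall (lineConfig s k z) l m) ≤
      2 * J * defect (lineConfig t k z) (lineConfig s k z) 1 -
        2 * ∑' n : ℕ, lineWeight D p n * defect (lineConfig t k z) (lineConfig s k z) ((n + 1 : ℕ) : ℤ) := by
    intro z
    refine mul_tsum_nearWall_le hv hE (finite_lineConfig_ne hX k z) ?_
    by_cases hk : k = i₀
    · right
      refine ⟨a, h, h1, hl, he, fun m => ?_⟩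
      rw [← hg]
      subst hk
      simp [IsWall, lineConfig, hs]
    · left
      intro m
      obtain ⟨j, hj⟩ := Fin.exists_succAbove_eq (Ne.symm hk)
      subst hj
      simp [IsWall, lineConfig, hs]
  have h2 : ∑' x, (nearIndicator t k l x - nearIndicator s k l x) =
      ∑ z ∈ B, ∑' m, (nearWall (lineConfig t k z) l m - nearWall (lineConfig s k z) l m) := by
    rw [tsum_eq_sum_tsum_line (summable_nearIndicator_sub hX k l) k (B := B)]
    · simp only [nearIndicator_insertNth]
    · intro z hz m
      rw [nearIndicator_insertNth, nearIndicator_insertNth, hB z hz, sub_self]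
  have h3 : ∑' n : ℕ, lineWeight D p n * defect t s (axisVec k ((n + 1 : ℕ) : ℤ)) =
      ∑ z ∈ B, ∑' n : ℕ, lineWeight D p n * defect (lineConfig t k z) (lineConfig s k z) ((n + 1 : ℕ) : ℤ) := by
    rw [← Summable.tsum_finsetSum fun z _ => hv.summable_defect (finite_lineConfig_ne hX k z) _]
    refine tsum_congr fun n => ?_
    rw [defect_axisVec_eq_sum hX k hB, Finset.mul_sum]
  rw [h2, h3, defect_axisVec_eq_sum hX k hB, Finset.mul_sum, Finset.mul_sum, Finset.mul_sum,
    ← Finset.sum_sub_distrib]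
  exact Finset.sum_le_sum fun z _ => hline z

/-- In the stripes of width `h ≤ l` every site is near a wall in the direction `i₀`, and in no other one. -/
theorem nearIndicator_background {l : ℕ} (hs : ∀ x, s x = g (x i₀)) {a : ℤ} {h : ℕ} (h1 : 1 ≤ h)
    (hl : h ≤ l) (hg : ∀ m, IsWall g m ↔ (h : ℤ) ∣ m - a) (x : Site (D + 1)) :
    ∑ k, nearIndicator s k l x = 1 := by
  rw [Finset.sum_eq_single i₀]
  · have h2 := nearIndicator_insertNth s i₀ l (x i₀) (i₀.removeNth x)
    rw [Fin.insertNth_self_removeNth] at h2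
    rw [h2]
    refine nearWall_eq_one h1 hl (a := a) (fun m => ?_) _
    rw [← hg]
    simp [IsWall, lineConfig, hs]
  · intro k _ hk
    refine if_neg ?_
    rintro ⟨q, -, hq⟩
    apply hq
    simp [hs, axisVec, Pi.single_eq_of_ne (Ne.symm hk)]
  · simp

end Lattice

/-! ### Counting the corners -/

section CornerCount
variable {d : ℕ} {t s : SpinConfig d} {i₀ : Fin d} {g : ℤ → ℤˣ}

theorem eq_add_axisVec_of_notMem_cornerSites {i j : Fin d} (hij : i ≠ j) {y : Site d} {a : ℤˣ}
    (hy : y ∉ cornerSites t) (h : t (y - axisVec i a) ≠ t y) (b : ℤˣ) : t (y + axisVec j b) = t y := by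
  by_contra hne
  exact hy ⟨i, j, hij, ⟨a, h⟩, b, Ne.symm hne⟩

/-- Away from the corners, a wall between `y - e_i` and `y` extends to the neighbouring bonds in every
direction `j ≠ i`. -/
theorem ne_add_axisVec_of_notMem_cornerSites {i j : Fin d} (hij : i ≠ j) {y : Site d}
    (h1 : y ∉ cornerSites t) (h2 : y - axisVec i 1 ∉ cornerSites t) (h : t (y - axisVec i 1) ≠ t y)
    (b : ℤˣ) : t (y + axisVec j b - axisVec i 1) ≠ t (y + axisVec j b) := by
  have e1 := eq_add_axisVec_of_notMem_cornerSites (a := 1) hij h1 (by simpa using h) b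
  have e2 := eq_add_axisVec_of_notMem_cornerSites (a := -1) hij h2
    (by simpa [axisVec, Pi.single_neg] using h.symm) b
  rw [e1, add_sub_right_comm, e2]
  exact h

theorem axisVec_succ (k : Fin d) (n : ℕ) :
    (axisVec k ((n + 1 : ℕ) : ℤ) : Site d) = axisVec k (n : ℤ) + axisVec k 1 := by
  rw [axisVec, axisVec, axisVec, ← Pi.single_add]; push_cast; rfl

/-- Two walls in different directions near `x` produce a corner near `x`. -/
theorem exists_mem_cornerSites {i j : Fin d} (hij : i ≠ j) {l : ℕ} {x : Site d}
    (hi : ∃ q : ℕ, q < l ∧ t (x - axisVec i q) ≠ t (x - axisVec i ((q + 1 : ℕ) : ℤ)))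
    (hj : ∃ q : ℕ, q < l ∧ t (x - axisVec j q) ≠ t (x - axisVec j ((q + 1 : ℕ) : ℤ))) :
    ∃ m n : ℕ, m ≤ l ∧ n ≤ l ∧ x - axisVec i m - axisVec j n ∈ cornerSites t := by
  by_contra! hC
  -- a wall in direction `i` extends over the whole box
  have key : ∀ (i j : Fin d), i ≠ j → (∀ m n : ℕ, m ≤ l → n ≤ l → x - axisVec i m - axisVec j n ∉ cornerSites t) →
      ∀ q : ℕ, q < l → t (x - axisVec i q) ≠ t (x - axisVec i ((q + 1 : ℕ) : ℤ)) →
      ∀ n : ℕ, n ≤ l → t (x - axisVec i q - axisVec j n - axisVec i 1) ≠ t (x - axisVec i q - axisVec j n) := by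
    intro i j hij hC q hq hw n
    induction n with
    | zero =>
      intro _
      rw [axisVec_succ, ← sub_sub] at hw
      simpa using hw.symm
    | succ n ih =>
      intro hn
      have h1 := hC q n hq.le (by omega)
      have h2 := hC (q + 1) n hq (by omega)
      rw [axisVec_succ, ← sub_sub, sub_right_comm] at h2
      have := ne_add_axisVec_of_notMem_cornerSites hij h1 h2 (ih (by omega)) (-1)
      have e : x - axisVec i (q : ℤ) - axisVec j (n : ℤ) + axisVec j (((-1 : ℤˣ) : ℤˣ) : ℤ) =
          x - axisVec i (q : ℤ) - axisVec j ((n + 1 : ℕ) : ℤ) := by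
        rw [axisVec_succ, Units.val_neg, Units.val_one, axisVec, axisVec, axisVec, Pi.single_neg]
        abel
      rwa [e] at this
  obtain ⟨q, hq, hqw⟩ := hi
  obtain ⟨q', hq', hqw'⟩ := hj
  have k1 := key i j hij hC q hq hqw q' hq'.le
  have k2 := key j i hij.symm (fun m n hm hn => by rw [sub_right_comm]; exact hC n m hn hm) q' hq' hqw' q hq.le
  rw [sub_right_comm x] at k2
  refine hC q q' hq.le hq'.le ⟨i, j, hij, ⟨1, by simpa using k1⟩, -1, ?_⟩
  have e : x - axisVec i (q : ℤ) - axisVec j (q' : ℤ) + axisVec j (((-1 : ℤˣ) : ℤˣ) : ℤ) =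
      x - axisVec i (q : ℤ) - axisVec j (q' : ℤ) - axisVec j 1 := by
    rw [Units.val_neg, Units.val_one, axisVec, axisVec, axisVec, Pi.single_neg]
    abel
  rw [e]
  exact k2.symm

/-- A finite perturbation without corners of a configuration depending on one coordinate only is
trivial: a wall transverse to another direction would extend to infinity. -/
theorem eq_of_cornerSites_eq_empty (hd : 2 ≤ d) (hX : {x | t x ≠ s x}.Finite)
    (hs : ∀ x, s x = g (x i₀)) (hC : cornerSites t = ∅) : t = s := by
  have far : ∀ (k : Fin d) (x y : Site d), ∃ n : ℕ, t (x + axisVec k n) = s (x + axisVec k n) ∧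
      t (y + axisVec k n) = s (y + axisVec k n) := by
    intro k x y
    have hinj : ∀ x : Site d, Function.Injective fun n : ℕ => x + axisVec k (n : ℤ) := by
      intro x a b h
      have := congrFun h k
      simpa [axisVec] using this
    have h1 := (hX.preimage (f := fun n : ℕ => x + axisVec k (n : ℤ)) (hinj x).injOn).union
      (hX.preimage (f := fun n : ℕ => y + axisVec k (n : ℤ)) (hinj y).injOn)
    obtain ⟨n, hn⟩ := h1.exists_notMem
    refine ⟨n, ?_, ?_⟩
    · by_contra h; exact hn (Or.inl h)
    · by_contra h; exact hn (Or.inr h)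
  have : Nontrivial (Fin d) := Fin.nontrivial_iff_two_le.2 hd
  obtain ⟨j, hj⟩ := exists_ne i₀
  have hflat : ∀ y, t (y - axisVec j 1) = t y := by
    intro y
    by_contra hne
    have h : ∀ n : ℕ, t (y + axisVec i₀ (n : ℤ) - axisVec j 1) ≠ t (y + axisVec i₀ (n : ℤ)) := by
      intro n
      induction n with
      | zero => simpa using hne
      | succ n ih =>
        have := ne_add_axisVec_of_notMem_cornerSites (t := t) hj (y := y + axisVec i₀ (n : ℤ))
          (by rw [hC]; simp) (by rw [hC]; simp) ih 1
        rw [axisVec_succ, ← add_assoc]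
        simpa using this
    obtain ⟨n, h1, h2⟩ := far i₀ y (y - axisVec j 1)
    apply h n
    rw [← sub_add_eq_add_sub, h2, h1, hs, hs]
    simp [axisVec, Pi.single_eq_of_ne hj.symm]
  have hflat2 : ∀ (y : Site d) (n : ℕ), t (y + axisVec j n) = t y := by
    intro y n
    induction n with
    | zero => simp
    | succ n ih =>
      rw [← ih, ← hflat (y + axisVec j ((n + 1 : ℕ) : ℤ)), axisVec_succ, ← add_assoc, add_sub_cancel_right]
  funext x
  obtain ⟨n, h1, -⟩ := far j x x
  rw [← hflat2 x n, h1, hs, hs]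
  simp [axisVec, Pi.single_eq_of_ne hj.symm]

end CornerCount

section CornerBound
variable {D : ℕ} {t s : SpinConfig (D + 1)} {i₀ : Fin (D + 1)} {g : ℤ → ℤˣ}

theorem nearIndicator_le_one (t : SpinConfig (D + 1)) (k : Fin (D + 1)) (l : ℕ) (x : Site (D + 1)) :
    nearIndicator t k l x ≤ 1 := by unfold nearIndicator; split_ifs <;> norm_num

/-- The number of sites that are near walls of at least two directions is controlled by the number of
corners. -/
theorem tsum_sum_nearIndicator_sub_le (hX : {x | t x ≠ s x}.Finite) (hs : ∀ x, s x = g (x i₀)) {l : ℕ}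
    (hone : ∀ x, ∑ k, nearIndicator s k l x = 1) :
    ∑ k, ∑' x, (nearIndicator t k l x - nearIndicator s k l x) ≤
      ((D + 1 : ℕ) : ℝ) * ((l + 1 : ℕ) : ℝ) ^ (D + 1) * (cornerSites t).ncard := by
  classical
  have hC := finite_cornerSites hX hs
  set S : Finset (Site (D + 1)) := (hC.toFinset ×ˢ Finset.Icc (0 : Site (D + 1)) (fun _ => (l : ℤ))).image
    fun w => w.1 + w.2 with hS
  have hcard : (S.card : ℝ) ≤ ((l + 1 : ℕ) : ℝ) ^ (D + 1) * (cornerSites t).ncard := by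
    have h1 : S.card ≤ (cornerSites t).ncard * (l + 1) ^ (D + 1) := by
      refine Finset.card_image_le.trans (le_of_eq ?_)
      rw [Finset.card_product, Set.ncard_eq_toFinset_card _ hC, Pi.card_Icc]
      simp
    rw [mul_comm]
    exact_mod_cast h1
  have hle : ∀ x, ∑ k, (nearIndicator t k l x - nearIndicator s k l x) ≤
      if x ∈ S then ((D + 1 : ℕ) : ℝ) else 0 := by
    intro x
    rw [Finset.sum_sub_distrib, hone]
    split_ifs with hxS
    · have : ∑ k, nearIndicator t k l x ≤ ∑ k : Fin (D + 1), 1 :=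
        Finset.sum_le_sum fun k _ => nearIndicator_le_one t k l x
      simp only [Finset.sum_const, Finset.card_univ, Fintype.card_fin, nsmul_eq_mul, mul_one] at this
      linarith
    · by_cases h : ∃ i, nearIndicator t i l x ≠ 0
      · obtain ⟨i, hi⟩ := h
        rw [Finset.sum_eq_single i, sub_nonpos]
        · exact nearIndicator_le_one t i l x
        · intro j _ hji
          by_contra hj
          apply hxS
          obtain ⟨m, n, hm, hn, hmem⟩ := exists_mem_cornerSites (t := t) (Ne.symm hji) (l := l) (x := x)
            (by by_contra h; exact hi (if_neg h)) (by by_contra h; exact hj (if_neg h))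
          rw [hS, Finset.mem_image]
          refine ⟨(_, axisVec i m + axisVec j n), Finset.mem_product.2 ⟨hC.mem_toFinset.2 hmem,
            Finset.mem_Icc.2 ⟨fun k => ?_, fun k => ?_⟩⟩, ?_⟩
          · by_cases hki : k = i
            · subst hki; simp [axisVec, Pi.single_eq_of_ne (Ne.symm hji)]
            · by_cases hkj : k = j
              · subst hkj; simp [axisVec, Pi.single_eq_of_ne hji]
              · simp [axisVec, Pi.single_eq_of_ne hki, Pi.single_eq_of_ne hkj]
          · by_cases hki : k = i
            · subst hki; simp [axisVec, Pi.single_eq_of_ne (Ne.symm hji), hm]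
            · by_cases hkj : k = j
              · subst hkj; simp [axisVec, Pi.single_eq_of_ne hji, hn]
              · simp [axisVec, Pi.single_eq_of_ne hki, Pi.single_eq_of_ne hkj]
          · simp only; abel
        · simp
      · push Not at h
        rw [Finset.sum_eq_zero fun k _ => h k]
        norm_num
  rw [← Summable.tsum_finsetSum fun k _ => summable_nearIndicator_sub hX k l]
  have hsum : Summable fun x => if x ∈ S then ((D + 1 : ℕ) : ℝ) else 0 :=
    summable_of_ne_finset_zero (s := S) fun x hx => if_neg hx
  refine ((summable_sum fun k _ => summable_nearIndicator_sub hX k l).tsum_le_tsum hle hsum).trans ?_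
  rw [tsum_eq_sum (s := S) fun x hx => if_neg hx, Finset.sum_congr rfl fun x hx => if_pos hx,
    Finset.sum_const, nsmul_eq_mul, mul_comm, mul_assoc]
  exact mul_le_mul_of_nonneg_left hcard (by positivity)

/-- The energy of a finite perturbation of an optimal striped configuration is bounded below by a
multiple of the number of its corners. -/
theorem ncard_cornerSites_le_energy {p : ℝ} (hp : (D : ℝ) + 2 < p) {J e : ℝ} (he0 : e ≤ 0) {l : ℕ}
    (hE : ∀ h, e * capWidth l h ≤ widthEnergy J (lineWeight D p) h)
    (hX : {x | t x ≠ s x}.Finite) (hs : ∀ x, s x = g (x i₀)) {a : ℤ} {h : ℕ} (h1 : 1 ≤ h)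
    (hl : h ≤ l) (he : widthEnergy J (lineWeight D p) h = e * h)
    (hg : ∀ m, IsWall g m ↔ (h : ℤ) ∣ m - a) :
    (1 / Real.sqrt 2 ^ p / (2 * ((D + 1 : ℕ) : ℝ) ^ 2) +
      e * (((D + 1 : ℕ) : ℝ) * ((l + 1 : ℕ) : ℝ) ^ (D + 1))) * (cornerSites t).ncard ≤
      -∑' y, pairWeight J p y * defect t s y := by
  rw [neg_tsum_pairWeight_mul_defect (by linarith) hX, add_mul, add_comm]
  refine add_le_add ?_ (card_cornerSites_le (by push_cast; linarith) hX hs)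
  refine le_trans ?_ (Finset.sum_le_sum fun k _ => mul_tsum_nearIndicator_le hp hE hX hs h1 hl he hg k)
  rw [← Finset.mul_sum, mul_assoc]
  exact mul_le_mul_of_nonpos_left
    (tsum_sum_nearIndicator_sub_le hX hs (nearIndicator_background hs h1 hl hg)) he0

end CornerBound

/-! ### The energies of the striped configurations -/

section Stripes

theorem sin_stripe_pos_iff {h : ℕ} (h1 : 1 ≤ h) (m : ℤ) :
    0 < Real.sin (Real.pi * ((m : ℝ) + 1 / 2) / h) ↔ Even (m / (h : ℤ)) := by
  have hm := Int.mul_ediv_add_emod m h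
  set q := m / (h : ℤ) with hq
  set r := m % (h : ℤ) with hr
  have hr0 : 0 ≤ r := Int.emod_nonneg _ (by omega)
  have hr1 : r + 1 ≤ h := Int.emod_lt_of_pos _ (by omega)
  have hh : (0 : ℝ) < h := by exact_mod_cast h1
  have e : Real.pi * ((m : ℝ) + 1 / 2) / h = Real.pi * (((r : ℝ) + 1 / 2) / h) + q * Real.pi := by
    rw [← hm]; push_cast; field_simp; ring
  have hr0' : (0 : ℝ) ≤ r := by exact_mod_cast hr0
  have hr1' : (r : ℝ) + 1 ≤ h := by exact_mod_cast hr1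
  have hpos : 0 < Real.sin (Real.pi * (((r : ℝ) + 1 / 2) / h)) := by
    refine Real.sin_pos_of_pos_of_lt_pi (by positivity) ?_
    refine mul_lt_of_lt_one_right Real.pi_pos ?_
    rw [div_lt_one hh]; linarith
  rw [e, Real.sin_add_int_mul_pi]
  rcases Int.even_or_odd q with h2 | h2
  · rw [h2.neg_one_zpow, one_mul]; exact ⟨fun _ => h2, fun _ => hpos⟩
  · rw [h2.neg_one_zpow]
    refine ⟨fun h => by linarith, fun h => absurd h (Int.not_even_iff_odd.2 h2)⟩

theorem stripes_eq {d : ℕ} [NeZero d] {h : ℕ} (h1 : 1 ≤ h) (x : Site d) :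
    stripes d h x = altStripes h (x 0) := by
  classical
  unfold stripes altStripes
  rw [Int.negOnePow_def]
  by_cases h2 : Even (x 0 / (h : ℤ))
  · rw [if_pos ((sin_stripe_pos_iff h1 _).2 h2), h2.neg_one_zpow]
  · rw [if_neg (mt (sin_stripe_pos_iff h1 _).1 h2), (Int.not_even_iff_odd.1 h2).neg_one_zpow]

theorem sum_range_add_of_periodic {f : ℤ → ℝ} {N : ℕ} (hf : ∀ k, f (k + N) = f k) (n : ℕ) :
    ∑ k ∈ Finset.range N, f (k + n) = ∑ k ∈ Finset.range N, f k := by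
  induction n with
  | zero => simp
  | succ n ih =>
    rw [← ih]
    have h1 := Finset.sum_range_succ (fun k : ℕ => f (k + n)) N
    have h2 := Finset.sum_range_succ' (fun k : ℕ => f (k + n)) N
    have h3 : f ((N : ℤ) + n) = f (((0 : ℕ) : ℤ) + n) := by
      rw [add_comm, hf]; simp
    rw [h1, h3] at h2
    have h4 := add_right_cancel h2
    rw [h4]
    refine Finset.sum_congr rfl fun k _ => ?_
    congr 1; push_cast; ring

/-- The disagreements of the stripes at displacement `n` over a period, as a function of `|n|`. -/
theorem sum_range_dis_altStripes {h : ℕ} (h1 : 1 ≤ h) (n : ℤ) :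
    ∑ k ∈ Finset.range (2 * h), dis (altStripes h k) (altStripes h (k + n)) = 2 * stripeDis h n.natAbs := by
  have hper : ∀ (n k : ℤ), dis (altStripes h (k + h)) (altStripes h (k + h + n)) =
      dis (altStripes h k) (altStripes h (k + n)) := by
    intro n k
    rw [add_right_comm, altStripes_add h1, altStripes_add h1, dis_neg_neg]
  have hneg : ∀ n : ℕ, ∑ k ∈ Finset.range (2 * h), dis (altStripes h k) (altStripes h (k + -(n : ℤ))) =
      2 * stripeDis h n := by
    intro n
    rw [two_mul, Finset.sum_range_add, stripeDis, if_neg (by omega)]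
    have : ∀ k : ℕ, dis (altStripes h ((h + k : ℕ) : ℤ)) (altStripes h (((h + k : ℕ) : ℤ) + -(n : ℤ))) =
        dis (altStripes h k) (altStripes h (k + -(n : ℤ))) := by
      intro k
      rw [← hper (-(n : ℤ)) k]; push_cast; rw [add_comm (h : ℤ)]
    simp only [this, sub_eq_add_neg]
    ring
  rcases Int.natAbs_eq n with hn | hn
  · rw [← hneg, ← sum_range_add_of_periodic (f := fun k => dis (altStripes h k) (altStripes h (k + -(n.natAbs : ℤ))))
      (N := 2 * h) (fun k => ?_) n.natAbs]
    · refine Finset.sum_congr rfl fun k _ => ?_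
      rw [add_neg_cancel_right, dis_comm, ← hn]
    · push_cast
      rw [two_mul, ← add_assoc, hper, hper]
  · rw [← hneg, ← hn]

variable {D : ℕ}

theorem siteEnergy_eq {d : ℕ} (J p : ℝ) (s : SpinConfig d) (x : Site d) :
    siteEnergy J p s x = -∑' z, pairWeight J p z * dis (s x) (s (x + z)) := by
  have h1 : ∑' y : {y : Site d // y ≠ x}, pairEnergy J p x y (s x) (s y) =
      ∑' y, pairEnergy J p x y (s x) (s y) := by
    refine tsum_subtype_eq_of_support_subset (s := {y : Site d | y ≠ x})
      (f := fun y => pairEnergy J p x y (s x) (s y)) fun y hy => ?_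
    rintro rfl
    apply hy
    simp [pairEnergy_eq, dis_self]
  rw [siteEnergy, h1, ← (Equiv.addLeft x).tsum_eq]
  simp only [pairEnergy_eq, Equiv.coe_addLeft, add_sub_cancel_left, mul_assoc]
  rw [tsum_mul_left]
  ring

theorem abs_dis_le_one (a b : ℤˣ) : |dis a b| ≤ 1 := by
  rw [abs_of_nonneg (dis_nonneg _ _)]; exact dis_le_one _ _

/-- The energy per site of the stripes of width `h` is the energy of a wall divided by `h`. -/
theorem stripeEnergy_eq {p : ℝ} (hp : (D : ℝ) + 2 < p) (J : ℝ) {h : ℕ} (h1 : 1 ≤ h) :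
    stripeEnergy (D + 1) J p h = widthEnergy J (lineWeight D p) h / h := by
  have hh : (0 : ℝ) < h := by exact_mod_cast h1
  have hp' : ((D + 1 : ℕ) : ℝ) < p := by push_cast; linarith
  set f : ℤ → ℝ := fun n => 2 * stripeDis h n.natAbs with hf
  have hfsum : ∀ n, f n = ∑ k ∈ Finset.range (2 * h), dis (altStripes h k) (altStripes h (k + n)) :=
    fun n => (sum_range_dis_altStripes h1 n).symm
  have hf0 : f 0 = 0 := by simp [hf, stripeDis_zero_right]
  have hfn : ∀ n, f (-n) = f n := by intro n; simp [hf]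
  have hfb : ∀ n, |f n| ≤ 2 * h := by
    intro n
    rw [hfsum]
    refine (Finset.abs_sum_le_sum_abs _ _).trans ?_
    refine (Finset.sum_le_sum fun k _ => abs_dis_le_one _ _).trans ?_
    simp
  have hs : ∑ k ∈ Finset.range (2 * h), siteEnergy J p (stripes (D + 1) h) (Pi.single 0 (k : ℤ)) =
      -∑' z : Site (D + 1), pairWeight J p z * f (z 0) := by
    have e : ∀ k : ℕ, siteEnergy J p (stripes (D + 1) h) (Pi.single 0 (k : ℤ)) =
        -∑' z : Site (D + 1), pairWeight J p z * dis (altStripes h k) (altStripes h (k + z 0)) := by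
      intro k
      rw [siteEnergy_eq]
      simp [stripes_eq h1]
    simp only [e, Finset.sum_neg_distrib, hfsum, Finset.mul_sum]
    rw [Summable.tsum_finsetSum fun k _ => summable_pairWeight_mul hp' J fun z => abs_dis_le_one _ _]
  have hs2 : ∑' z : Site (D + 1), pairWeight J p z * f (z 0) =
      2 * (∑' n : ℕ, lineWeight D p n * f ((n + 1 : ℕ) : ℤ)) - 2 * J * f 1 := by
    have hsum : Summable fun z : Site (D + 1) => decay p z * f (z 0) :=
      summable_mul_of_abs_le hp' fun z => hfb _
    simp only [pairWeight, sub_mul]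
    rw [hsum.tsum_sub (summable_siteNorm_eq_one J _), tsum_siteNorm_eq_one_mul J hf0 hfn]
    obtain ⟨h2, h3⟩ := tsum_decay_mul 0 hsum
    rw [← h3, tsum_transverseSum_even h2 hf0 hfn]
  have hf1 : f 1 = 2 := by
    have := stripeDis_eq (h := h) (n := 1) h1
    simp [hf, this]
  have hfv : ∀ n : ℕ, lineWeight D p n * f ((n + 1 : ℕ) : ℤ) = 2 * (lineWeight D p n * stripeDis h (n + 1)) := by
    intro n
    simp only [hf, Int.natAbs_natCast]
    ring
  simp only [hfv, tsum_mul_left, hf1] at hs2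
  rw [stripeEnergy, hs, hs2, widthEnergy]
  field_simp
  ring

theorem criticalCoupling_eq {p : ℝ} (hp : (D : ℝ) + 2 < p) :
    criticalCoupling (D + 1) p = ∑' n : ℕ, lineWeight D p n * (n + 1) := by
  set f : ℤ → ℝ := fun n => if 0 < n then (n : ℝ) else 0 with hf
  have hsum : Summable fun y : Site (D + 1) => decay p y * f (y 0) := by
    refine Summable.of_nonneg_of_le (fun y => mul_nonneg (decay_nonneg _ _) ?_) (fun y => ?_)
      (summable_decay_mul_abs_rpow (D := D) (p := p) (q := 1) (by linarith) zero_le_one 0)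
    · simp only [hf]; split_ifs with h
      · exact_mod_cast h.le
      · rfl
    · refine mul_le_mul_of_nonneg_left ?_ (decay_nonneg _ _)
      rw [Real.rpow_one]
      simp only [hf]; split_ifs
      · exact le_abs_self _
      · exact abs_nonneg _
  have h1 : criticalCoupling (D + 1) p = ∑' y : Site (D + 1), decay p y * f (y 0) := by
    rw [criticalCoupling]
    have e : ∀ y : {y : Site (D + 1) // 0 < y 0}, (y.1 0 : ℝ) / siteDist y.1 0 ^ p =
        (fun y : Site (D + 1) => decay p y * f (y 0)) y.1 := by
      intro y
      simp only [hf, if_pos y.2, decay, siteDist_eq, zero_sub, siteNorm_neg]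
      ring
    rw [tsum_congr e]
    refine tsum_subtype_eq_of_support_subset (s := {y : Site (D + 1) | 0 < y 0})
      (f := fun y : Site (D + 1) => decay p y * f (y 0)) fun y hy => ?_
    by_contra hne
    apply hy
    simp only [hf]
    rw [if_neg (show ¬ 0 < y 0 from hne), mul_zero]
  rw [h1, ← (tsum_decay_mul 0 hsum).2]
  have hinj : Function.Injective fun n : ℕ => ((n + 1 : ℕ) : ℤ) := fun a b h => by simpa using h
  rw [← hinj.tsum_eq (f := fun n : ℤ => transverseSum D p n * f n)]
  · refine tsum_congr fun n => ?_
    simp only [hf]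
    rw [if_pos (by positivity)]
    push_cast; rfl
  · intro n hn
    by_cases h0 : 0 < n
    · exact ⟨n.toNat - 1, by simp only; omega⟩
    · exact absurd (by simp only [hf]; rw [if_neg h0, mul_zero]) hn

section WidthEnergy
variable {v : ℕ → ℝ}

theorem widthEnergy_zero (J : ℝ) : widthEnergy J v 0 = 2 * (J - ∑' n, v n * (n + 1)) := by
  simp [widthEnergy, stripeDis]
  ring

/-- Walls repel each other. -/
theorem two_mul_sub_le_widthEnergy (hv : IsLaplaceWeight v) (J : ℝ) (h : ℕ) :
    2 * (J - ∑' n, v n * (n + 1)) ≤ widthEnergy J v h := by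
  have := (hv.summable_stripeDis h).tsum_le_tsum (fun n => mul_le_mul_of_nonneg_left
    (by exact_mod_cast stripeDis_le h (n + 1)) (hv.1 n)) hv.2.1
  rw [widthEnergy]
  linarith

/-- Walls at distance `h` repel each other with an energy of order `h ^ (1 - q)`. -/
theorem widthEnergy_le (hv : IsLaplaceWeight v) (J : ℝ) {q : ℝ} (hq : 1 ≤ q)
    (hvq : Summable fun n : ℕ => v n * ((n : ℝ) + 1) ^ q) {h : ℕ} (h1 : 1 ≤ h) :
    widthEnergy J v h ≤ 2 * (J - ∑' n, v n * (n + 1)) +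
      2 * (∑' n, v n * ((n : ℝ) + 1) ^ q) * (h : ℝ) ^ (1 - q) := by
  have hh : (0 : ℝ) < h := by exact_mod_cast h1
  have hle : ∀ n : ℕ, v n * (n + 1) - v n * stripeDis h (n + 1) ≤
      v n * ((n : ℝ) + 1) ^ q * (h : ℝ) ^ (1 - q) := by
    intro n
    have hn : (0 : ℝ) < (n : ℝ) + 1 := by positivity
    rw [← mul_sub, mul_assoc]
    refine mul_le_mul_of_nonneg_left ?_ (hv.1 n)
    by_cases hnh : n + 1 ≤ h
    · rw [stripeDis_eq hnh]
      push_cast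
      rw [sub_self]; positivity
    · have h2 : (h : ℝ) ≤ (n : ℝ) + 1 := by exact_mod_cast (not_le.1 hnh).le
      have h3 : ((n : ℝ) + 1) ^ (1 - q) ≤ (h : ℝ) ^ (1 - q) :=
        Real.rpow_le_rpow_of_nonpos hh h2 (by linarith)
      have h4 := mul_le_mul_of_nonneg_left h3 (Real.rpow_nonneg hn.le q)
      rw [← Real.rpow_add hn, add_sub_cancel, Real.rpow_one] at h4
      linarith [stripeDis_nonneg h (n + 1)]
  have := (hv.2.1.sub (hv.summable_stripeDis h)).tsum_le_tsum hle (hvq.mul_right _)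
  rw [hv.2.1.tsum_sub (hv.summable_stripeDis h), tsum_mul_right] at this
  rw [widthEnergy]
  linarith

theorem summable_lineWeight_mul_rpow {p q : ℝ} (hp : (D : ℝ) + 1 < p - q) (hq : 0 ≤ q) :
    Summable fun n : ℕ => lineWeight D p n * ((n : ℝ) + 1) ^ q := by
  refine (tsum_nat_lineWeight (f := fun n => |(n : ℝ)| ^ q) 0 (summable_decay_mul_abs_rpow hp hq 0)).congr
    fun n => ?_
  push_cast
  rw [abs_of_nonneg (by positivity)]

end WidthEnergy
end Stripes

/-! ### Choice of the parameters -/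

section Parameters

/-- The consequences of the bounds `-2τ ≤ E h ≤ -2τ + 2 C h ^ (-γ)` on the energies of the walls, for a
trial width `H` at which the repulsion of the walls is at most `τ`. -/
theorem exists_optimal_energy {E : ℕ → ℝ} {τ C γ : ℝ} (hτ : 0 < τ) (h0 : E 0 = -(2 * τ))
    (hlow : ∀ h, -(2 * τ) ≤ E h) (hup : ∀ h : ℕ, 1 ≤ h → E h ≤ -(2 * τ) + 2 * C * (h : ℝ) ^ (-γ))
    {H : ℕ} (hH : 1 ≤ H) (hHC : 2 * C ≤ τ * (H : ℝ) ^ γ) (D : ℕ) :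
    ∃ e : ℝ, e < 0 ∧ ∃ l : ℕ, (∃ h : ℕ, 1 ≤ h ∧ ∀ k : ℕ, 1 ≤ k → E h / h ≤ E k / k) ∧
      (∀ h : ℕ, 1 ≤ h → (∀ k : ℕ, 1 ≤ k → E h / h ≤ E k / k) → h ≤ l ∧ E h = e * h) ∧
      (∀ h, e * capWidth l h ≤ E h) ∧
      -e * ((l + 1 : ℕ) : ℝ) ^ (D + 1) ≤ 6 * 3 ^ D * (τ * (H : ℝ) ^ D) := by
  have hH0 : (0 : ℝ) < H := by exact_mod_cast hH
  have hH1 : (1 : ℝ) ≤ H := by exact_mod_cast hH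
  have hEH : E H ≤ -τ := by
    have h1 := mul_le_mul_of_nonneg_right hHC (Real.rpow_nonneg hH0.le (-γ))
    rw [mul_assoc τ, ← Real.rpow_add hH0, add_neg_cancel, Real.rpow_zero] at h1
    linarith [hup H hH]
  -- wide stripes cannot be better than the trial width
  have hwide : ∀ k : ℕ, 1 ≤ k → E k / k ≤ E H / H → k ≤ 2 * H := by
    intro k hk hkH
    have hk0 : (0 : ℝ) < k := by exact_mod_cast hk
    rw [div_le_div_iff₀ hk0 hH0] at hkH
    have h1 := mul_le_mul_of_nonneg_right (hlow k) hH0.le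
    have h2 := mul_le_mul_of_nonneg_right hEH hk0.le
    have h3 : τ * k ≤ τ * (2 * H) := by linarith
    exact_mod_cast le_of_mul_le_mul_left h3 hτ
  obtain ⟨h₀, hh₀, hmin⟩ := (Finset.Icc 1 (2 * H)).exists_min_image (fun k : ℕ => E k / k)
    ⟨H, Finset.mem_Icc.2 ⟨hH, by omega⟩⟩
  have h₀1 : 1 ≤ h₀ := (Finset.mem_Icc.1 hh₀).1
  have hopt : ∀ k : ℕ, 1 ≤ k → E h₀ / h₀ ≤ E k / k := by
    intro k hk
    by_cases hkH : k ≤ 2 * H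
    · exact hmin k (Finset.mem_Icc.2 ⟨hk, hkH⟩)
    · exact (hmin H (Finset.mem_Icc.2 ⟨hH, by omega⟩)).trans (le_of_lt (not_le.1 (mt (hwide k hk) hkH)))
  set e := E h₀ / h₀ with he
  have heH : e ≤ -(τ / H) := by
    refine (hopt H hH).trans ?_
    rw [← neg_div]
    gcongr
  have he0 : e < 0 := heH.trans_lt (by simp only [neg_neg_iff_pos]; positivity)
  have hne : 0 < -e := by linarith
  have heτ : -e ≤ 2 * τ := by
    have h₀0 : (1 : ℝ) ≤ h₀ := by exact_mod_cast h₀1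
    rw [he, ← neg_div, div_le_iff₀ (by linarith)]
    nlinarith [hlow h₀]
  set l := ⌈2 * τ / -e⌉₊ with hl
  have hl1 : 2 * τ / -e ≤ l := Nat.le_ceil _
  have hel : e * l ≤ -(2 * τ) := by
    rw [div_le_iff₀ hne] at hl1
    linarith
  have hlH : l ≤ 2 * H := by
    refine Nat.ceil_le.2 ?_
    rw [div_le_iff₀ hne]
    have := (div_le_iff₀ hH0).1 (show τ / H ≤ -e by linarith)
    push_cast
    linarith
  refine ⟨e, he0, l, ⟨h₀, h₀1, hopt⟩, fun h h1 hh => ?_, fun h => ?_, ?_⟩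
  · have hh0 : (0 : ℝ) < h := by exact_mod_cast h1
    have h2 : E h / h = e := le_antisymm (hh h₀ h₀1) (hopt h h1)
    have h3 : E h = e * h := by rw [← h2]; field_simp
    refine ⟨?_, h3⟩
    have h4 := hlow h
    rw [h3] at h4
    have h5 : (h : ℝ) ≤ 2 * τ / -e := by rw [le_div_iff₀ hne]; linarith
    exact_mod_cast h5.trans hl1
  · unfold capWidth
    split_ifs with hh
    · rw [hh, h0]; exact hel
    · rcases le_total h l with hhl | hhl
      · rw [min_eq_left hhl]
        have hh0 : (0 : ℝ) < h := by exact_mod_cast Nat.pos_of_ne_zero hh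
        exact (le_div_iff₀ hh0).1 (hopt h (by omega))
      · rw [min_eq_right hhl]
        exact hel.trans (hlow h)
  · have h1 : -e * ((l + 1 : ℕ) : ℝ) ≤ 6 * τ := by
      have h2 : (l : ℝ) < 2 * τ / -e + 1 := Nat.ceil_lt_add_one (by positivity)
      have h3 := mul_le_mul_of_nonneg_left h2.le hne.le
      rw [mul_add, mul_div_cancel₀ _ hne.ne'] at h3
      push_cast
      linarith
    have h2 : ((l + 1 : ℕ) : ℝ) ≤ 3 * H := by
      have : (l : ℝ) ≤ 2 * H := by exact_mod_cast hlH
      push_cast; linarith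
    calc -e * ((l + 1 : ℕ) : ℝ) ^ (D + 1) = (-e * ((l + 1 : ℕ) : ℝ)) * ((l + 1 : ℕ) : ℝ) ^ D := by ring
      _ ≤ (6 * τ) * (3 * H) ^ D := by gcongr
      _ = _ := by rw [mul_pow]; ring

/-- For `γ > D` there is a trial width at which the repulsion of the walls is small while the width is
not too large. -/
theorem exists_trial_width {C γ δ : ℝ} {D : ℕ} (hC : 0 ≤ C) (hγ : (D : ℝ) < γ) (hδ : 0 < δ) :
    ∃ ε : ℝ, 0 < ε ∧ ∀ τ : ℝ, 0 < τ → τ < ε →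
      ∃ H : ℕ, 1 ≤ H ∧ 2 * C ≤ τ * (H : ℝ) ^ γ ∧ τ * (H : ℝ) ^ D < δ := by
  have hD : (0 : ℝ) ≤ D := Nat.cast_nonneg D
  have hγ0 : 0 < γ := by linarith
  set A : ℝ := 2 * C + 1 with hA
  have hA0 : 0 < A := by linarith
  set b : ℝ := 1 - D / γ with hb
  have hb0 : 0 < b := by
    rw [hb, sub_pos, div_lt_one hγ0]; exact hγ
  have hlim : ContinuousAt (fun τ : ℝ => 2 ^ D * A ^ ((D : ℝ) / γ) * τ ^ b) 0 :=
    (Real.continuousAt_rpow_const 0 b (Or.inr hb0.le)).const_mul _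
  obtain ⟨ε, hε, hlim⟩ := Metric.continuousAt_iff.1 hlim δ hδ
  refine ⟨min ε A, lt_min hε hA0, fun τ hτ hτε => ?_⟩
  have h1 := hlim (x := τ) (by
    rw [dist_zero_right, Real.norm_of_nonneg hτ.le]; exact hτε.trans_le (min_le_left _ _))
  have hτA : τ < A := hτε.trans_le (min_le_right _ _)
  rw [Real.zero_rpow hb0.ne', mul_zero, dist_zero_right] at h1
  have h1 := (le_abs_self _).trans_lt h1
  set x : ℝ := (A / τ) ^ (1 / γ) with hx
  have hx1 : 1 ≤ x := Real.one_le_rpow ((one_le_div hτ).2 hτA.le) (by positivity)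
  have hH : x ≤ (⌈x⌉₊ : ℝ) := Nat.le_ceil x
  refine ⟨⌈x⌉₊, Nat.one_le_cast.1 (hx1.trans hH), ?_, lt_of_le_of_lt ?_ h1⟩
  · have h2 : x ^ γ = A / τ := by
      rw [hx, ← Real.rpow_mul (by positivity), one_div, inv_mul_cancel₀ hγ0.ne', Real.rpow_one]
    have h3 : x ^ γ ≤ (⌈x⌉₊ : ℝ) ^ γ := Real.rpow_le_rpow (by linarith) hH hγ0.le
    rw [h2, div_le_iff₀ hτ] at h3
    linarith
  · have h2 : (⌈x⌉₊ : ℝ) ≤ 2 * x := by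
      linarith [Nat.ceil_lt_add_one (show 0 ≤ x by linarith)]
    have h3 : x ^ D = A ^ ((D : ℝ) / γ) / τ ^ ((D : ℝ) / γ) := by
      rw [hx, ← Real.rpow_natCast, ← Real.rpow_mul (by positivity), one_div_mul_eq_div,
        Real.div_rpow hA0.le hτ.le]
    calc τ * (⌈x⌉₊ : ℝ) ^ D ≤ τ * (2 * x) ^ D := by gcongr
      _ = 2 ^ D * A ^ ((D : ℝ) / γ) * τ ^ b := by
        rw [mul_pow, h3, hb, Real.rpow_sub hτ, Real.rpow_one]; ring

end Parameters

/-! ### Ground states and their sectors -/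

section Rotation

/-- The first row of an orthogonal integer matrix is a unit vector up to sign, so that rotated stripes depend
on one coordinate only. -/
theorem exists_isWall_iff_of_stripes {d : ℕ} [NeZero d] {h : ℕ} (h1 : 1 ≤ h)
    {R : Matrix (Fin d) (Fin d) ℤ} (hR : R * R.transpose = 1) (v : Site d) :
    ∃ (i₀ : Fin d) (g : ℤ → ℤˣ) (a : ℤ), (∀ x, stripes d h (R.mulVec x + v) = g (x i₀)) ∧
      ∀ m, IsWall g m ↔ (h : ℤ) ∣ m - a := by
  have hrow : ∑ j, R 0 j ^ 2 = 1 := by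
    have := congrFun (congrFun hR 0) 0
    rw [Matrix.mul_apply, Matrix.one_apply_eq] at this
    rw [← this]
    exact Finset.sum_congr rfl fun j _ => by rw [Matrix.transpose_apply, sq]
  obtain ⟨i₀, hi₀⟩ : ∃ i, R 0 i ≠ 0 := by
    by_contra! h
    simp [h] at hrow
  have hpos : 1 ≤ R 0 i₀ ^ 2 := Int.add_one_le_iff.2 (sq_pos_iff.2 hi₀)
  rw [← Finset.add_sum_erase _ _ (Finset.mem_univ i₀)] at hrow
  have hrest : 0 ≤ ∑ j ∈ Finset.univ.erase i₀, R 0 j ^ 2 := Finset.sum_nonneg fun _ _ => sq_nonneg _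
  have hzero : ∀ j, j ≠ i₀ → R 0 j = 0 := by
    intro j hj
    have := (Finset.sum_eq_zero_iff_of_nonneg (fun j _ => sq_nonneg (R 0 j))).1
      (show ∑ j ∈ Finset.univ.erase i₀, R 0 j ^ 2 = 0 by linarith) j (by simp [hj])
    exact pow_eq_zero_iff two_ne_zero |>.1 this
  have happ : ∀ x : Site d, (R.mulVec x + v) 0 = R 0 i₀ * x i₀ + v 0 := by
    intro x
    rw [Pi.add_apply, Matrix.mulVec, dotProduct, Finset.sum_eq_single i₀]
    · intro j _ hj; rw [hzero j hj, zero_mul]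
    · simp
  have hsq : R 0 i₀ ^ 2 = 1 := by linarith
  have hx : ∀ x : Site d, stripes d h (R.mulVec x + v) = altStripes h (R 0 i₀ * x i₀ + v 0) :=
    fun x => by rw [stripes_eq h1, happ]
  rcases (sq_eq_one_iff).1 hsq with hu | hu
  · refine ⟨i₀, fun m => altStripes h (R 0 i₀ * m + v 0), -v 0, hx, fun m => ?_⟩
    rw [sub_neg_eq_add, ← isWall_altStripes h1, IsWall, IsWall, hu, one_mul, one_mul, sub_add_eq_add_sub]
  · refine ⟨i₀, fun m => altStripes h (R 0 i₀ * m + v 0), v 0 + 1, hx, fun m => ?_⟩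
    rw [← dvd_neg, ← isWall_altStripes h1, IsWall, IsWall, ne_comm, hu,
      show -1 * (m - 1) + v 0 = -(m - (v 0 + 1)) by ring,
      show -1 * m + v 0 = -(m - (v 0 + 1)) - 1 by ring]

end Rotation

section Sector

theorem defect_swap {G : Type*} [AddCommGroup G] (t s : G → ℤˣ) (y : G) :
    defect s t y = -defect t s y := by
  unfold defect
  rw [← tsum_neg]
  simp only [neg_sub]

/-- A striped configuration that optimizes the energy of its walls, among perturbations whose corners
outweigh their other gains, is a ground state with trivial sector. -/
theorem isGroundState_and_sector_eq {d : ℕ} (hd : 2 ≤ d) {J p κ : ℝ} (hp : (d : ℝ) < p) (hκ : 0 < κ)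
    {s : SpinConfig d} {i₀ : Fin d} {g : ℤ → ℤˣ} (hs : ∀ x, s x = g (x i₀))
    (hbound : ∀ t : SpinConfig d, {x | t x ≠ s x}.Finite →
      κ * (cornerSites t).ncard ≤ -∑' y, pairWeight J p y * defect t s y) :
    IsGroundState J p s ∧ sector J p s = {s} := by
  classical
  have hground : IsGroundState J p s := by
    intro X σ
    set t : SpinConfig d := fun x => if x ∈ X then σ x else s x with ht
    have hX : {x | t x ≠ s x}.Finite := X.finite_toSet.subset fun x hx => by
      by_contra hxX
      exact hx (if_neg hxX)
    rw [hamiltonian_sub_eq hp X (t := t) (fun x hx => if_pos hx) fun x hx => if_neg hx]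
    exact le_trans (by positivity) (hbound t hX)
  refine ⟨hground, Set.eq_singleton_iff_unique_mem.2 ⟨⟨hground, by simp⟩, fun t ht => ?_⟩⟩
  obtain ⟨ht, hX⟩ := ht
  have h1 := ht hX.toFinset s
  rw [hamiltonian_sub_eq hp _ (t := s) (fun _ _ => rfl) fun x hx => by
    by_contra hne; exact hx (hX.mem_toFinset.2 (Ne.symm hne))] at h1
  simp only [defect_swap t s, mul_neg, tsum_neg, neg_neg] at h1
  have h2 := hbound t hX
  have h3 : ((cornerSites t).ncard : ℝ) ≤ 0 := by
    by_contra hne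
    have := mul_pos hκ (not_le.1 hne)
    linarith
  have h4 : (cornerSites t).ncard = 0 := by exact_mod_cast le_antisymm h3 (Nat.cast_nonneg _)
  rw [Set.ncard_eq_zero (finite_cornerSites hX hs)] at h4
  exact eq_of_cornerSites_eq_empty hd hX hs h4

end Sector

theorem theorem1 (d : ℕ) [NeZero d] (hd : 2 ≤ d) (p : ℝ) (hp : 2 * (d : ℝ) < p) :
    ∃ ε : ℝ, 0 < ε ∧ ∀ J : ℝ, criticalCoupling d p - ε < J → J < criticalCoupling d p →
      (∃ h : ℕ, IsOptimalWidth d J p h) ∧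
      ∀ s : SpinConfig d, IsOptimalStriped J p s →
        IsGroundState J p s ∧ sector J p s = {s} := by
  obtain ⟨D, rfl⟩ : ∃ D, d = D + 1 := ⟨d - 1, by omega⟩
  have hD : (1 : ℝ) ≤ D := by exact_mod_cast (show 1 ≤ D by omega)
  push_cast at hp
  have hp2 : (D : ℝ) + 2 < p := by linarith
  have hv := isLaplaceWeight_lineWeight hp2
  have hvq := summable_lineWeight_mul_rpow (D := D) (p := p) (q := p / 2) (by linarith) (by linarith)
  set C : ℝ := ∑' n : ℕ, lineWeight D p n * ((n : ℝ) + 1) ^ (p / 2) with hC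
  have hC0 : 0 ≤ C := tsum_nonneg fun n => mul_nonneg (hv.1 n) (by positivity)
  set c₀ : ℝ := 1 / Real.sqrt 2 ^ p / (2 * ((D + 1 : ℕ) : ℝ) ^ 2) with hc₀
  have hc₀0 : 0 < c₀ := by
    have : 0 < Real.sqrt 2 ^ p := by positivity
    positivity
  obtain ⟨ε, hε, htrial⟩ := exists_trial_width (C := C) (γ := p / 2 - 1) (D := D)
    (δ := c₀ / (((D + 1 : ℕ) : ℝ) * (6 * 3 ^ D))) hC0 (by linarith) (by positivity)
  refine ⟨ε, hε, fun J hJ1 hJ2 => ?_⟩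
  obtain ⟨H, hH, hHC, hHδ⟩ := htrial (criticalCoupling (D + 1) p - J) (by linarith) (by linarith)
  have hJc := criticalCoupling_eq hp2
  rw [lt_div_iff₀ (by positivity)] at hHδ
  obtain ⟨e, he, l, hmin, hopt, hE, hsmall⟩ := exists_optimal_energy
    (E := widthEnergy J (lineWeight D p)) (τ := criticalCoupling (D + 1) p - J) (C := C) (γ := p / 2 - 1)
    (by linarith) (by rw [widthEnergy_zero, hJc]; ring)
    (fun h => by
      have := two_mul_sub_le_widthEnergy hv J h
      rw [← hJc] at this; linarith)
    (fun h h1 => by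
      have := widthEnergy_le hv J (by linarith) hvq h1
      rw [← hJc] at this
      rw [neg_sub]; linarith)
    hH hHC D
  have hκ : 0 < c₀ + e * (((D + 1 : ℕ) : ℝ) * ((l + 1 : ℕ) : ℝ) ^ (D + 1)) := by
    have h1 := mul_le_mul_of_nonneg_left hsmall (Nat.cast_nonneg (α := ℝ) (D + 1))
    linarith
  have hiff : ∀ h : ℕ, IsOptimalWidth (D + 1) J p h ↔ 1 ≤ h ∧ ∀ k : ℕ, 1 ≤ k →
      widthEnergy J (lineWeight D p) h / h ≤ widthEnergy J (lineWeight D p) k / k := by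
    intro h
    refine and_congr_right fun h1 => forall₂_congr fun k hk => ?_
    rw [stripeEnergy_eq hp2 J h1, stripeEnergy_eq hp2 J hk]
  refine ⟨?_, ?_⟩
  · obtain ⟨h, hh⟩ := hmin
    exact ⟨h, (hiff h).2 hh⟩
  · rintro s ⟨h, hh, R, v, hR, -, hsR⟩
    obtain ⟨h1, hh⟩ := (hiff h).1 hh
    obtain ⟨hl, he2⟩ := hopt h h1 hh
    obtain ⟨i₀, g, a, hg1, hg2⟩ := exists_isWall_iff_of_stripes h1 hR v
    have hs : ∀ x, s x = g (x i₀) := fun x => by rw [hsR, hg1]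
    exact isGroundState_and_sector_eq hd (by push_cast; linarith) hκ hs fun t hX =>
      ncard_cornerSites_le_energy hp2 he.le hE hX hs h1 hl he2 hg2
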